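/- Let $M$ be a compact connected smooth $n$-manifold without boundary, let $\mu$ be a smooth positive volume density on $M$ with $\int_M\mu=1$ (for oriented $M$: a volume form), and let $n/2<s\le\infty$, where $H^\infty=C^\infty$. Let $$\mathrm{Dens}^s(M)=\Big\{\rho\in H^s(M)\;\Big|\;\rho>0,\ \int_M\rho\,\mu=1\Big\},\qquad T^*\mathrm{Dens}^s(M)=\mathrm{Dens}^s(M)\times H^s(M)/\mathbb R,$$ an open subset of an affine space modelled on $H^s_0(M)\times H^s(M)/\mathbb R$, where $H^s_0(M)=\{f\in H^s(M)\mid\int_M f\mu=0\}$. Tangent vectors at $(\rho,[\theta])$ are written as pairs $(\dot\rho,\dot\theta)\in H^s(M)\times H^s(M)$ with $\int_M\dot\rho\,\mu=0$ and $\int_M\dot\theta\rho\,\mu=0$. Consider the Sasaki–Fisher–Rao metric $$\mathsf G^*_{(\rho,[\theta])}\big((\dot\rho_1,\dot\theta_1),(\dot\rho_2,\dot\theta_2)\big)=\frac14\int_M\Big(\frac{\dot\rho_1\dot\rho_2}{\rho}+\dot\theta_1\dot\theta_2\rho\Big)\mu$$ and the canonical symplectic form scaled by $1/4$, $$\Omega\big((\dot\rho_1,\dot\theta_1),(\dot\rho_2,\dot\theta_2)\big)=\frac14\int_M\big(\dot\theta_1\dot\rho_2-\dot\theta_2\dot\rho_1\big)\mu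 .$$ Then $T^*\mathrm{Dens}^s(M)$ with $\mathsf G^*$, $\Omega$ and the almost complex structure $$J_{(\rho,[\theta])}(\dot\rho,\dot\theta)=\Big(\dot\theta\rho,\,-\frac{\dot\rho}{\rho}\Big)$$ is a (weak) Kähler manifold: $\mathsf G^*$ is a smooth weak Riemannian metric, $\Omega$ is a smooth closed weakly nondegenerate two-form, $J$ is smooth with $J^2=-1$ and integrable (around every point there is a chart with values in a complex locally convex space whose differential carries $J$ to multiplication by $i$), $\mathsf G^*(J\cdot,J\cdot)=\mathsf G^*$ and $\Omega(\cdot,\cdot)=\mathsf G^*(J\cdot,\cdot)$. Moreover, let $\mathbb PH^s(M,\mathbb C)$ be the complex projective space of $H^s(M,\mathbb C)$, with $\langle\phi,\psi\rangle=\int_M\phi\overline\psi\,\mu$ and the Fubini–Study Hermitian form $$h_\psi(u,v)=\frac{\langle u,v\rangle}{\langle\psi,\psi\rangle}-\frac{\langle u,\psi\rangle\langle\psi,v\rangle}{\langle\psi,\psi\rangle^2}.$$ With the Fubini–Study metric $\mathrm{Re}\,h$, the symplectic form $\mathrm{Im}\,h$ (which is $\int_M\mathrm{Im}(\dot\psi_1\overline{\dot\psi_2})\,\mu$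 for tangent vectors to the unit $L^2$-sphere) and the complex structure determined by them through $\Omega(\cdot,\cdot)=\mathsf g(J\cdot,\cdot)$, namely multiplication by $-i$, it is a (weak) Kähler manifold, and the Madelung transform $$\mathbf\Phi\colon T^*\mathrm{Dens}^s(M)\to\mathbb PH^s(M,\mathbb C),\qquad(\rho,[\theta])\mapsto\big[\sqrt\rho\,e^{i\theta/2}\big],$$ is a Kähler isomorphism onto an open subset of $\mathbb PH^s(M,\mathbb C)$: it is a diffeomorphism onto an open subset, and it preserves the metrics, the symplectic forms and the complex structures. -/

import Mathlib

open scoped Manifold ContDiff Topology ComplexConjugate FourierTransform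

noncomputable section

universe u

namespace Madelung

/-! ### Calculus and Kähler manifolds modelled on locally convex spaces -/

section Calculus

variable {E : Type u} [AddCommGroup E] [Module ℝ E] [TopologicalSpace E]
variable {F : Type u} [AddCommGroup F] [Module ℝ F] [TopologicalSpace F]

/-- `d` is the derivative of `f` at `x` in the direction `v`. -/
def HasDirDeriv (f : E → F) (x v : E) (d : F) : Prop :=
  Filter.Tendsto (fun t : ℝ => t⁻¹ • (f (x + t • v) - f x)) (𝓝[≠] 0) (𝓝 d)

end Calculus

/-- `f` is of class `C^k` on the open set `U` in the sense of Michal and Bastiani: `f` is continuous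
and, for `k > 0`, its directional derivative `(x, v) ↦ df(x; v)` exists and is of class `C^(k-1)` on
`U × E`. -/
def BastianiC {F : Type*} [AddCommGroup F] [Module ℝ F] [TopologicalSpace F] :
    ℕ → ∀ {E : Type u} [AddCommGroup E] [Module ℝ E] [TopologicalSpace E],
      Set E → (E → F) → Prop
  | 0, _, _, _, _, U, f => ContinuousOn f U
  | k + 1, E, _, _, _, U, f => ContinuousOn f U ∧ ∃ df : E × E → F,
      (∀ x ∈ U, ∀ v : E,
        Filter.Tendsto (fun t : ℝ => t⁻¹ • (f (x + t • v) - f x)) (𝓝[≠] 0) (𝓝 (df (x, v)))) ∧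
      BastianiC k (U ×ˢ (Set.univ : Set E)) df

/-- Smoothness of maps between locally convex spaces (on an open set). On Banach spaces this is the
usual notion, and on Fréchet spaces it is the usual notion of a smooth map of Fréchet calculus. -/
def SmoothOn {E : Type u} [AddCommGroup E] [Module ℝ E] [TopologicalSpace E]
    {F : Type*} [AddCommGroup F] [Module ℝ F] [TopologicalSpace F] (U : Set E) (f : E → F) : Prop :=
  ∀ k : ℕ, BastianiC k U f

/-- Hausdorff real locally convex topological vector spaces. -/
structure IsModelSpace (E : Type u) [AddCommGroup E] [Module ℝ E] [TopologicalSpace E] : Prop where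
  isTopologicalAddGroup : IsTopologicalAddGroup E
  continuousSMul : ContinuousSMul ℝ E
  locallyConvex : LocallyConvexSpace ℝ E
  t2 : T2Space E

/-- `J` is integrable on the open set `U`: around every point of `U` there is a smooth chart with
values in a complex locally convex space whose differential turns `J` into multiplication
by `i`. -/
def IsIntegrableOn {E : Type u} [AddCommGroup E] [Module ℝ E] [TopologicalSpace E]
    (U : Set E) (J : E → E → E) : Prop :=
  ∀ x ∈ U, ∃ (F : Type u) (_ : AddCommGroup F) (_ : Module ℂ F) (_ : TopologicalSpace F)
    (_ : IsTopologicalAddGroup F) (_ : ContinuousSMul ℂ F) (_ : LocallyConvexSpace ℝ F)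
    (_ : T2Space F) (κ : OpenPartialHomeomorph E F),
      x ∈ κ.source ∧ κ.source ⊆ U ∧ SmoothOn κ.source κ ∧ SmoothOn κ.target κ.symm ∧
      ∀ y ∈ κ.source, ∀ (v : E) (w : F),
        HasDirDeriv κ y v w → HasDirDeriv κ y (J y v) (Complex.I • w)

/-- `(g, Ω, J)` is a (weak) Kähler structure on the open subset `U` of the locally convex
space `E`. -/
structure IsKahlerOn {E : Type u} [AddCommGroup E] [Module ℝ E] [TopologicalSpace E]
    (U : Set E) (g Ω : E → E → E → ℝ) (J : E → E → E) : Prop where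
  /-- `g` is a smooth weak Riemannian metric. -/
  g_smooth : SmoothOn (U ×ˢ (Set.univ : Set (E × E))) (fun p : E × E × E => g p.1 p.2.1 p.2.2)
  g_symm : ∀ x ∈ U, ∀ u v, g x u v = g x v u
  g_linear : ∀ x ∈ U, ∀ v, IsLinearMap ℝ (fun u => g x u v)
  g_pos : ∀ x ∈ U, ∀ u, u ≠ 0 → 0 < g x u u
  /-- `Ω` is a smooth weak symplectic form. -/
  Ω_smooth : SmoothOn (U ×ˢ (Set.univ : Set (E × E))) (fun p : E × E × E => Ω p.1 p.2.1 p.2.2)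
  Ω_antisymm : ∀ x ∈ U, ∀ u v, Ω x u v = -Ω x v u
  Ω_linear : ∀ x ∈ U, ∀ v, IsLinearMap ℝ (fun u => Ω x u v)
  Ω_nondegenerate : ∀ x ∈ U, ∀ u, (∀ v, Ω x u v = 0) → u = 0
  /-- `dΩ = 0`, evaluated on constant vector fields. -/
  Ω_closed : ∀ x ∈ U, ∀ u v w,
    deriv (fun t : ℝ => Ω (x + t • u) v w) 0 + deriv (fun t : ℝ => Ω (x + t • v) w u) 0 +
      deriv (fun t : ℝ => Ω (x + t • w) u v) 0 = 0
  /-- `J` is a smooth integrable almost complex structure. -/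
  J_smooth : SmoothOn (U ×ˢ (Set.univ : Set E)) (fun p : E × E => J p.1 p.2)
  J_linear : ∀ x ∈ U, IsLinearMap ℝ (J x)
  J_sq : ∀ x ∈ U, ∀ u, J x (J x u) = -u
  J_integrable : IsIntegrableOn U J
  /-- Compatibility of the three structures. -/
  g_J : ∀ x ∈ U, ∀ u v, g x (J x u) (J x v) = g x u v
  Ω_eq : ∀ x ∈ U, ∀ u v, Ω x u v = g x (J x u) v

/-- An atlas on `X` with values in real topological vector spaces, together with the expressions in
each chart of a metric `g`, a two-form `Ω` and an almost complex structure `J`. This is only data: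
what makes it a Kähler manifold is `KahlerAtlas.IsKahler`. -/
structure KahlerAtlas (X : Type u) where
  ι : Type u
  E : ι → Type u
  [addCommGroup : ∀ i, AddCommGroup (E i)]
  [module : ∀ i, Module ℝ (E i)]
  [topologicalSpace : ∀ i, TopologicalSpace (E i)]
  chart : ∀ i, PartialEquiv X (E i)
  g : ∀ i, E i → E i → E i → ℝ
  Ω : ∀ i, E i → E i → E i → ℝ
  J : ∀ i, E i → E i → E i

attribute [instance] KahlerAtlas.addCommGroup KahlerAtlas.module KahlerAtlas.topologicalSpace

namespace KahlerAtlas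

variable {X Y : Type u} [TopologicalSpace X] [TopologicalSpace Y]

/-- The map `f : X → Y` preserves `g`, `Ω` and `J`: its local expressions satisfy
`f^* g = g`, `f^* Ω = Ω` and `df ∘ J = J ∘ df`. -/
def PreservesKahler (A : KahlerAtlas X) (B : KahlerAtlas Y) (f : X → Y) : Prop :=
  ∀ i j, ∀ x ∈ (A.chart i).target, f ((A.chart i).symm x) ∈ (B.chart j).source →
    (∀ u v u' v',
      HasDirDeriv (fun y => B.chart j (f ((A.chart i).symm y))) x u u' →
      HasDirDeriv (fun y => B.chart j (f ((A.chart i).symm y))) x v v' →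
        B.g j (B.chart j (f ((A.chart i).symm x))) u' v' = A.g i x u v ∧
        B.Ω j (B.chart j (f ((A.chart i).symm x))) u' v' = A.Ω i x u v) ∧
    (∀ u u',
      HasDirDeriv (fun y => B.chart j (f ((A.chart i).symm y))) x u u' →
      HasDirDeriv (fun y => B.chart j (f ((A.chart i).symm y))) x (A.J i x u)
        (B.J j (B.chart j (f ((A.chart i).symm x))) u'))

/-- The map `f : X → Y` is smooth in the charts of the two atlases. -/
def IsSmoothMap (A : KahlerAtlas X) (B : KahlerAtlas Y) (f : X → Y) : Prop :=
  ∀ i j, SmoothOn {x | x ∈ (A.chart i).target ∧ f ((A.chart i).symm x) ∈ (B.chart j).source}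
    (fun x => B.chart j (f ((A.chart i).symm x)))

/-- The atlas makes `X` a smooth Hausdorff manifold modelled on locally convex spaces, and the data
`g`, `Ω`, `J` form a Kähler structure on it. -/
structure IsKahler (A : KahlerAtlas X) : Prop where
  t2 : T2Space X
  modelSpace : ∀ i, IsModelSpace (A.E i)
  cover : ∀ p : X, ∃ i, p ∈ (A.chart i).source
  isOpen_source : ∀ i, IsOpen (A.chart i).source
  isOpen_target : ∀ i, IsOpen (A.chart i).target
  continuousOn_chart : ∀ i, ContinuousOn (A.chart i) (A.chart i).source
  continuousOn_symm : ∀ i, ContinuousOn (A.chart i).symm (A.chart i).target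
  /-- Transition maps are smooth. -/
  smooth_transition : IsSmoothMap A A id
  /-- The local expressions of `g`, `Ω` and `J` agree on overlaps. -/
  compatible : PreservesKahler A A id
  kahlerOn : ∀ i, IsKahlerOn (A.chart i).target (A.g i) (A.Ω i) (A.J i)

/-- `f` is an isomorphism of Kähler manifolds from `X` onto an open subset of `Y`: it is a
diffeomorphism onto an open subset, isometric, symplectic and holomorphic. -/
structure IsKahlerOpenEmbedding (A : KahlerAtlas X) (B : KahlerAtlas Y) (f : X → Y) : Prop where
  isOpenEmbedding : Topology.IsOpenEmbedding f
  smooth : IsSmoothMap A B f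
  /-- The inverse of `f` is smooth on the open set `f(X)`. -/
  smooth_inverse : ∀ i j, ∃ h : B.E j → A.E i,
    SmoothOn (B.chart j '' {q | q ∈ (B.chart j).source ∧ q ∈ f '' (A.chart i).source}) h ∧
    ∀ p ∈ (A.chart i).source, f p ∈ (B.chart j).source → h (B.chart j (f p)) = A.chart i p
  preserves : PreservesKahler A B f

end KahlerAtlas

/-! ### Sobolev spaces on a compact manifold -/

section Sobolev

variable (n : ℕ) (M : Type u) [TopologicalSpace M] [ChartedSpace (EuclideanSpace ℝ (Fin n)) M]

/-- A localization: a smooth coordinate chart, a smooth cutoff function supported in its domain, and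
a Sobolev exponent `t ≤ s`. -/
structure Localization (s : WithTop ℝ) where
  chart : OpenPartialHomeomorph M (EuclideanSpace ℝ (Fin n))
  chart_mem : chart ∈ IsManifold.maximalAtlas (𝓡 n) ∞ M
  cutoff : M → ℝ
  smooth : ContMDiff (𝓡 n) 𝓘(ℝ, ℝ) ∞ cutoff
  support : tsupport cutoff ⊆ chart.source
  t : ℝ
  t_le : (t : WithTop ℝ) ≤ s

variable {n M} {s : WithTop ℝ}

/-- The localized function `(χ f) ∘ φ⁻¹`, extended by zero to `ℝⁿ`. -/
def Localization.loc (L : Localization n M s) (f : M → ℂ) : EuclideanSpace ℝ (Fin n) → ℂ :=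
  L.chart.target.indicator fun y => (L.cutoff (L.chart.symm y) : ℂ) * f (L.chart.symm y)

/-- The function `ξ ↦ (1 + |ξ|²)^(t/2) ĥ(ξ)`, where `h = (χ f) ∘ φ⁻¹`; its `L²` norm is the `H^t`
norm of `h`. -/
def Localization.weighted (L : Localization n M s) (f : M → ℂ) : EuclideanSpace ℝ (Fin n) → ℂ :=
  fun ξ => (((1 + ‖ξ‖ ^ 2) ^ (L.t / 2) : ℝ) : ℂ) * 𝓕 (L.loc f) ξ

/-- The image of the support of the cutoff in the coordinate space. -/
def Localization.K (L : Localization n M s) : Set (EuclideanSpace ℝ (Fin n)) :=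
  L.chart '' tsupport L.cutoff

lemma Localization.isCompact_K [CompactSpace M] (L : Localization n M s) : IsCompact L.K :=
  ((isClosed_tsupport _).isCompact).image_of_continuousOn
    (L.chart.continuousOn.mono L.support)

lemma Localization.K_subset (L : Localization n M s) : L.K ⊆ L.chart.target := by
  rintro _ ⟨x, hx, rfl⟩
  exact L.chart.map_source (L.support hx)

lemma Localization.loc_eq_zero (L : Localization n M s) (f : M → ℂ)
    {y : EuclideanSpace ℝ (Fin n)} (hy : y ∉ L.K) : L.loc f y = 0 := by
  by_cases h : y ∈ L.chart.target
  · have : L.cutoff (L.chart.symm y) = 0 := by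
      by_contra h0
      exact hy ⟨_, subset_tsupport _ h0, L.chart.right_inv h⟩
    simp [Localization.loc, this]
  · simp [Localization.loc, h]

lemma Localization.continuous_cutoff (L : Localization n M s) : Continuous L.cutoff :=
  L.smooth.continuous

lemma Localization.integrable_loc [CompactSpace M] (L : Localization n M s) (f : C(M, ℂ)) :
    MeasureTheory.Integrable (L.loc f) := by
  have hc : ContinuousOn (L.loc f) L.K := by
    have h1 : ContinuousOn (fun y => (L.cutoff (L.chart.symm y) : ℂ) * f (L.chart.symm y)) L.K := by
      have h2 : ContinuousOn L.chart.symm L.K := L.chart.symm.continuousOn.mono L.K_subset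
      exact (Complex.continuous_ofReal.comp_continuousOn
        (L.continuous_cutoff.comp_continuousOn h2)).mul (f.continuous.comp_continuousOn h2)
    refine h1.congr fun y hy => ?_
    simp [Localization.loc, L.K_subset hy]
  have h2 := hc.integrableOn_compact (μ := MeasureTheory.volume) L.isCompact_K
  exact h2.integrable_of_forall_notMem_eq_zero fun y hy => L.loc_eq_zero f hy

lemma Localization.loc_add (L : Localization n M s) (f g : M → ℂ) :
    L.loc (f + g) = L.loc f + L.loc g := by
  ext y
  by_cases h : y ∈ L.chart.target <;> simp [Localization.loc, h, mul_add]

lemma Localization.loc_smul (L : Localization n M s) (c : ℂ) (f : M → ℂ) :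
    L.loc (c • f) = c • L.loc f := by
  ext y
  by_cases h : y ∈ L.chart.target <;> simp [Localization.loc, h]
  ring

lemma Localization.weighted_add [CompactSpace M] (L : Localization n M s) (f g : C(M, ℂ)) :
    L.weighted (f + g : C(M, ℂ)) = L.weighted f + L.weighted g := by
  ext ξ
  have : 𝓕 (L.loc (f + g : C(M, ℂ))) ξ = 𝓕 (L.loc f) ξ + 𝓕 (L.loc g) ξ := by
    rw [ContinuousMap.coe_add, L.loc_add]
    have := VectorFourier.fourierIntegral_add (μ := MeasureTheory.volume)
      (e := Real.fourierChar) (L := innerₗ (EuclideanSpace ℝ (Fin n))) Real.continuous_fourierChar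
      (by exact continuous_inner) (L.integrable_loc f) (L.integrable_loc g)
    exact congrFun this ξ
  simp only [Localization.weighted, this, Pi.add_apply, mul_add]

lemma Localization.weighted_smul (L : Localization n M s) (c : ℂ) (f : C(M, ℂ)) :
    L.weighted (c • f : C(M, ℂ)) = c • L.weighted f := by
  ext ξ
  have : 𝓕 (L.loc (c • f : C(M, ℂ))) ξ = c * 𝓕 (L.loc f) ξ := by
    rw [ContinuousMap.coe_smul, L.loc_smul]
    have := VectorFourier.fourierIntegral_const_smul (μ := MeasureTheory.volume)
      Real.fourierChar (innerₗ (EuclideanSpace ℝ (Fin n))) (L.loc f) c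
    exact congrFun this ξ
  simp only [Localization.weighted, this, Pi.smul_apply, smul_eq_mul]
  ring

/-- The localization of a constant is smooth with compact support. -/
lemma Localization.contDiff_loc_one [IsManifold (𝓡 n) ∞ M] [CompactSpace M]
    (L : Localization n M s) : ContDiff ℝ ∞ (L.loc 1) := by
  rw [contDiff_iff_contDiffAt]
  intro y
  by_cases hy : y ∈ L.chart.target
  · have h1 : ContMDiffOn 𝓘(ℝ, EuclideanSpace ℝ (Fin n)) 𝓘(ℝ, ℝ) ∞
        (fun y => L.cutoff (L.chart.symm y)) L.chart.target :=
      L.smooth.comp_contMDiffOn (contMDiffOn_symm_of_mem_maximalAtlas L.chart_mem)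
    have h2 : ContDiffAt ℝ ∞ (fun y => L.cutoff (L.chart.symm y)) y :=
      (contMDiffOn_iff_contDiffOn.1 h1).contDiffAt (L.chart.open_target.mem_nhds hy)
    have h3 : ContDiffAt ℝ ∞ (fun y => (L.cutoff (L.chart.symm y) : ℂ)) y :=
      Complex.ofRealCLM.contDiff.contDiffAt.comp y h2
    refine h3.congr_of_eventuallyEq ?_
    filter_upwards [L.chart.open_target.mem_nhds hy] with z hz
    simp [Localization.loc, hz]
  · have hK : y ∉ L.K := fun h => hy (L.K_subset h)
    refine (contDiffAt_const (c := (0 : ℂ))).congr_of_eventuallyEq ?_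
    filter_upwards [L.isCompact_K.isClosed.isOpen_compl.mem_nhds hK] with z hz
    exact L.loc_eq_zero _ hz

lemma Localization.memLp_weighted_one [IsManifold (𝓡 n) ∞ M] [CompactSpace M]
    (L : Localization n M s) : MeasureTheory.MemLp (L.weighted 1) 2 := by
  have hc : HasCompactSupport (L.loc 1) :=
    HasCompactSupport.intro L.isCompact_K fun y hy => L.loc_eq_zero _ hy
  let φ : SchwartzMap (EuclideanSpace ℝ (Fin n)) ℂ := hc.toSchwartzMap L.contDiff_loc_one
  have hg : (fun ξ : EuclideanSpace ℝ (Fin n) =>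
      (((1 + ‖ξ‖ ^ 2) ^ (L.t / 2) : ℝ) : ℂ)).HasTemperateGrowth := by fun_prop
  have h := (SchwartzMap.smulLeftCLM ℂ (fun ξ : EuclideanSpace ℝ (Fin n) =>
    (((1 + ‖ξ‖ ^ 2) ^ (L.t / 2) : ℝ) : ℂ)) (𝓕 φ)).memLp 2 MeasureTheory.volume
  convert h using 1
  ext ξ
  rw [SchwartzMap.smulLeftCLM_apply_apply hg]
  rfl

variable (n M s)

/-- The space `H^s(M, ℂ)` for `n/2 < s ≤ ∞`, as a space of continuous functions: `f` belongs to it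
if all its localizations `(χ f) ∘ φ⁻¹` belong to `H^t(ℝⁿ)` for all real `t ≤ s` (that is, to
`H^s(ℝⁿ)` if `s < ∞`). -/
def sobolevSubmodule [CompactSpace M] : Submodule ℂ C(M, ℂ) where
  carrier := {f | ∀ L : Localization n M s, MeasureTheory.MemLp (L.weighted f) 2}
  zero_mem' := fun L => by
    have h : L.weighted (0 : C(M, ℂ)) = 0 := by
      simpa using L.weighted_smul 0 (0 : C(M, ℂ))
    rw [h]
    exact MeasureTheory.MemLp.zero
  add_mem' := fun {f g} hf hg L => by
    rw [L.weighted_add]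
    exact (hf L).add (hg L)
  smul_mem' := fun c f hf L => by
    rw [L.weighted_smul]
    exact (hf L).const_smul c

/-- The complexification `C(M, ℝ) → C(M, ℂ)`. -/
def ofRealLin : C(M, ℝ) →ₗ[ℝ] C(M, ℂ) where
  toFun f := ⟨fun x => (f x : ℂ), Complex.continuous_ofReal.comp f.continuous⟩
  map_add' f g := by ext x; simp
  map_smul' c f := by ext x; simp

/-- The space of real-valued functions of class `H^s`. -/
def sobolevSubmoduleReal [CompactSpace M] : Submodule ℝ C(M, ℝ) :=
  ((sobolevSubmodule n M s).restrictScalars ℝ).comap (ofRealLin M)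

/-- `H^s(M, ℂ)`, as a type carrying the `H^s` topology below (not the uniform topology). -/
def HsC [CompactSpace M] : Type u := sobolevSubmodule n M s

/-- `H^s(M) = H^s(M, ℝ)`, as a type carrying the `H^s` topology below. -/
def HsR [CompactSpace M] : Type u := sobolevSubmoduleReal n M s

variable [CompactSpace M]

instance : AddCommGroup (HsC n M s) := inferInstanceAs (AddCommGroup (sobolevSubmodule n M s))
instance : Module ℂ (HsC n M s) := inferInstanceAs (Module ℂ (sobolevSubmodule n M s))
instance : AddCommGroup (HsR n M s) := inferInstanceAs (AddCommGroup (sobolevSubmoduleReal n M s))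
instance : Module ℝ (HsR n M s) := inferInstanceAs (Module ℝ (sobolevSubmoduleReal n M s))

variable {n M s}

/-- The continuous function underlying an element of `H^s(M, ℂ)`. -/
def HsC.toMap (f : HsC n M s) : C(M, ℂ) := f.1

/-- The continuous function underlying an element of `H^s(M)`. -/
def HsR.toMap (f : HsR n M s) : C(M, ℝ) := f.1

instance : CoeFun (HsC n M s) (fun _ => M → ℂ) := ⟨fun f => f.toMap⟩
instance : CoeFun (HsR n M s) (fun _ => M → ℝ) := ⟨fun f => f.toMap⟩

@[simp] lemma HsC.add_apply (f g : HsC n M s) (x : M) : (f + g) x = f x + g x := rfl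
@[simp] lemma HsC.sub_apply (f g : HsC n M s) (x : M) : (f - g) x = f x - g x := rfl
@[simp] lemma HsC.smul_apply (c : ℂ) (f : HsC n M s) (x : M) : (c • f) x = c * f x := rfl
@[simp] lemma HsC.zero_apply (x : M) : (0 : HsC n M s) x = 0 := rfl
@[simp] lemma HsR.add_apply (f g : HsR n M s) (x : M) : (f + g) x = f x + g x := rfl
@[simp] lemma HsR.sub_apply (f g : HsR n M s) (x : M) : (f - g) x = f x - g x := rfl
@[simp] lemma HsR.smul_apply (c : ℝ) (f : HsR n M s) (x : M) : (c • f) x = c * f x := rfl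
@[simp] lemma HsR.zero_apply (x : M) : (0 : HsR n M s) x = 0 := rfl

lemma HsR.ext {f g : HsR n M s} (h : ∀ x, f x = g x) : f = g :=
  Subtype.ext (ContinuousMap.ext h)

lemma HsC.ext {f g : HsC n M s} (h : ∀ x, f x = g x) : f = g :=
  Subtype.ext (ContinuousMap.ext h)

/-- The element `(1 + |ξ|²)^(t/2) ĥ` of `L²(ℝⁿ)`, where `h = (χ f) ∘ φ⁻¹`. -/
def HsC.localLp (f : HsC n M s) (L : Localization n M s) :
    MeasureTheory.Lp ℂ 2 (MeasureTheory.volume : MeasureTheory.Measure (EuclideanSpace ℝ (Fin n))) :=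
  MeasureTheory.MemLp.toLp _ (f.2 L)

/-- The inclusion `H^s(M) → H^s(M, ℂ)`. -/
def HsR.toHsC (f : HsR n M s) : HsC n M s := ⟨ofRealLin M f.1, f.2⟩

/-- The `H^s` topology on `H^s(M, ℂ)`: the coarsest topology for which all the maps
`f ↦ (χ f) ∘ φ⁻¹` into `H^t(ℝⁿ)`, with `t ≤ s` real, are continuous. -/
instance : TopologicalSpace (HsC n M s) :=
  TopologicalSpace.induced (fun f => f.localLp) inferInstance

/-- The `H^s` topology on `H^s(M)`. -/
instance : TopologicalSpace (HsR n M s) :=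
  TopologicalSpace.induced HsR.toHsC inferInstance

variable [IsManifold (𝓡 n) ∞ M]

variable (n M s) in
/-- The constant function `1` as an element of `H^s(M)`. -/
def HsR.const1 : HsR n M s := ⟨1, fun L => by
  have h : ((ofRealLin M (1 : C(M, ℝ)) : C(M, ℂ)) : M → ℂ) = 1 := by ext x; simp [ofRealLin]
  rw [h]
  exact L.memLp_weighted_one⟩

@[simp] lemma HsR.const1_apply (x : M) : HsR.const1 n M s x = 1 := rfl

end Sobolev

/-! ### Densities and their cotangent bundle -/

section Densities

open MeasureTheory

variable (n : ℕ) {M : Type u} [TopologicalSpace M] [ChartedSpace (EuclideanSpace ℝ (Fin n)) M]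
  [MeasurableSpace M]

/-- `μ` is (the measure of) a volume form: in every smooth coordinate chart it has a smooth positive
density with respect to Lebesgue measure. -/
def IsVolume (μ : Measure M) : Prop :=
  ∀ e ∈ IsManifold.maximalAtlas (𝓡 n) ∞ M, ∃ m : EuclideanSpace ℝ (Fin n) → ℝ,
    ContDiffOn ℝ ∞ m e.target ∧ (∀ y ∈ e.target, 0 < m y) ∧
    ∀ A ⊆ e.target, MeasurableSet A → μ (e.source ∩ e ⁻¹' A) = ∫⁻ y in A, ENNReal.ofReal (m y)

variable {n}
variable [CompactSpace M] [BorelSpace M] {s : WithTop ℝ} {μ : Measure M} [IsProbabilityMeasure μ]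

lemma integrable_continuousMap (f : C(M, ℝ)) : Integrable f μ :=
  f.continuous.integrable_of_hasCompactSupport (HasCompactSupport.of_compactSpace f)

lemma integrable_continuousMap_complex (f : C(M, ℂ)) : Integrable f μ :=
  f.continuous.integrable_of_hasCompactSupport (HasCompactSupport.of_compactSpace f)

variable (n M s) in
/-- The constant functions. -/
def constants [IsManifold (𝓡 n) ∞ M] : Submodule ℝ (HsR n M s) := ℝ ∙ HsR.const1 n M s

variable (n M s μ) in
/-- `H^s_0(M)`, the functions of class `H^s` with integral zero. -/
def HsZero : Submodule ℝ (HsR n M s) where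
  carrier := {f | ∫ x, f x ∂μ = 0}
  zero_mem' := by simp
  add_mem' := fun {f g} hf hg => by
    simp only [Set.mem_ofPred_eq, HsR.add_apply] at *
    rw [integral_add (integrable_continuousMap f.toMap) (integrable_continuousMap g.toMap), hf, hg,
      add_zero]
  smul_mem' := fun c f hf => by
    simp only [Set.mem_ofPred_eq, HsR.smul_apply] at *
    rw [integral_const_mul, hf, mul_zero]

variable (n M s μ) in
/-- The space `Dens^s(M)` of positive probability densities of class `H^s`. -/
abbrev Dens : Type u := {ρ : HsR n M s // (∀ x, 0 < ρ x) ∧ ∫ x, ρ x ∂μ = 1}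

/-- For `ρ` and `θ` of class `H^s`, the integral `∫ θ ρ μ`, linear in `θ`. -/
def integralMul (ρ : HsR n M s) : HsR n M s →ₗ[ℝ] ℝ where
  toFun θ := ∫ x, θ x * ρ x ∂μ
  map_add' θ₁ θ₂ := by
    simp only [HsR.add_apply, add_mul]
    exact integral_add (integrable_continuousMap (θ₁.toMap * ρ.toMap))
      (integrable_continuousMap (θ₂.toMap * ρ.toMap))
  map_smul' c θ := by
    simp only [HsR.smul_apply, mul_assoc, integral_const_mul, smul_eq_mul, RingHom.id_apply]

variable [IsManifold (𝓡 n) ∞ M]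

variable (n M s μ) in
/-- The (regular) cotangent bundle `T^* Dens^s(M) = Dens^s(M) × H^s(M)/ℝ`. -/
abbrev CotDens : Type u := Dens n M s μ × (HsR n M s ⧸ constants n M s)

variable (n M s μ) in
/-- The space `H^s_0(M) × H^s(M)/ℝ` on which `T^* Dens^s(M)` is modelled. It is also the
tangent space at every point. -/
abbrev CotModel : Type u := HsZero n M s μ × (HsR n M s ⧸ constants n M s)

/-- The pairing `(ρ̇, [θ]) ↦ ∫ θ ρ̇ μ` between tangent and cotangent vectors of `Dens^s(M)`. -/
def pairing (r : HsZero n M s μ) : (HsR n M s ⧸ constants n M s) →ₗ[ℝ] ℝ :=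
  (constants n M s).liftQ (integralMul (μ := μ) r.1) <| by
    rw [constants, Submodule.span_le, Set.singleton_subset_iff]
    have h := r.2
    simp only [HsZero, Submodule.mem_mk, AddSubmonoid.mem_mk, AddSubsemigroup.mem_mk,
      Set.mem_ofPred_eq] at h
    simpa [integralMul] using h

/-- The function `1 + σ` of integral one, for `σ` of integral zero. -/
def density (σ : HsZero n M s μ) : HsR n M s := HsR.const1 n M s + σ.1

@[simp] lemma density_apply (σ : HsZero n M s μ) (x : M) : density σ x = 1 + σ.1 x := rfl

lemma integral_density (σ : HsZero n M s μ) : ∫ x, density σ x ∂μ = 1 := by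
  have h : ∫ x, σ.1 x ∂μ = 0 := σ.2
  simp only [density_apply]
  rw [integral_add (integrable_const _) (integrable_continuousMap σ.1.toMap), h]
  simp

/-- For `ρ = 1 + σ`, the representative `θ - ∫ θ ρ μ` of the class `[θ]`: it is the only
representative whose integral against `ρ μ` vanishes. -/
def normalized (σ : HsZero n M s μ) : (HsR n M s ⧸ constants n M s) →ₗ[ℝ] HsR n M s :=
  (constants n M s).liftQ
    (LinearMap.id - (integralMul (μ := μ) (density σ)).smulRight (HsR.const1 n M s)) <| by
    rw [constants, Submodule.span_le, Set.singleton_subset_iff]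
    have h := integral_density (μ := μ) σ
    simp only [density_apply] at h
    simp [integralMul, h]

/-- The coordinate `ρ - 1` of a density `ρ`. -/
def densCoord (ρ : Dens n M s μ) : HsZero n M s μ :=
  ⟨ρ.1 - HsR.const1 n M s, by
    have h : ∫ x, ρ.1 x ∂μ = 1 := ρ.2.2
    have h1 : ∫ x, (ρ.1 x - 1) ∂μ = 0 := by
      rw [integral_sub (integrable_continuousMap ρ.1.toMap) (integrable_const _), h]
      simp
    exact h1⟩

lemma density_densCoord (ρ : Dens n M s μ) : density (densCoord ρ) = ρ.1 :=
  add_sub_cancel (HsR.const1 n M s) ρ.1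

lemma densCoord_density (σ : HsZero n M s μ) (h) : densCoord ⟨density σ, h⟩ = σ :=
  Subtype.ext (add_sub_cancel_left (HsR.const1 n M s) σ.1)

open Classical in
/-- The density with coordinate `σ`, if `1 + σ > 0` (the constant density otherwise). -/
def densOfCoord (σ : HsZero n M s μ) : Dens n M s μ :=
  if h : ∀ x, 0 < density σ x then ⟨density σ, h, integral_density σ⟩
  else ⟨HsR.const1 n M s, fun _ => one_pos, by simp⟩

lemma densOfCoord_of_pos {σ : HsZero n M s μ} (h : ∀ x, 0 < density σ x) :
    densOfCoord σ = ⟨density σ, h, integral_density σ⟩ := dif_pos h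

/-- The global chart `(ρ, [θ]) ↦ (ρ - 1, [θ])` of `T^* Dens^s(M)`. -/
def cotChart : PartialEquiv (CotDens n M s μ) (CotModel n M s μ) where
  toFun p := (densCoord p.1, p.2)
  invFun e := (densOfCoord e.1, e.2)
  source := Set.univ
  target := {e | ∀ x, 0 < density e.1 x}
  map_source' p _ x := by
    rw [density_densCoord]
    exact p.1.2.1 x
  map_target' _ _ := Set.mem_univ _
  left_inv' p _ := by
    have h : ∀ x, 0 < density (densCoord p.1) x := fun x => by
      rw [density_densCoord]
      exact p.1.2.1 x
    refine Prod.ext ?_ rfl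
    rw [densOfCoord_of_pos h]
    exact Subtype.ext (density_densCoord p.1)
  right_inv' e he := by
    refine Prod.ext ?_ rfl
    dsimp only
    rw [densOfCoord_of_pos he, densCoord_density]

/-- The Sasaki-Fisher-Rao metric `¼ ∫ (ρ̇₁ ρ̇₂ / ρ + θ̇₁ θ̇₂ ρ) μ`, where `θ̇₁`, `θ̇₂` are the
representatives with `∫ θ̇ᵢ ρ μ = 0`, at the point with coordinates `e`. -/
def sasakiFisherRao (e u v : CotModel n M s μ) : ℝ :=
  (1 / 4) * ∫ x, (u.1.1 x * v.1.1 x / density e.1 x +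
    normalized e.1 u.2 x * normalized e.1 v.2 x * density e.1 x) ∂μ

/-- The canonical symplectic form `∫ (θ̇₁ ρ̇₂ - θ̇₂ ρ̇₁) μ` of `T^* Dens^s(M)`. -/
def canonicalForm (u v : CotModel n M s μ) : ℝ := pairing v.1 u.2 - pairing u.1 v.2

/-- `T^* Dens^s(M)` with the Sasaki-Fisher-Rao metric, the canonical symplectic form scaled by `1/4`
and the given almost complex structure. -/
def cotDensAtlas (J : CotModel n M s μ → CotModel n M s μ → CotModel n M s μ) :
    KahlerAtlas (CotDens n M s μ) where
  ι := PUnit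
  E := fun _ => CotModel n M s μ
  chart := fun _ => cotChart
  g := fun _ => sasakiFisherRao
  Ω := fun _ _ u v => (1 / 4) * canonicalForm u v
  J := fun _ => J

end Densities

/-! ### The projective space of wave functions -/

section Projective

open MeasureTheory

open scoped LinearAlgebra.Projectivization

variable {n : ℕ} {M : Type u} [TopologicalSpace M] [ChartedSpace (EuclideanSpace ℝ (Fin n)) M]
  [CompactSpace M] {s : WithTop ℝ}

variable (n M s) in
/-- The complex projective space `ℙ H^s(M, ℂ)`, with the quotient topology. -/
def ProjHs : Type u := ℙ ℂ (HsC n M s)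

/-- The class `[ψ]` of a nonzero wave function. -/
def ProjHs.mk (ψ : HsC n M s) (h : ψ ≠ 0) : ProjHs n M s := Projectivization.mk ℂ ψ h

/-- A representative of a point of the projective space. -/
def ProjHs.rep (p : ProjHs n M s) : HsC n M s := Projectivization.rep (K := ℂ) p

lemma ProjHs.rep_mk (ψ : HsC n M s) (h : ψ ≠ 0) :
    ∃ a : ℂ, a ≠ 0 ∧ (ProjHs.mk ψ h).rep = a • ψ := by
  obtain ⟨a, ha⟩ := Projectivization.exists_smul_eq_mk_rep ℂ ψ h
  exact ⟨a, a.ne_zero, ha.symm⟩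

lemma ProjHs.mk_eq (p : ProjHs n M s) (ψ : HsC n M s) (h : ψ ≠ 0) (a : ℂ)
    (ha : a • p.rep = ψ) : ProjHs.mk ψ h = p := by
  have h1 := (Projectivization.mk_eq_mk_iff' ℂ ψ p.rep h (Projectivization.rep_nonzero p)).2 ⟨a, ha⟩
  exact h1.trans (Projectivization.mk_rep p)

instance : TopologicalSpace (ProjHs n M s) :=
  TopologicalSpace.coinduced
    (fun ψ : {ψ : HsC n M s // ψ ≠ 0} => ProjHs.mk ψ.1 ψ.2) inferInstance

variable [MeasurableSpace M] [BorelSpace M] {μ : Measure M} [IsProbabilityMeasure μ]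

variable (μ) in
/-- The `L²` inner product `⟨φ, ψ⟩ = ∫ φ ψ̄ μ`, as a linear function of `φ`. -/
def ip (ψ : HsC n M s) : HsC n M s →ₗ[ℂ] ℂ where
  toFun φ := ∫ x, φ x * conj (ψ x) ∂μ
  map_add' φ₁ φ₂ := by
    simp only [HsC.add_apply, add_mul]
    exact integral_add (integrable_continuousMap_complex (φ₁.toMap * star ψ.toMap))
      (integrable_continuousMap_complex (φ₂.toMap * star ψ.toMap))
  map_smul' c φ := by
    simp only [HsC.smul_apply, mul_assoc, integral_const_mul, smul_eq_mul, RingHom.id_apply]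

variable (n M s μ) in
/-- The unit sphere of `L²`, intersected with `H^s(M, ℂ)`. -/
abbrev UnitSphere : Type u := {ψ : HsC n M s // ip μ ψ ψ = 1}

/-- The orthogonal complement of `ψ₀` in `H^s(M, ℂ)`. -/
def perp (ψ₀ : UnitSphere n M s μ) : Submodule ℂ (HsC n M s) := LinearMap.ker (ip μ ψ₀.1)

lemma ip_affine (ψ₀ : UnitSphere n M s μ) (w : perp ψ₀) : ip μ ψ₀.1 (ψ₀.1 + w.1) = 1 := by
  have h2 : ip μ ψ₀.1 w.1 = 0 := w.2
  rw [map_add, ψ₀.2, h2, add_zero]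

lemma affine_ne_zero (ψ₀ : UnitSphere n M s μ) (w : perp ψ₀) : ψ₀.1 + w.1 ≠ 0 := by
  intro h
  have h1 := ip_affine ψ₀ w
  rw [h, map_zero] at h1
  exact zero_ne_one h1

open Classical in
/-- For `⟨ψ, ψ₀⟩ ≠ 0`, the vector `ψ / ⟨ψ, ψ₀⟩ - ψ₀`, which is orthogonal to `ψ₀`. -/
def affineCoord (ψ₀ : UnitSphere n M s μ) (ψ : HsC n M s) : perp ψ₀ :=
  if h : ip μ ψ₀.1 ψ = 0 then 0 else ⟨(ip μ ψ₀.1 ψ)⁻¹ • ψ - ψ₀.1, by simp [perp, ψ₀.2, h]⟩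

lemma affineCoord_of_ne (ψ₀ : UnitSphere n M s μ) {ψ : HsC n M s} (h : ip μ ψ₀.1 ψ ≠ 0) :
    (affineCoord ψ₀ ψ).1 = (ip μ ψ₀.1 ψ)⁻¹ • ψ - ψ₀.1 := by
  rw [affineCoord, dif_neg h]

/-- The affine chart `[ψ] ↦ ψ / ⟨ψ, ψ₀⟩ - ψ₀` from `{[ψ] | ⟨ψ, ψ₀⟩ ≠ 0}` onto the orthogonal
complement of `ψ₀`, with inverse `w ↦ [ψ₀ + w]`. -/
def projChart (ψ₀ : UnitSphere n M s μ) : PartialEquiv (ProjHs n M s) (perp ψ₀) where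
  toFun p := affineCoord ψ₀ p.rep
  invFun w := ProjHs.mk (ψ₀.1 + w.1) (affine_ne_zero ψ₀ w)
  source := {p | ip μ ψ₀.1 p.rep ≠ 0}
  target := Set.univ
  map_source' _ _ := Set.mem_univ _
  map_target' w _ := by
    obtain ⟨a, ha, h⟩ := ProjHs.rep_mk (ψ₀.1 + w.1) (affine_ne_zero ψ₀ w)
    change ip μ ψ₀.1 (ProjHs.mk (ψ₀.1 + w.1) (affine_ne_zero ψ₀ w)).rep ≠ 0
    rw [h, map_smul, ip_affine]
    simpa using ha
  left_inv' p hp := by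
    refine ProjHs.mk_eq p _ _ (ip μ ψ₀.1 p.rep)⁻¹ ?_
    rw [affineCoord_of_ne ψ₀ hp]
    abel
  right_inv' w _ := by
    obtain ⟨a, ha, h⟩ := ProjHs.rep_mk (ψ₀.1 + w.1) (affine_ne_zero ψ₀ w)
    have h2 : ip μ ψ₀.1 (a • (ψ₀.1 + w.1)) = a := by
      rw [map_smul, ip_affine]
      simp
    refine Subtype.ext ?_
    rw [h, affineCoord_of_ne ψ₀ (by rwa [h2]), h2, smul_smul, inv_mul_cancel₀ ha, one_smul]
    abel

/-- The Fubini-Study Hermitian form on representatives,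
`⟨u, v⟩ / ⟨ψ, ψ⟩ - ⟨u, ψ⟩ ⟨ψ, v⟩ / ⟨ψ, ψ⟩²`. -/
def fubiniStudy (μ : Measure M) [IsProbabilityMeasure μ] (ψ u v : HsC n M s) : ℂ :=
  ip μ v u / ip μ ψ ψ -
    ip μ ψ u * ip μ v ψ / ip μ ψ ψ ^ 2

variable (n M s μ) in
/-- `ℙ H^s(M, ℂ)` with the Fubini-Study metric, the symplectic form given by `∫ Im(ψ̇₁ ψ̇̄₂) μ` for
tangent vectors to the `L²` unit sphere, and the complex structure determined by them through
`Ω(u, v) = g(J u, v)`, namely `J = -i`. -/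
def projAtlas : KahlerAtlas (ProjHs n M s) where
  ι := UnitSphere n M s μ
  E := fun ψ₀ => perp ψ₀
  chart := projChart
  g := fun ψ₀ w u v => (fubiniStudy μ (ψ₀.1 + w.1) u.1 v.1).re
  Ω := fun ψ₀ w u v => (fubiniStudy μ (ψ₀.1 + w.1) u.1 v.1).im
  J := fun _ _ u => -(Complex.I • u)

variable [IsManifold (𝓡 n) ∞ M]

/-- `J` is given on `T^* Dens^s(M)` by `J(ρ̇, θ̇) = (θ̇ ρ, -ρ̇ / ρ)`, where tangent vectors at
`(ρ, [θ])` are written as pairs with `∫ ρ̇ μ = 0` and `∫ θ̇ ρ μ = 0`. -/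
def IsRotationField (J : CotModel n M s μ → CotModel n M s μ → CotModel n M s μ) : Prop :=
  ∀ (p : CotDens n M s μ) (r : HsZero n M s μ) (τ : HsR n M s), ∫ x, τ x * p.1.1 x ∂μ = 0 →
    ∃ (r' : HsZero n M s μ) (τ' : HsR n M s),
      J (cotChart p) (r, Submodule.Quotient.mk τ) = (r', Submodule.Quotient.mk τ') ∧
      (∀ x, r'.1 x = τ x * p.1.1 x) ∧ (∀ x, τ' x = -(r.1 x / p.1.1 x)) ∧
      ∫ x, τ' x * p.1.1 x ∂μ = 0

/-- `Φ` is the Madelung transform `(ρ, [θ]) ↦ [√ρ e^{iθ/2}]`. -/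
def IsMadelungTransform (Φ : CotDens n M s μ → ProjHs n M s) : Prop :=
  ∀ (ρ : Dens n M s μ) (θ : HsR n M s), ∃ (ψ : HsC n M s) (h : ψ ≠ 0),
    (∀ x, ψ x = (Real.sqrt (ρ.1 x) : ℂ) * Complex.exp (Complex.I * (θ x : ℂ) / 2)) ∧
    Φ (ρ, Submodule.Quotient.mk θ) = ProjHs.mk ψ h

end Projective

end Madelung

end

universe v w

noncomputable section

namespace Madelung

/-! ### Calculus of Bastiani maps between locally convex spaces -/

section BastianiCalculus

open Filter Set

section Line

variable {E : Type u} [AddCommGroup E] [Module ℝ E] [TopologicalSpace E]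
  [IsTopologicalAddGroup E] [ContinuousSMul ℝ E]

/-! Along a tangent vector `(ρ̇, θ̇)` the wave function `ψ = √ρ e^(iθ/2)` moves by `ψ̇ = ψ (ρ̇/ρ +
iθ̇)/2`, and `ψ ψ̄ = ρ`. If `θ̇` is normalized by `∫ θ̇ ρ μ = 0`, then `ψ̇` is orthogonal to `ψ`, so
the Fubini-Study form of two such vectors is simply `∫ ψ̇₁ conj(ψ̇₂) μ`. Expanding it gives the
Sasaki-Fisher-Rao metric as real part and a quarter of the canonical form as imaginary part
(`fubiniStudy_wave`). Replacing `(ρ̇/ρ, θ̇)` by `(θ̇, -ρ̇/ρ)` multiplies `ψ̇` by `-i`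
(`waveFactor_rotation`).

The function `(log ρ - iθ)/2`, taken modulo constants, is a global holomorphic coordinate on the
cotangent bundle, with values in all complex functions of integral zero (`logChart`). This gives
integrability. It also inverts the Madelung transform. The image consists of the lines spanned by
exponentials. On a connected manifold a logarithm is unique up to an additive constant, so the
conjugate logarithm modulo constants (`logClass`) is well defined, is unchanged by scaling `ψ`, and
returns the coordinate. Exponentials form an open set because a function close to `e^b` has its
quotient by `e^b` in the right half-plane.

The analysis consists in proving that `exp` and `log` act smoothly on `H^s` for all `n/2 < s ≤ ∞`.
The topology is given by weighted `L²` norms of Fourier transforms of localized functions, and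
splitting the weight of a convolution makes `H^s` a topological algebra (`sobNorm_mul_le`). For the
logarithm the power series must converge as soon as the sup norm is small, whatever the size of the
`H^s` norm. This is spectral invariance (`exists_sobNorm_pow_le`): the `H^t` norm of `k^(2m)` is
bounded by the `H^t` norm of `k^m` times its Wiener norm, the latter is interpolated between `L²`
and `H^t`, and iterating the estimate lowers the growth rate to any number above `sup |k|`. A
quadratic Taylor remainder at zero and the functional equations of `exp` and `log` give their
derivatives everywhere. These derivatives are expressed by `exp` and `log` again, so smoothness
follows by induction on the order. -/

lemma tendsto_line (x v : E) : Tendsto (fun t : ℝ => x + t • v) (𝓝 0) (𝓝 x) := by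
  have h : Continuous fun t : ℝ => x + t • v := by fun_prop
  simpa using h.tendsto 0

lemma eventually_line_mem {U : Set E} (hU : IsOpen U) {x : E} (hx : x ∈ U) (v : E) :
    ∀ᶠ t : ℝ in 𝓝[≠] 0, x + t • v ∈ U :=
  ((tendsto_line x v).mono_left nhdsWithin_le_nhds).eventually (hU.mem_nhds hx)

variable {F : Type u} [AddCommGroup F] [Module ℝ F] [TopologicalSpace F]

lemma HasDirDeriv.congr {f g : E → F} {U : Set E} (hU : IsOpen U) (hfg : EqOn g f U) {x v : E}
    {d : F} (hx : x ∈ U) (h : HasDirDeriv f x v d) : HasDirDeriv g x v d := by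
  refine Tendsto.congr' ?_ h
  filter_upwards [eventually_line_mem hU hx v] with t ht
  rw [hfg ht, hfg hx]

end Line

variable {E : Type u} [AddCommGroup E] [Module ℝ E] [TopologicalSpace E]
variable {F : Type v} [AddCommGroup F] [Module ℝ F] [TopologicalSpace F]
variable {G : Type w} [AddCommGroup G] [Module ℝ G] [TopologicalSpace G]

/-- The mean value theorem in convex form. Otherwise Hahn-Banach separates the increment from `C` by
a continuous linear form, and the scalar mean value theorem applied to that form gives a
contradiction. -/
lemma mem_closedConvex_of_derivative [IsTopologicalAddGroup G] [ContinuousSMul ℝ G]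
    [LocallyConvexSpace ℝ G] {C : Set G} (hC : Convex ℝ C) (hC' : IsClosed C) {φ d : ℝ → G}
    (hφ : ∀ r ∈ Icc (0 : ℝ) 1,
      Tendsto (fun s : ℝ => s⁻¹ • (φ (r + s) - φ r)) (𝓝[≠] 0) (𝓝 (d r)))
    (hd : ∀ r ∈ Icc (0 : ℝ) 1, d r ∈ C) : φ 1 - φ 0 ∈ C := by
  by_contra hn
  obtain ⟨L, c, hL, hc⟩ := geometric_hahn_banach_closed_point hC hC' hn
  have hder : ∀ r ∈ Icc (0 : ℝ) 1, HasDerivAt (fun r => L (φ r)) (L (d r)) r := by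
    intro r hr
    rw [hasDerivAt_iff_tendsto_slope_zero]
    refine ((L.continuous.tendsto _).comp (hφ r hr)).congr fun s => ?_
    simp
  obtain ⟨r, hr, h⟩ := exists_hasDerivAt_eq_slope (fun r => L (φ r)) (fun r => L (d r))
    zero_lt_one (fun r hr => (hder r hr).continuousAt.continuousWithinAt)
    (fun r hr => hder r (Ioo_subset_Icc_self hr))
  have h1 := hL _ (hd r (Ioo_subset_Icc_self hr))
  rw [map_sub] at hc
  simp only [sub_zero, div_one] at h
  linarith

lemma exists_closed_convex_nhds [IsTopologicalAddGroup G] [ContinuousSMul ℝ G]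
    [LocallyConvexSpace ℝ G] {y : G} {N : Set G} (hN : N ∈ 𝓝 y) :
    ∃ C ∈ 𝓝 y, IsClosed C ∧ Convex ℝ C ∧ C ⊆ N := by
  obtain ⟨A, hA, hAc, hAN⟩ := exists_mem_nhds_isClosed_subset hN
  obtain ⟨B, ⟨hB, hBc⟩, hBA⟩ := (LocallyConvexSpace.convex_basis (𝕜 := ℝ) y).mem_iff.1 hA
  exact ⟨closure B, mem_of_superset hB subset_closure, isClosed_closure, hBc.closure,
    (closure_minimal hBA hAc).trans hAN⟩

/-- Chain rule for the directional derivative along a differentiable curve. -/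
lemma tendsto_dirDeriv_comp [IsTopologicalAddGroup F] [ContinuousSMul ℝ F]
    [LocallyConvexSpace ℝ F] [IsTopologicalAddGroup G] [ContinuousSMul ℝ G]
    [LocallyConvexSpace ℝ G] {V : Set F} (hV : IsOpen V) {g : F → G} {dg : F × F → G}
    (hg : ∀ y ∈ V, ∀ w : F,
      Tendsto (fun t : ℝ => t⁻¹ • (g (y + t • w) - g y)) (𝓝[≠] 0) (𝓝 (dg (y, w))))
    (hdg : ContinuousOn dg (V ×ˢ univ)) {γ : ℝ → F} {y w : F} (hy : y ∈ V)
    (hγ : Tendsto (fun t : ℝ => t⁻¹ • (γ t - y)) (𝓝[≠] 0) (𝓝 w)) :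
    Tendsto (fun t : ℝ => t⁻¹ • (g (γ t) - g y)) (𝓝[≠] 0) (𝓝 (dg (y, w))) := by
  have ht0 : Tendsto (fun t : ℝ => t) (𝓝[≠] 0) (𝓝 0) := nhdsWithin_le_nhds
  have hγ0 : Tendsto (fun t : ℝ => y + t • (t⁻¹ • (γ t - y))) (𝓝[≠] 0) (𝓝 y) := by
    simpa using (tendsto_const_nhds (x := y)).add (ht0.smul hγ)
  refine tendsto_def.2 fun N hN => ?_
  obtain ⟨C, hC, hCc, hCv, hCN⟩ := exists_closed_convex_nhds hN
  have hopen : V ×ˢ (univ : Set F) ∈ 𝓝 (y, w) := (hV.prod isOpen_univ).mem_nhds ⟨hy, mem_univ _⟩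
  have hpre : dg ⁻¹' C ∩ V ×ˢ univ ∈ 𝓝 (y, w) :=
    inter_mem (((hdg _ ⟨hy, mem_univ _⟩).continuousAt hopen) hC) hopen
  obtain ⟨P, ⟨hP, hPc⟩, hPsub⟩ := (LocallyConvexSpace.convex_basis (𝕜 := ℝ) (y, w)).mem_iff.1 hpre
  have hP' : ∀ᶠ t : ℝ in 𝓝[≠] 0, (y + t • (t⁻¹ • (γ t - y)), t⁻¹ • (γ t - y)) ∈ P :=
    (hγ0.prodMk_nhds hγ) hP
  have hP'' : ∀ᶠ t : ℝ in 𝓝[≠] 0, (y, t⁻¹ • (γ t - y)) ∈ P :=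
    (tendsto_const_nhds.prodMk_nhds hγ) hP
  filter_upwards [hP', hP'', self_mem_nhdsWithin] with t h1 h2 ht
  refine hCN ?_
  replace ht : t ≠ 0 := ht
  set z : F := t⁻¹ • (γ t - y) with hz
  have hγt : γ t = y + t • z := by rw [hz, smul_inv_smul₀ ht]; abel
  -- The convex set `P` contains `(y, z)` and `(y + t z, z) = (γ t, z)`, hence the whole segment
  -- between them. So the derivative of `r ↦ t⁻¹ g(y + r t z)` stays in `C`, and the mean value
  -- theorem puts the difference quotient of `g ∘ γ` in `C`.
  have hmem : ∀ r ∈ Icc (0 : ℝ) 1, (y + (r * t) • z, z) ∈ P := by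
    intro r hr
    have := hPc h2 h1 (sub_nonneg.2 hr.2) hr.1 (by ring)
    convert this using 1
    ext1
    · simp only [Prod.fst_add, Prod.smul_fst, smul_add, smul_smul]
      rw [← add_assoc, ← add_smul]; simp
    · simp only [Prod.snd_add, Prod.smul_snd]
      rw [← add_smul]; simp
  have key := mem_closedConvex_of_derivative hCv hCc (φ := fun r => t⁻¹ • g (y + (r * t) • z))
    (d := fun r => dg (y + (r * t) • z, z)) ?_ (fun r hr => (hPsub (hmem r hr)).1)
  · simpa [hγt, smul_sub] using key
  · intro r hr
    have hb := hg _ (hPsub (hmem r hr)).2.1 z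
    have hst : Tendsto (fun s : ℝ => s * t) (𝓝[≠] 0) (𝓝[≠] 0) := by
      refine tendsto_nhdsWithin_iff.2 ⟨?_, ?_⟩
      · have : Tendsto (fun s : ℝ => s * t) (𝓝 0) (𝓝 (0 * t)) := tendsto_id.mul_const t
        rw [zero_mul] at this
        exact this.mono_left nhdsWithin_le_nhds
      · filter_upwards [self_mem_nhdsWithin] with s hs
        exact mul_ne_zero hs ht
    refine (hb.comp hst).congr fun s => ?_
    simp only [Function.comp, ← smul_sub, smul_smul, mul_inv, add_mul, add_smul, add_assoc]

namespace BastianiC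

lemma continuousOn {k : ℕ} {U : Set E} {f : E → F} (h : BastianiC k U f) : ContinuousOn f U := by
  cases k with
  | zero => exact h
  | succ k => exact h.1

lemma mono {k : ℕ} : ∀ {E : Type u} [AddCommGroup E] [Module ℝ E] [TopologicalSpace E]
    {U V : Set E} {f : E → F}, V ⊆ U → BastianiC k U f → BastianiC k V f := by
  induction k with
  | zero => exact fun hVU h => ContinuousOn.mono h hVU
  | succ k ih =>
    rintro E _ _ _ U V f hVU ⟨h, df, hdf, hk⟩
    exact ⟨h.mono hVU, df, fun x hx => hdf x (hVU hx), ih (prod_mono hVU subset_rfl) hk⟩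

lemma of_succ {k : ℕ} : ∀ {E : Type u} [AddCommGroup E] [Module ℝ E] [TopologicalSpace E]
    {U : Set E} {f : E → F}, BastianiC (k + 1) U f → BastianiC k U f := by
  induction k with
  | zero => exact fun h => h.1
  | succ k ih =>
    rintro E _ _ _ U f ⟨h, df, hdf, hk⟩
    exact ⟨h, df, hdf, ih hk⟩

lemma congr [IsTopologicalAddGroup E] [ContinuousSMul ℝ E] {k : ℕ} {U : Set E} {f g : E → F}
    (hU : IsOpen U) (hfg : EqOn g f U) (h : BastianiC k U f) : BastianiC k U g := by
  cases k with
  | zero => exact ContinuousOn.congr h hfg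
  | succ k =>
    obtain ⟨h, df, hdf, hk⟩ := h
    refine ⟨h.congr hfg, df, fun x hx v => Tendsto.congr' ?_ (hdf x hx v), hk⟩
    filter_upwards [eventually_line_mem hU hx v] with t ht
    rw [hfg ht, hfg hx]

/-- Directional derivatives are unique in a Hausdorff space, so the values chosen pointwise agree
with each local derivative, and the induction hypothesis applies to the resulting global derivative.
-/
lemma of_locally [T2Space F] {k : ℕ} : ∀ {E : Type u} [AddCommGroup E] [Module ℝ E]
    [TopologicalSpace E] [IsTopologicalAddGroup E] [ContinuousSMul ℝ E] {U : Set E} {f : E → F},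
    (∀ x ∈ U, ∃ V ⊆ U, IsOpen V ∧ x ∈ V ∧ BastianiC k V f) → BastianiC k U f := by
  induction k with
  | zero =>
    intro E _ _ _ _ _ U f h x hx
    obtain ⟨V, -, hV, hxV, hf⟩ := h x hx
    exact (ContinuousOn.continuousAt hf (hV.mem_nhds hxV)).continuousWithinAt
  | succ k ih =>
    intro E _ _ _ _ _ U f h
    have hd : ∀ p : E × E, ∃ d : F, p.1 ∈ U →
        Tendsto (fun t : ℝ => t⁻¹ • (f (p.1 + t • p.2) - f p.1)) (𝓝[≠] 0) (𝓝 d) := by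
      intro p
      by_cases hp : p.1 ∈ U
      · obtain ⟨V, -, hV, hxV, -, df, hdf, -⟩ := h _ hp
        exact ⟨_, fun _ => hdf _ hxV p.2⟩
      · exact ⟨0, fun h => absurd h hp⟩
    choose d hd using hd
    refine ⟨fun x hx => ?_, d, fun x hx v => hd (x, v) hx, ih ?_⟩
    · obtain ⟨V, -, hV, hxV, hf⟩ := h x hx
      exact (hf.1.continuousAt (hV.mem_nhds hxV)).continuousWithinAt
    · rintro ⟨x, v⟩ ⟨hx, -⟩
      obtain ⟨V, hVU, hV, hxV, -, df, hdf, hk⟩ := h x hx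
      refine ⟨V ×ˢ univ, prod_mono hVU subset_rfl, hV.prod isOpen_univ, ⟨hxV, mem_univ _⟩, ?_⟩
      refine hk.congr (hV.prod isOpen_univ) ?_
      rintro ⟨y, w⟩ ⟨hy, -⟩
      exact tendsto_nhds_unique (hd (y, w) (hVU hy)) (hdf y hy w)

lemma const {k : ℕ} (c : F) : ∀ {E : Type u} [AddCommGroup E] [Module ℝ E] [TopologicalSpace E]
    {U : Set E}, BastianiC k U (fun _ => c) := by
  induction k generalizing c with
  | zero => exact continuousOn_const
  | succ k ih =>
    intro E _ _ _ U
    exact ⟨continuousOn_const, fun _ => 0, fun x _ v => by simpa using tendsto_const_nhds, ih 0⟩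

lemma clm {k : ℕ} : ∀ {E : Type u} [AddCommGroup E] [Module ℝ E] [TopologicalSpace E]
    {U : Set E} (L : E →L[ℝ] F), BastianiC k U L := by
  induction k with
  | zero => exact fun L => L.continuous.continuousOn
  | succ k ih =>
    intro E _ _ _ U L
    refine ⟨L.continuous.continuousOn, fun p => L p.2, fun x _ v => ?_,
      ih (L.comp (ContinuousLinearMap.snd ℝ E E))⟩
    refine Tendsto.congr' ?_ tendsto_const_nhds
    filter_upwards [self_mem_nhdsWithin] with t ht
    simp [smul_smul, inv_mul_cancel₀ (show t ≠ 0 from ht)]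

lemma prodMk {k : ℕ} : ∀ {E : Type u} [AddCommGroup E] [Module ℝ E] [TopologicalSpace E]
    {U : Set E} {f : E → F} {g : E → G}, BastianiC k U f → BastianiC k U g →
    BastianiC k U (fun x => (f x, g x)) := by
  induction k with
  | zero => exact fun hf hg => ContinuousOn.prodMk hf hg
  | succ k ih =>
    rintro E _ _ _ U f g ⟨hf, df, hdf, hkf⟩ ⟨hg, dg, hdg, hkg⟩
    exact ⟨hf.prodMk hg, fun p => (df p, dg p),
      fun x hx v => (hdf x hx v).prodMk_nhds (hdg x hx v), ih hkf hkg⟩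

/-- Precomposition with a linear map needs no mean value argument, hence no local convexity. It
serves to view a function of `x` as a function of `(x, v)` in the inductive proofs. -/
lemma comp_clm {k : ℕ} : ∀ {E : Type u} [AddCommGroup E] [Module ℝ E] [TopologicalSpace E]
    {F : Type v} [AddCommGroup F] [Module ℝ F] [TopologicalSpace F] {U : Set F} {f : F → G}
    (_ : BastianiC k U f) (L : E →L[ℝ] F), BastianiC k (L ⁻¹' U) (fun x => f (L x)) := by
  induction k with
  | zero =>
    intro E _ _ _ F _ _ _ U f hf L
    exact ContinuousOn.comp hf L.continuous.continuousOn fun x hx => hx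
  | succ k ih =>
    rintro E _ _ _ F _ _ _ U f ⟨hf, df, hdf, hk⟩ L
    refine ⟨hf.comp L.continuous.continuousOn fun x hx => hx, fun p => df (L p.1, L p.2),
      fun x hx v => ?_, (ih hk (L.prodMap L)).mono ?_⟩
    · simpa using hdf (L x) hx (L v)
    · exact fun p hp => ⟨hp.1, mem_univ _⟩

/-- The derivative of the composition is `dg ∘ (f ∘ pr₁, df)`, again a composition, one order lower.
The spaces vary in the induction because this one lives on `E × E` and passes through `F × F`. -/
lemma comp [IsTopologicalAddGroup G] [ContinuousSMul ℝ G] [LocallyConvexSpace ℝ G] {k : ℕ} :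
    ∀ {E : Type u} [AddCommGroup E] [Module ℝ E] [TopologicalSpace E]
    {F : Type v} [AddCommGroup F] [Module ℝ F] [TopologicalSpace F] [IsTopologicalAddGroup F]
    [ContinuousSMul ℝ F] [LocallyConvexSpace ℝ F] {U : Set E} {V : Set F} {f : E → F} {g : F → G},
    IsOpen V → BastianiC k V g → BastianiC k U f → MapsTo f U V →
    BastianiC k U (fun x => g (f x)) := by
  induction k with
  | zero => exact fun _ hg hf hm => ContinuousOn.comp hg hf hm
  | succ k ih =>
    rintro E _ _ _ F _ _ _ _ _ _ U V f g hV ⟨hg, dg, hdg, hkg⟩ hf' hm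
    obtain ⟨hf, df, hdf, hkf⟩ := id hf'
    refine ⟨hg.comp hf hm, fun p => dg (f p.1, df p), fun x hx v => ?_, ?_⟩
    · exact tendsto_dirDeriv_comp hV hdg hkg.continuousOn (hm hx) (hdf x hx v)
    · refine ih (hV.prod isOpen_univ) hkg (prodMk ?_ hkf) fun p hp => ⟨hm hp.1, mem_univ _⟩
      exact (hf'.of_succ.comp_clm (ContinuousLinearMap.fst ℝ E E)).mono fun p hp => hp.1

lemma add [IsTopologicalAddGroup F] [ContinuousSMul ℝ F] [LocallyConvexSpace ℝ F] {k : ℕ}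
    {U : Set E} {f g : E → F} (hf : BastianiC k U f) (hg : BastianiC k U g) :
    BastianiC k U (fun x => f x + g x) :=
  comp (V := univ) isOpen_univ
    (clm (ContinuousLinearMap.fst ℝ F F + ContinuousLinearMap.snd ℝ F F)) (hf.prodMk hg)
    (mapsTo_univ _ _)

/-- The derivative `b(v₁, x₂) + b(x₁, v₂)` is a sum of two copies of `b` precomposed with linear
maps, so the induction closes on `b` itself. The remainder of the difference quotient is `t b(v₁,
v₂)`. -/
lemma bilin {H : Type*} [AddCommGroup H] [Module ℝ H] [TopologicalSpace H]
    [IsTopologicalAddGroup H] [ContinuousSMul ℝ H] [LocallyConvexSpace ℝ H]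
    [IsTopologicalAddGroup F] [ContinuousSMul ℝ F] [IsTopologicalAddGroup G] [ContinuousSMul ℝ G]
    (b : F →ₗ[ℝ] G →ₗ[ℝ] H) (hb : Continuous fun p : F × G => b p.1 p.2) {k : ℕ}
    {U : Set (F × G)} : BastianiC k U (fun p : F × G => b p.1 p.2) := by
  refine mono (subset_univ U) ?_
  induction k with
  | zero => exact hb.continuousOn
  | succ k ih =>
    refine ⟨hb.continuousOn, fun q => b q.2.1 q.1.2 + b q.1.1 q.2.2, fun x _ v => ?_, ?_⟩
    · have h0 : Tendsto (fun t : ℝ => b v.1 x.2 + b x.1 v.2 + t • b v.1 v.2) (𝓝[≠] 0)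
          (𝓝 (b v.1 x.2 + b x.1 v.2)) :=
        (tendsto_line (b v.1 x.2 + b x.1 v.2) (b v.1 v.2)).mono_left nhdsWithin_le_nhds
      refine Tendsto.congr' ?_ h0
      filter_upwards [self_mem_nhdsWithin] with t ht
      replace ht : t ≠ 0 := ht
      simp only [Prod.fst_add, Prod.smul_fst, Prod.snd_add, Prod.smul_snd, map_add, map_smul,
        LinearMap.add_apply, LinearMap.smul_apply]
      rw [← smul_right_injective H ht |>.eq_iff]
      simp only [smul_inv_smul₀ ht, smul_add, smul_smul]
      abel
    · let π₁ := ContinuousLinearMap.fst ℝ (F × G) (F × G)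
      let π₂ := ContinuousLinearMap.snd ℝ (F × G) (F × G)
      let p₁ := ContinuousLinearMap.fst ℝ F G
      let p₂ := ContinuousLinearMap.snd ℝ F G
      exact add ((ih.comp_clm ((p₁.comp π₂).prod (p₂.comp π₁))).mono fun _ _ => mem_univ _)
        ((ih.comp_clm ((p₁.comp π₁).prod (p₂.comp π₂))).mono fun _ _ => mem_univ _)

end BastianiC

namespace SmoothOn

variable {U V : Set E} {f g : E → F}

lemma continuousOn (h : SmoothOn U f) : ContinuousOn f U := h 0

lemma mono (hVU : V ⊆ U) (h : SmoothOn U f) : SmoothOn V f := fun k => (h k).mono hVU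

lemma congr [IsTopologicalAddGroup E] [ContinuousSMul ℝ E] (hU : IsOpen U) (hfg : EqOn g f U)
    (h : SmoothOn U f) : SmoothOn U g := fun k => (h k).congr hU hfg

lemma of_locally [IsTopologicalAddGroup E] [ContinuousSMul ℝ E] [T2Space F]
    (h : ∀ x ∈ U, ∃ V ⊆ U, IsOpen V ∧ x ∈ V ∧ SmoothOn V f) : SmoothOn U f := fun _ =>
  BastianiC.of_locally fun x hx =>
    let ⟨V, hVU, hV, hxV, hf⟩ := h x hx
    ⟨V, hVU, hV, hxV, hf _⟩

lemma const (c : F) : SmoothOn U (fun _ => c) := fun _ => BastianiC.const c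

lemma clm (L : E →L[ℝ] F) : SmoothOn U L := fun _ => BastianiC.clm L

lemma prodMk {g : E → G} (hf : SmoothOn U f) (hg : SmoothOn U g) :
    SmoothOn U (fun x => (f x, g x)) := fun k => (hf k).prodMk (hg k)

lemma comp_clm {U : Set F} {f : F → G} (hf : SmoothOn U f) (L : E →L[ℝ] F) (hV : MapsTo L V U) :
    SmoothOn V (fun x => f (L x)) := fun k => ((hf k).comp_clm L).mono hV

variable [IsTopologicalAddGroup F] [ContinuousSMul ℝ F] [LocallyConvexSpace ℝ F]
variable [IsTopologicalAddGroup G] [ContinuousSMul ℝ G] [LocallyConvexSpace ℝ G]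

lemma comp {V : Set F} {g : F → G} (hV : IsOpen V) (hg : SmoothOn V g) (hf : SmoothOn U f)
    (hm : MapsTo f U V) : SmoothOn U (fun x => g (f x)) := fun k => (hg k).comp hV (hf k) hm

lemma clm_comp (L : F →L[ℝ] G) (hf : SmoothOn U f) : SmoothOn U (fun x => L (f x)) :=
  comp (V := univ) isOpen_univ (clm L) hf (mapsTo_univ _ _)

lemma add (hf : SmoothOn U f) (hg : SmoothOn U g) : SmoothOn U (fun x => f x + g x) :=
  fun k => (hf k).add (hg k)

lemma neg (hf : SmoothOn U f) : SmoothOn U (fun x => -f x) :=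
  clm_comp (-ContinuousLinearMap.id ℝ F) hf

lemma sub (hf : SmoothOn U f) (hg : SmoothOn U g) : SmoothOn U (fun x => f x - g x) := by
  simpa only [sub_eq_add_neg] using hf.add hg.neg

lemma bilin {H : Type*} [AddCommGroup H] [Module ℝ H] [TopologicalSpace H]
    [IsTopologicalAddGroup H] [ContinuousSMul ℝ H] [LocallyConvexSpace ℝ H]
    (b : F →ₗ[ℝ] G →ₗ[ℝ] H) (hb : Continuous fun p : F × G => b p.1 p.2) {g : E → G}
    (hf : SmoothOn U f) (hg : SmoothOn U g) : SmoothOn U (fun x => b (f x) (g x)) :=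
  comp (V := univ) isOpen_univ (fun _ => BastianiC.bilin b hb) (hf.prodMk hg) (mapsTo_univ _ _)

lemma smul {c : E → ℝ} (hc : SmoothOn U c) (hf : SmoothOn U f) :
    SmoothOn U (fun x => c x • f x) :=
  bilin (LinearMap.lsmul ℝ F) continuous_smul hc hf

end SmoothOn

/-- The curve `γ` has derivative `d` at time zero. -/
def CurveDeriv (γ : ℝ → F) (d : F) : Prop :=
  Tendsto (fun t : ℝ => t⁻¹ • (γ t - γ 0)) (𝓝[≠] 0) (𝓝 d)

lemma hasDirDeriv_iff_curveDeriv {E F : Type u} [AddCommGroup E] [Module ℝ E] [TopologicalSpace E]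
    [AddCommGroup F] [Module ℝ F] [TopologicalSpace F] {f : E → F} {x v : E} {d : F} :
    HasDirDeriv f x v d ↔ CurveDeriv (fun t => f (x + t • v)) d := by
  simp [HasDirDeriv, CurveDeriv]

lemma curveDeriv_iff_hasDerivAt {F : Type*} [NormedAddCommGroup F] [NormedSpace ℝ F] {γ : ℝ → F}
    {d : F} : CurveDeriv γ d ↔ HasDerivAt γ d 0 := by
  simp [CurveDeriv, hasDerivAt_iff_tendsto_slope_zero]

namespace CurveDeriv

variable {γ : ℝ → F} {d : F}

lemma unique [T2Space F] {d' : F} (h : CurveDeriv γ d) (h' : CurveDeriv γ d') : d = d' :=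
  tendsto_nhds_unique h h'

lemma congr {γ' : ℝ → F} (hγ : γ' =ᶠ[𝓝 0] γ) (h : CurveDeriv γ d) : CurveDeriv γ' d := by
  refine Tendsto.congr' ?_ h
  filter_upwards [hγ.filter_mono nhdsWithin_le_nhds] with t ht
  rw [ht, hγ.self_of_nhds]

lemma line [IsTopologicalAddGroup F] [ContinuousSMul ℝ F] (x v : F) :
    CurveDeriv (fun t : ℝ => x + t • v) v := by
  refine Tendsto.congr' ?_ tendsto_const_nhds
  filter_upwards [self_mem_nhdsWithin] with t ht
  simp [smul_smul, inv_mul_cancel₀ (show t ≠ 0 from ht)]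

lemma clm (L : F →L[ℝ] G) (h : CurveDeriv γ d) : CurveDeriv (fun t => L (γ t)) (L d) :=
  ((L.continuous.tendsto _).comp h).congr fun t => by simp

variable [IsTopologicalAddGroup F]

lemma add {δ : ℝ → F} {e : F} (h : CurveDeriv γ d) (h' : CurveDeriv δ e) :
    CurveDeriv (fun t => γ t + δ t) (d + e) := by
  refine (Tendsto.add h h').congr fun t => ?_
  rw [← smul_add, add_sub_add_comm]

variable [ContinuousSMul ℝ F]

lemma tendsto (h : CurveDeriv γ d) : Tendsto γ (𝓝[≠] 0) (𝓝 (γ 0)) := by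
  have h0 : Tendsto (fun t : ℝ => t) (𝓝[≠] 0) (𝓝 0) := nhdsWithin_le_nhds
  have h1 := (h0.smul h).add (tendsto_const_nhds (x := γ 0))
  rw [zero_smul, zero_add] at h1
  refine Tendsto.congr' ?_ h1
  filter_upwards [self_mem_nhdsWithin] with t ht
  rw [smul_inv_smul₀ (show t ≠ 0 from ht), sub_add_cancel]

lemma bilin {H : Type*} [AddCommGroup H] [Module ℝ H] [TopologicalSpace H]
    [IsTopologicalAddGroup H] [ContinuousSMul ℝ H]
    (b : F →ₗ[ℝ] G →ₗ[ℝ] H) (hb : Continuous fun p : F × G => b p.1 p.2) {δ : ℝ → G} {e : G}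
    (h : CurveDeriv γ d) (h' : CurveDeriv δ e) :
    CurveDeriv (fun t => b (γ t) (δ t)) (b d (δ 0) + b (γ 0) e) := by
  have h1 := ((hb.tendsto _).comp (Tendsto.prodMk_nhds h.tendsto h')).add
    ((hb.tendsto _).comp (Tendsto.prodMk_nhds h (tendsto_const_nhds (x := δ 0))))
  rw [add_comm] at h1
  refine h1.congr fun t => ?_
  simp only [Function.comp, map_smul, LinearMap.smul_apply, map_sub, LinearMap.sub_apply,
    ← smul_add]
  congr 1
  abel

lemma comp [LocallyConvexSpace ℝ F] [IsTopologicalAddGroup G] [ContinuousSMul ℝ G]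
    [LocallyConvexSpace ℝ G] {V : Set F} (hV : IsOpen V) {g : F → G} {dg : F × F → G}
    (hg : ∀ y ∈ V, ∀ w : F, CurveDeriv (fun t : ℝ => g (y + t • w)) (dg (y, w)))
    (hdg : ContinuousOn dg (V ×ˢ univ)) (h0 : γ 0 ∈ V) (h : CurveDeriv γ d) :
    CurveDeriv (fun t => g (γ t)) (dg (γ 0, d)) :=
  tendsto_dirDeriv_comp hV (fun y hy w => by simpa [CurveDeriv] using hg y hy w) hdg h0 h

end CurveDeriv

end BastianiCalculus

/-! ### Sobolev norms of compactly supported functions on a Euclidean space -/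

section EuclideanSobolev

set_option linter.unusedSectionVars false

open MeasureTheory ENNReal

variable {V : Type*} [NormedAddCommGroup V] [InnerProductSpace ℝ V] [FiniteDimensional ℝ V]
  [MeasurableSpace V] [BorelSpace V]

section LTwo

/-- The `L²` norm of an extended nonnegative function. -/
def l2Norm (f : V → ℝ≥0∞) : ℝ≥0∞ := (∫⁻ x, f x ^ (2 : ℝ)) ^ (1 / 2 : ℝ)

lemma l2Norm_mono {f g : V → ℝ≥0∞} (h : ∀ x, f x ≤ g x) : l2Norm f ≤ l2Norm g := by
  unfold l2Norm
  gcongr with x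
  exact h x

lemma l2Norm_const_mul {f : V → ℝ≥0∞} (hf : Measurable f) (c : ℝ≥0∞) :
    l2Norm (fun x => c * f x) = c * l2Norm f := by
  unfold l2Norm
  simp_rw [ENNReal.mul_rpow_of_nonneg _ _ (zero_le_two (α := ℝ))]
  rw [lintegral_const_mul _ (hf.pow_const _), ENNReal.mul_rpow_of_nonneg _ _ (by norm_num),
    ← ENNReal.rpow_mul]
  norm_num

lemma l2Norm_add_le {f g : V → ℝ≥0∞} (hf : Measurable f) (hg : Measurable g) :
    l2Norm (fun x => f x + g x) ≤ l2Norm f + l2Norm g :=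
  ENNReal.lintegral_Lp_add_le hf.aemeasurable hg.aemeasurable one_le_two

lemma lintegral_mul_le_l2Norm {f g : V → ℝ≥0∞} (hf : Measurable f) (hg : Measurable g) :
    ∫⁻ x, f x * g x ≤ l2Norm f * l2Norm g :=
  ENNReal.lintegral_mul_le_Lp_mul_Lq volume Real.HolderConjugate.two_two hf.aemeasurable
    hg.aemeasurable

/-- Young's inequality `‖f * g‖₂ ≤ ‖f‖₁ ‖g‖₂`. -/
lemma l2Norm_convolution_le {f g : V → ℝ≥0∞} (hf : Measurable f) (hg : Measurable g) :
    l2Norm (fun ξ => ∫⁻ η, f η * g (ξ - η)) ≤ (∫⁻ η, f η) * l2Norm g := by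
  have h1 : ∀ ξ, (∫⁻ η, f η * g (ξ - η)) ^ (2 : ℝ) ≤
      (∫⁻ η, f η) * ∫⁻ η, f η * g (ξ - η) ^ (2 : ℝ) := by
    intro ξ
    -- Writing `f = f^(1/2) f^(1/2)` before Cauchy-Schwarz leaves `f` to the first power and puts
    -- the square on `g` only.
    have h2 : ∫⁻ η, f η * g (ξ - η) =
        ∫⁻ η, f η ^ (1 / 2 : ℝ) * (f η ^ (1 / 2 : ℝ) * g (ξ - η)) := by
      congr 1 with η
      rw [← mul_assoc, ← ENNReal.rpow_add_of_nonneg _ _ (by norm_num) (by norm_num)]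
      norm_num
    rw [h2]
    refine (ENNReal.rpow_le_rpow (lintegral_mul_le_l2Norm (by fun_prop) (by fun_prop))
      zero_le_two).trans_eq ?_
    rw [ENNReal.mul_rpow_of_nonneg _ _ zero_le_two, l2Norm, l2Norm, ← ENNReal.rpow_mul,
      ← ENNReal.rpow_mul]
    simp_rw [ENNReal.mul_rpow_of_nonneg _ _ (zero_le_two (α := ℝ)), ← ENNReal.rpow_mul]
    norm_num
  have h3 : ∫⁻ ξ, (∫⁻ η, f η) * ∫⁻ η, f η * g (ξ - η) ^ (2 : ℝ) =
      (∫⁻ η, f η) ^ (2 : ℝ) * ∫⁻ ξ, g ξ ^ (2 : ℝ) := by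
    rw [lintegral_const_mul _ (by fun_prop), lintegral_lintegral_swap (by fun_prop)]
    have h4 : ∀ η, ∫⁻ ξ, f η * g (ξ - η) ^ (2 : ℝ) = f η * ∫⁻ ξ, g ξ ^ (2 : ℝ) := by
      intro η
      rw [lintegral_const_mul _ (by fun_prop)]
      congr 1
      exact lintegral_sub_right_eq_self (fun ξ => g ξ ^ (2 : ℝ)) η
    simp_rw [h4]
    rw [lintegral_mul_const _ hf, ← mul_assoc, ENNReal.rpow_two, sq]
  calc l2Norm (fun ξ => ∫⁻ η, f η * g (ξ - η))
      ≤ ((∫⁻ η, f η) ^ (2 : ℝ) * ∫⁻ ξ, g ξ ^ (2 : ℝ)) ^ (1 / 2 : ℝ) := by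
        rw [← h3]
        exact ENNReal.rpow_le_rpow (lintegral_mono h1) (by norm_num)
    _ = (∫⁻ η, f η) * l2Norm g := by
        rw [ENNReal.mul_rpow_of_nonneg _ _ (by norm_num), ← ENNReal.rpow_mul, l2Norm]
        norm_num

end LTwo

section Weights

/-- The weight `(1 + |ξ|²)^(t/2)`. -/
def japanese (t : ℝ) (ξ : V) : ℝ := (1 + ‖ξ‖ ^ 2) ^ (t / 2)

lemma japanese_pos (t : ℝ) (ξ : V) : 0 < japanese t ξ := by unfold japanese; positivity

lemma measurable_japanese (t : ℝ) : Measurable (japanese t : V → ℝ) := by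
  unfold japanese; fun_prop

lemma japanese_add (t r : ℝ) (ξ : V) : japanese (t + r) ξ = japanese t ξ * japanese r ξ := by
  unfold japanese
  rw [add_div, Real.rpow_add (by positivity)]

lemma japanese_mono {t r : ℝ} (h : t ≤ r) (ξ : V) : japanese t ξ ≤ japanese r ξ :=
  Real.rpow_le_rpow_of_exponent_le (by nlinarith [sq_nonneg ‖ξ‖]) (by linarith)

/-- One of `η` and `ξ - η` has at least half the length of `ξ`. In a convolution this moves the
weight onto one of the two factors. -/
lemma japanese_le_add {t : ℝ} (ht : 0 ≤ t) (ξ η : V) :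
    japanese t ξ ≤ 4 ^ (t / 2) * (japanese t η + japanese t (ξ - η)) := by
  have h1 : ‖ξ‖ ≤ ‖η‖ + ‖ξ - η‖ := by simpa using norm_add_le η (ξ - η)
  have h2 : 1 + ‖ξ‖ ^ 2 ≤ 4 * max (1 + ‖η‖ ^ 2) (1 + ‖ξ - η‖ ^ 2) := by
    have := le_max_left (1 + ‖η‖ ^ 2) (1 + ‖ξ - η‖ ^ 2)
    have := le_max_right (1 + ‖η‖ ^ 2) (1 + ‖ξ - η‖ ^ 2)
    nlinarith [sq_nonneg (‖η‖ - ‖ξ - η‖), norm_nonneg ξ, pow_le_pow_left₀ (norm_nonneg ξ) h1 2]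
  calc japanese t ξ ≤ (4 * max (1 + ‖η‖ ^ 2) (1 + ‖ξ - η‖ ^ 2)) ^ (t / 2) :=
        Real.rpow_le_rpow (by positivity) h2 (by positivity)
    _ = 4 ^ (t / 2) * max (1 + ‖η‖ ^ 2) (1 + ‖ξ - η‖ ^ 2) ^ (t / 2) :=
        Real.mul_rpow (by norm_num) (by positivity)
    _ ≤ _ := by
        gcongr
        rcases max_choice (1 + ‖η‖ ^ 2) (1 + ‖ξ - η‖ ^ 2) with h | h <;> rw [h]
        · exact le_add_of_nonneg_right (japanese_pos _ _).le
        · exact le_add_of_nonneg_left (japanese_pos _ _).le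

/-- This is `x^a ≤ 1 + x` for `x` equal to the weight divided by `l`. The scale `l` stays free so
that it can later be chosen to balance the two terms. -/
lemma japanese_interpolate {t a l : ℝ} (ha : 0 ≤ a) (ha' : a ≤ 1) (hl : 0 < l) (ξ : V) :
    japanese (a * t) ξ ≤ l ^ a + l ^ (a - 1) * japanese t ξ := by
  have h1 : japanese (a * t) ξ = l ^ a * (japanese t ξ / l) ^ a := by
    rw [← Real.mul_rpow hl.le (div_nonneg (japanese_pos _ _).le hl.le), mul_div_cancel₀ _ hl.ne',
      japanese, japanese, ← Real.rpow_mul (by positivity)]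
    congr 1
    ring
  have h2 : (japanese t ξ / l) ^ a ≤ 1 + japanese t ξ / l := by
    have hx := div_nonneg (japanese_pos t ξ).le hl.le
    rcases le_total (japanese t ξ / l) 1 with h | h
    · exact (Real.rpow_le_one hx h ha).trans (le_add_of_nonneg_right hx)
    · refine (Real.rpow_le_rpow_of_exponent_le h ha').trans ?_
      simp
  rw [h1]
  refine (mul_le_mul_of_nonneg_left h2 (by positivity)).trans_eq ?_
  rw [Real.rpow_sub_one hl.ne']
  field_simp

lemma l2Norm_japanese_lt_top {t : ℝ} (ht : (Module.finrank ℝ V : ℝ) / 2 < t) :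
    l2Norm (fun ξ : V => ENNReal.ofReal (japanese (-t) ξ)) < ⊤ := by
  have h := (integrable_rpow_neg_one_add_norm_sq (E := V) (μ := volume) (r := 2 * t)
    (by linarith)).lintegral_lt_top
  refine ENNReal.rpow_lt_top_of_nonneg (by norm_num) (ne_of_lt ?_)
  refine lt_of_eq_of_lt (lintegral_congr fun ξ => ?_) h
  rw [ENNReal.ofReal_rpow_of_nonneg (japanese_pos _ _).le zero_le_two, japanese,
    ← Real.rpow_mul (add_nonneg zero_le_one (sq_nonneg _))]
  congr 2
  ring

end Weights

/-- The `H^t` norm of `k`. -/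
def sobNorm (t : ℝ) (k : V → ℂ) : ℝ≥0∞ :=
  l2Norm fun ξ => ENNReal.ofReal (japanese t ξ) * ‖𝓕 k ξ‖ₑ

/-- The `L¹` norm of the Fourier transform. -/
def wienerNorm (k : V → ℂ) : ℝ≥0∞ := ∫⁻ ξ, ‖𝓕 k ξ‖ₑ

lemma continuous_fourier {k : V → ℂ} (hk : Integrable k) : Continuous (𝓕 k) :=
  VectorFourier.fourierIntegral_continuous Real.continuous_fourierChar
    (by exact continuous_inner) hk

lemma measurable_enorm_fourier {k : V → ℂ} (hk : Integrable k) :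
    Measurable fun ξ => ‖𝓕 k ξ‖ₑ := (continuous_fourier hk).measurable.enorm

lemma sobNorm_mono {t r : ℝ} (h : t ≤ r) (k : V → ℂ) : sobNorm t k ≤ sobNorm r k :=
  l2Norm_mono fun ξ => by gcongr; exact japanese_mono h ξ

/-- For `t > n/2`, the Fourier transform of a function of class `H^t` is integrable. -/
lemma wienerNorm_le {t : ℝ} {k : V → ℂ} (hk : Integrable k) :
    wienerNorm k ≤ l2Norm (fun ξ : V => ENNReal.ofReal (japanese (-t) ξ)) * sobNorm t k := by
  have h := measurable_enorm_fourier hk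
  have h' := fun t => (measurable_japanese (V := V) t).ennreal_ofReal
  refine le_trans (le_of_eq ?_) (lintegral_mul_le_l2Norm (h' _) ((h' _).mul h))
  refine lintegral_congr fun ξ => ?_
  rw [← mul_assoc, ← ENNReal.ofReal_mul (japanese_pos _ _).le, ← japanese_add]
  simp [japanese]

lemma wienerNorm_le_interpolate {t a l : ℝ} (ha : 0 ≤ a) (ha' : a ≤ 1) (hl : 0 < l) {k : V → ℂ}
    (hk : Integrable k) :
    wienerNorm k ≤ l2Norm (fun ξ : V => ENNReal.ofReal (japanese (-(a * t)) ξ)) *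
      (ENNReal.ofReal (l ^ a) * sobNorm 0 k + ENNReal.ofReal (l ^ (a - 1)) * sobNorm t k) := by
  have h := measurable_enorm_fourier hk
  have h' := fun t => (measurable_japanese (V := V) t).ennreal_ofReal
  refine (wienerNorm_le (t := a * t) hk).trans ?_
  gcongr
  have hm : ∀ r, Measurable fun ξ : V => ENNReal.ofReal (japanese r ξ) * ‖𝓕 k ξ‖ₑ :=
    fun r => (h' r).mul h
  rw [sobNorm, sobNorm, sobNorm, ← l2Norm_const_mul (hm _), ← l2Norm_const_mul (hm _)]
  refine le_trans (l2Norm_mono fun ξ => ?_) (l2Norm_add_le (by fun_prop) (by fun_prop))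
  rw [← mul_assoc, ← mul_assoc, ← add_mul, ← ENNReal.ofReal_mul (by positivity),
    ← ENNReal.ofReal_mul (by positivity), ← ENNReal.ofReal_add
      (mul_nonneg (by positivity) (japanese_pos _ _).le)
      (mul_nonneg (by positivity) (japanese_pos _ _).le)]
  gcongr
  refine (japanese_interpolate ha ha' hl ξ).trans_eq ?_
  simp [japanese]

lemma integrable_fourier {k : V → ℂ} (hk : Integrable k) (h : wienerNorm k < ⊤) :
    Integrable (𝓕 k) := ⟨(continuous_fourier hk).aestronglyMeasurable, h⟩

/-- Fourier inversion, when the Wiener norm is finite. Otherwise there is nothing to prove. -/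
lemma enorm_le_wienerNorm {k : V → ℂ} (hc : Continuous k) (hk : Integrable k) (x : V) :
    ‖k x‖ₑ ≤ wienerNorm k := by
  rcases eq_top_or_lt_top (wienerNorm k) with h | h
  · rw [h]; exact le_top
  have h1 := congrFun (hc.fourierInv_fourier_eq hk (integrable_fourier hk h)) x
  rw [← h1, Real.fourierInv_eq]
  refine (enorm_integral_le_lintegral_enorm _).trans_eq (lintegral_congr fun ξ => ?_)
  rw [enorm_eq_iff_norm_eq, Circle.norm_smul]

/-- The Fourier transform of a product. -/
lemma fourier_mul {f g : V → ℂ} (hf : Continuous f) (hfi : Integrable f)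
    (hfW : wienerNorm f < ⊤) (hgi : Integrable g) (ξ : V) :
    𝓕 (fun x => f x * g x) ξ = ∫ η, 𝓕 f η * 𝓕 g (ξ - η) := by
  have hF := integrable_fourier hfi hfW
  let e : V → ℂ := fun x => (Real.fourierChar (inner ℝ x ξ) : ℂ)
  have hG : Integrable fun x => e x * g (-x) := by
    refine (hgi.comp_neg).bdd_mul (c := 1) ?_ (Filter.Eventually.of_forall fun x => by
      simp only [e, Circle.norm_coe, le_refl])
    apply Continuous.aestronglyMeasurable
    exact continuous_induced_dom.comp (Real.continuous_fourierChar.comp (by fun_prop))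
  -- The multiplication formula `∫ F̂ G = ∫ F Ĝ` with `F = 𝓕 f` and `G(x) = e(x) g(-x)`. By
  -- inversion `F̂` is `f` reflected, and the modulation and reflection in `G` turn `Ĝ(η)` into `𝓕 g
  -- (ξ - η)`.
  have key := VectorFourier.integral_fourierIntegral_smul_eq_flip (μ := volume) (ν := volume)
    (L := innerₗ V) (f := 𝓕 f) (g := fun x => e x * g (-x)) Real.continuous_fourierChar
    (by exact continuous_inner) hF hG
  have hFF : ∀ x, VectorFourier.fourierIntegral Real.fourierChar volume (innerₗ V) (𝓕 f) x
      = f (-x) := by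
    intro x
    have := congrFun (hf.fourierInv_fourier_eq hfi hF) (-x)
    rw [← this, Real.fourierInv_eq_fourier_neg, neg_neg]
    rfl
  have hGG : ∀ η, VectorFourier.fourierIntegral Real.fourierChar volume (innerₗ V).flip
      (fun x => e x * g (-x)) η = 𝓕 g (ξ - η) := by
    intro η
    rw [Real.fourier_eq, ← integral_neg_eq_self]
    refine integral_congr_ae (Filter.Eventually.of_forall fun x => ?_)
    simp only [e, LinearMap.flip_apply, innerₗ_apply_apply, Circle.smul_def, smul_eq_mul,
      ← mul_assoc, ← Circle.coe_mul, ← AddChar.map_add_eq_mul, inner_neg_left, inner_sub_right,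
      real_inner_comm η x, neg_sub]
    congr 3
    ring
  simp only [hFF, hGG, smul_eq_mul] at key
  rw [← key, Real.fourier_eq, ← integral_neg_eq_self]
  refine integral_congr_ae (Filter.Eventually.of_forall fun x => ?_)
  simp only [e, Circle.smul_def, smul_eq_mul, neg_neg, inner_neg_left]
  ring

/-- The Fourier transform of the product is a convolution. The weight is moved onto one of the
factors, that factor is measured in `L²` and the other in `L¹`, and Young's inequality bounds both
terms. The estimate is linear in each `H^t` norm, which the bootstrap for powers relies on. -/
lemma sobNorm_mul_le {t : ℝ} (ht : 0 ≤ t) {f g : V → ℂ} (hf : Continuous f) (hfi : Integrable f)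
    (hfW : wienerNorm f < ⊤) (hgi : Integrable g) :
    sobNorm t (fun x => f x * g x) ≤ ENNReal.ofReal (4 ^ (t / 2)) *
      (sobNorm t f * wienerNorm g + wienerNorm f * sobNorm t g) := by
  have hj := (measurable_japanese (V := V) t).ennreal_ofReal
  have hF := measurable_enorm_fourier hfi
  have hG := measurable_enorm_fourier hgi
  set j : V → ℝ≥0∞ := fun ξ => ENNReal.ofReal (japanese t ξ)
  set F : V → ℝ≥0∞ := fun ξ => ‖𝓕 f ξ‖ₑ
  set G : V → ℝ≥0∞ := fun ξ => ‖𝓕 g ξ‖ₑ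
  have h1 : ∀ ξ, j ξ * ‖𝓕 (fun x => f x * g x) ξ‖ₑ ≤ ENNReal.ofReal (4 ^ (t / 2)) *
      ((∫⁻ η, G η * (j (ξ - η) * F (ξ - η))) + ∫⁻ η, F η * (j (ξ - η) * G (ξ - η))) := by
    intro ξ
    -- The substitution `η ↦ ξ - η` makes the weighted factor the translated one, as in the form of
    -- Young's inequality used below.
    have h2 : ∫⁻ η, G η * (j (ξ - η) * F (ξ - η)) = ∫⁻ η, j η * F η * G (ξ - η) := by
      rw [← lintegral_sub_left_eq_self _ ξ]
      refine lintegral_congr fun η => ?_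
      simp only [_root_.sub_sub_cancel]
      exact mul_comm _ _
    rw [h2, fourier_mul hf hfi hfW hgi, ← lintegral_add_left (by fun_prop),
      ← lintegral_const_mul _ (by fun_prop)]
    refine (mul_le_mul_right (enorm_integral_le_lintegral_enorm _) _).trans ?_
    rw [← lintegral_const_mul _ (by
      simp only [enorm_mul]
      exact hF.mul (hG.comp (measurable_const.sub measurable_id)))]
    refine lintegral_mono fun η => ?_
    have h3 : j ξ ≤ ENNReal.ofReal (4 ^ (t / 2)) * (j η + j (ξ - η)) := by
      rw [← ENNReal.ofReal_add (japanese_pos _ _).le (japanese_pos _ _).le,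
        ← ENNReal.ofReal_mul (by positivity)]
      exact ENNReal.ofReal_le_ofReal (japanese_le_add ht ξ η)
    rw [enorm_mul]
    refine (mul_le_mul_left h3 _).trans_eq ?_
    simp only [F, G]
    ring
  refine (l2Norm_mono h1).trans ?_
  rw [l2Norm_const_mul (by fun_prop), add_comm (sobNorm t f * _), mul_comm (sobNorm t f)]
  gcongr
  refine (l2Norm_add_le (by fun_prop) (by fun_prop)).trans ?_
  rw [add_comm]
  exact add_le_add (l2Norm_convolution_le hF (hj.mul hG)) (l2Norm_convolution_le hG (hj.mul hF))

lemma enorm_le_toReal_wienerNorm {k : V → ℂ} (hc : Continuous k) (hk : Integrable k)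
    (hW : wienerNorm k < ⊤) (x : V) : ‖k x‖ ≤ (wienerNorm k).toReal := by
  have := ENNReal.toReal_mono hW.ne (enorm_le_wienerNorm hc hk x)
  simpa using this

lemma integrable_norm_sq {k : V → ℂ} (hc : Continuous k) (hk : Integrable k) {C : ℝ}
    (hC : ∀ x, ‖k x‖ ≤ C) : Integrable fun x => ‖k x‖ ^ 2 := by
  simp_rw [sq]
  exact hk.norm.bdd_mul (c := C) hc.norm.aestronglyMeasurable
    (Filter.Eventually.of_forall fun x => by simpa using hC x)

lemma l2Norm_enorm_eq {k : V → ℂ} (h : Integrable fun x => ‖k x‖ ^ 2) :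
    l2Norm (fun x => ‖k x‖ₑ) = ENNReal.ofReal (∫ x, ‖k x‖ ^ 2) ^ (1 / 2 : ℝ) := by
  rw [ofReal_integral_eq_lintegral_ofReal h (Filter.Eventually.of_forall fun x => sq_nonneg _),
    l2Norm]
  congr 1
  refine lintegral_congr fun x => ?_
  rw [ENNReal.rpow_two, ENNReal.ofReal_pow (norm_nonneg _), ofReal_norm]

/-- Plancherel's theorem for continuous integrable functions with integrable Fourier transform. -/
lemma sobNorm_zero {k : V → ℂ} (hc : Continuous k) (hk : Integrable k)
    (hW : wienerNorm k < ⊤) : sobNorm 0 k = l2Norm fun x => ‖k x‖ₑ := by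
  have hF := integrable_fourier hk hW
  have hFb : ∀ ξ, ‖𝓕 k ξ‖ ≤ ∫ x, ‖k x‖ := fun ξ =>
    VectorFourier.norm_fourierIntegral_le_integral_norm _ _ _ _ _
  have h1 : sobNorm 0 k = l2Norm fun ξ => ‖𝓕 k ξ‖ₑ := by simp [sobNorm, japanese]
  rw [h1, l2Norm_enorm_eq (integrable_norm_sq (continuous_fourier hk) hF hFb),
    l2Norm_enorm_eq (integrable_norm_sq hc hk (enorm_le_toReal_wienerNorm hc hk hW))]
  congr 2
  have hFc : Integrable fun ξ => conj (𝓕 k ξ) := Complex.conjCLE.integrable_comp_iff.2 hF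
  -- The multiplication formula for `k` and `conj (𝓕 k)`. By inversion the second transform is `conj
  -- k`, so the formula reads `∫ |𝓕 k|² = ∫ |k|²`.
  have key := VectorFourier.integral_fourierIntegral_smul_eq_flip (μ := volume) (ν := volume)
    (L := innerₗ V) (f := k) (g := fun ξ => conj (𝓕 k ξ)) Real.continuous_fourierChar
    (by exact continuous_inner) hk hFc
  have h2 : ∀ x, VectorFourier.fourierIntegral Real.fourierChar volume (innerₗ V).flip
      (fun ξ => conj (𝓕 k ξ)) x = conj (k x) := by
    intro x
    have h3 := congrFun (hc.fourierInv_fourier_eq hk hF) x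
    rw [show conj (k x) = conj (𝓕⁻ (𝓕 k) x) by rw [h3], Real.fourierInv_eq, ← integral_conj]
    refine integral_congr_ae (Filter.Eventually.of_forall fun ξ => ?_)
    simp [Circle.smul_def, real_inner_comm x ξ]
  simp only [h2, smul_eq_mul] at key
  have h4 : ∀ z : ℂ, z * conj z = ((‖z‖ ^ 2 : ℝ) : ℂ) := fun z => by
    rw [Complex.mul_conj, Complex.normSq_eq_norm_sq]
  have h5 : ∀ ξ, VectorFourier.fourierIntegral Real.fourierChar volume (innerₗ V) k ξ
      * conj (𝓕 k ξ) = ((‖𝓕 k ξ‖ ^ 2 : ℝ) : ℂ) := fun ξ => h4 (𝓕 k ξ)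
  simp only [h4, h5, integral_complex_ofReal] at key
  exact_mod_cast key

/-- A sequence whose even terms are controlled by interpolation between its geometric growth and a
smaller geometric sequence grows like that smaller sequence. -/
lemma exists_geometric_bound {S : ℕ → ℝ} {C A a Q q : ℝ} (hS : ∀ m, 0 ≤ S m) (hC : 0 ≤ C)
    (hA : 0 ≤ A) (ha : 0 < a) (ha' : a < 1) (hQ : 0 < Q) (hq : Q < q)
    (h1 : ∀ m ≥ 1, S (m + 1) ≤ C * S m)
    (h2 : ∀ m ≥ 1, ∀ l > 0, S (2 * m) ≤ C * S m * (l ^ a * (A * Q ^ m) + l ^ (a - 1) * S m)) :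
    ∃ K, 0 ≤ K ∧ ∀ m ≥ 1, S m ≤ K * q ^ m := by
  let P : ℝ → Prop := fun p => ∃ K, 0 ≤ K ∧ ∀ m ≥ 1, S m ≤ K * p ^ m
  set b : ℝ := (1 + a) / 2 with hb
  -- If `S` grows at rate `p`, the choice `l = (p / Q)^m` balances the two terms of `h2` and bounds
  -- the even terms at rate `p'` with `p'² = p^(1+a) Q^(1-a)`. The new rate is a weighted geometric
  -- mean of `p` and `Q`, with weight `b < 1` on `p`.
  have step : ∀ p > 0, P p → P (p ^ b * Q ^ (1 - b)) := by
    rintro p hp ⟨K, hK, hSK⟩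
    set p' := p ^ b * Q ^ (1 - b) with hp'
    have hp'0 : 0 < p' := by positivity
    have hsq : p' ^ 2 = p * (p / Q) ^ a * Q := by
      have e1 : p * p ^ a = p ^ (1 + a) := by rw [Real.rpow_add hp, Real.rpow_one]
      have e2 : Q / Q ^ a = Q ^ (1 - a) := by rw [Real.rpow_sub hQ, Real.rpow_one]
      rw [hp', mul_pow, ← Real.rpow_natCast, ← Real.rpow_natCast, ← Real.rpow_mul hp.le,
        ← Real.rpow_mul hQ.le, Real.div_rpow hp.le hQ.le, hb]
      have e3 : (1 + a) / 2 * ((2 : ℕ) : ℝ) = 1 + a := by push_cast; ring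
      have e4 : (1 - (1 + a) / 2) * ((2 : ℕ) : ℝ) = 1 - a := by push_cast; ring
      rw [e3, e4, ← e1, ← e2]
      field_simp
    have heven : ∀ m ≥ 1, S (2 * m) ≤ C * K * (A + K) * p' ^ (2 * m) := by
      intro m hm
      have hl : 0 < (p / Q) ^ m := by positivity
      have e1 : ((p / Q) ^ m) ^ a = ((p / Q) ^ a) ^ m := by
        rw [← Real.rpow_natCast, ← Real.rpow_mul (by positivity), mul_comm,
          Real.rpow_mul (by positivity), Real.rpow_natCast]
      calc S (2 * m) ≤ C * S m * (((p / Q) ^ m) ^ a * (A * Q ^ m) + ((p / Q) ^ m) ^ (a - 1) * S m) :=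
            h2 m hm _ hl
        _ ≤ C * (K * p ^ m) * (((p / Q) ^ m) ^ a * (A * Q ^ m)
              + ((p / Q) ^ m) ^ (a - 1) * (K * p ^ m)) := by
            have := hSK m hm
            have := hS m
            gcongr
        _ = C * K * (A + K) * p' ^ (2 * m) := by
            rw [pow_mul, hsq, Real.rpow_sub_one hl.ne', e1]
            simp only [mul_pow, div_pow]
            field_simp
    -- The three summands cover the even indices, the odd indices from `3` on (one application of
    -- `h1` after an even index), and the index `1`.
    refine ⟨C * K * (A + K) + C * (C * K * (A + K)) / p' + S 1 / p', ?_, ?_⟩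
    · have := hS 1
      positivity
    · intro m hm
      have := hS 1
      obtain ⟨l, rfl | rfl⟩ := Nat.even_or_odd' m
      · refine (heven l (by omega)).trans ?_
        gcongr
        have : 0 ≤ C * (C * K * (A + K)) / p' + S 1 / p' := by positivity
        linarith
      · rcases Nat.eq_zero_or_pos l with rfl | hl
        · have e : S 1 = S 1 / p' * p' ^ (2 * 0 + 1) := by field_simp; simp
          calc S (2 * 0 + 1) = S 1 / p' * p' ^ (2 * 0 + 1) := e
            _ ≤ _ := by
              gcongr
              have : 0 ≤ C * K * (A + K) + C * (C * K * (A + K)) / p' := by positivity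
              linarith
        · calc S (2 * l + 1) ≤ C * S (2 * l) := h1 _ (by omega)
            _ ≤ C * (C * K * (A + K) * p' ^ (2 * l)) := by gcongr; exact heven l hl
            _ = C * (C * K * (A + K)) / p' * p' ^ (2 * l + 1) := by field_simp; ring
            _ ≤ _ := by
              gcongr
              have : 0 ≤ C * K * (A + K) := by positivity
              have : 0 ≤ S 1 / p' := by positivity
              linarith
  have hb0 : 0 < b := by rw [hb]; linarith
  have hb1 : b < 1 := by rw [hb]; linarith
  have hq0 : 0 < q := hQ.trans hq
  -- By `h1` the sequence grows at most at rate `C`. Taking the maximum with `q` keeps the starting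
  -- rate positive.
  set p₀ := max C q with hp₀
  have hp₀0 : 0 < p₀ := lt_max_of_lt_right hq0
  have base : P p₀ := by
    refine ⟨S 1 / p₀, div_nonneg (hS 1) hp₀0.le, fun m hm => ?_⟩
    induction m, hm using Nat.le_induction with
    | base => simp [hp₀0.ne']
    | succ m hm ih =>
      calc S (m + 1) ≤ C * S m := h1 m hm
        _ ≤ p₀ * (S 1 / p₀ * p₀ ^ m) := by
          have := hS m
          have := le_max_left C q
          gcongr
        _ = _ := by ring
  -- Each step replaces the ratio of the rate to `Q` by its `b`-th power. Since `b < 1`, the rates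
  -- tend to `Q` and eventually fall below `q`.
  have iter : ∀ j : ℕ, P (Q * (p₀ / Q) ^ (b ^ j)) := by
    intro j
    induction j with
    | zero => simpa [mul_div_cancel₀ _ hQ.ne'] using base
    | succ j ih =>
      have := step _ (by positivity) ih
      convert this using 1
      rw [Real.mul_rpow hQ.le (by positivity), ← Real.rpow_mul (by positivity), ← pow_succ,
        mul_right_comm, ← Real.rpow_add hQ]
      simp
  have hlim : Filter.Tendsto (fun j : ℕ => Q * (p₀ / Q) ^ (b ^ j)) Filter.atTop (𝓝 Q) := by
    have h3 := tendsto_pow_atTop_nhds_zero_of_lt_one hb0.le hb1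
    have h4 := (Real.continuousAt_const_rpow (a := p₀ / Q) (b := 0) (by positivity)).tendsto.comp h3
    simpa using h4.const_mul Q
  obtain ⟨j, hj⟩ := (hlim.eventually (gt_mem_nhds hq)).exists
  obtain ⟨K, hK, hSK⟩ := iter j
  refine ⟨K, hK, fun m hm => (hSK m hm).trans ?_⟩
  gcongr

end EuclideanSobolev

/-! ### The Sobolev algebra on Euclidean space and the growth of powers. -/

section EuclideanSobolevAlgebra

open MeasureTheory
open scoped ENNReal NNReal

variable {V : Type*} [NormedAddCommGroup V] [InnerProductSpace ℝ V] [FiniteDimensional ℝ V]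
  [MeasurableSpace V] [BorelSpace V]

lemma exists_wienerNorm_le {t : ℝ} (ht : (Module.finrank ℝ V : ℝ) / 2 < t) :
    ∃ D : ℝ≥0, ∀ k : V → ℂ, Integrable k → wienerNorm k ≤ D * sobNorm t k := by
  lift l2Norm (fun ξ : V => ENNReal.ofReal (japanese (-t) ξ)) to ℝ≥0
    using (l2Norm_japanese_lt_top ht).ne with D hD
  exact ⟨D, fun k hk => hD ▸ wienerNorm_le hk⟩

/-- For `t > n/2`, the product is bounded in the `H^t` norm. -/
lemma exists_sobNorm_mul_le {t : ℝ} (ht : (Module.finrank ℝ V : ℝ) / 2 < t) :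
    ∃ C : ℝ≥0, ∀ f g : V → ℂ, Continuous f → Integrable f → sobNorm t f < ⊤ → Integrable g →
      sobNorm t (fun x => f x * g x) ≤ C * (sobNorm t f * sobNorm t g) := by
  obtain ⟨D, hD⟩ := exists_wienerNorm_le ht
  have ht0 : 0 ≤ t := le_trans (by positivity) ht.le
  refine ⟨(4 ^ (t / 2) : ℝ).toNNReal * (2 * D), fun f g hf hfi hft hgi => ?_⟩
  have hW : wienerNorm f < ⊤ := (hD f hfi).trans_lt (ENNReal.mul_lt_top (by simp) hft)
  calc sobNorm t (fun x => f x * g x)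
      ≤ ENNReal.ofReal (4 ^ (t / 2)) * (sobNorm t f * (D * sobNorm t g) +
          D * sobNorm t f * sobNorm t g) := by
        refine (sobNorm_mul_le ht0 hf hfi hW hgi).trans ?_
        gcongr
        · exact hD g hgi
        · exact hD f hfi
    _ = _ := by
        rw [ENNReal.ofReal]
        push_cast
        ring

/-- Spectral invariance: the growth of the powers of `k` in the `H^t` norm, `t > n/2`, is
controlled by the maximum of `|k|`. -/
lemma exists_sobNorm_pow_le {t : ℝ} (ht : (Module.finrank ℝ V : ℝ) / 2 < t) {k : V → ℂ}
    (hc : Continuous k) (hk : HasCompactSupport k) (hkt : sobNorm t k < ⊤) {Q q : ℝ}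
    (hQ : ∀ x, ‖k x‖ ≤ Q) (hQ0 : 0 < Q) (hQq : Q < q) :
    ∃ K : ℝ, 0 ≤ K ∧ ∀ m ≥ 1, sobNorm t (fun x => k x ^ m) ≤ ENNReal.ofReal (K * q ^ m) := by
  obtain ⟨C, hC⟩ := exists_sobNorm_mul_le ht
  obtain ⟨D, hD⟩ := exists_wienerNorm_le ht
  have hn : (0 : ℝ) ≤ (Module.finrank ℝ V : ℝ) / 2 := by positivity
  have ht0 : 0 < t := hn.trans_lt ht
  have hcm : ∀ m : ℕ, Continuous fun x => k x ^ m := fun m => hc.pow m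
  have hsm : ∀ m ≥ 1, HasCompactSupport fun x => k x ^ m := fun m hm =>
    hk.comp_left (g := fun z => z ^ m) (zero_pow (by omega))
  have him : ∀ m ≥ 1, Integrable fun x => k x ^ m := fun m hm =>
    (hcm m).integrable_of_hasCompactSupport (hsm m hm)
  have hki : Integrable k := hc.integrable_of_hasCompactSupport hk
  have hfin : ∀ m ≥ 1, sobNorm t (fun x => k x ^ m) < ⊤ := by
    intro m hm
    induction m, hm using Nat.le_induction with
    | base => simpa using hkt
    | succ m hm ih =>
      simp_rw [pow_succ]
      exact (hC _ _ (hcm m) (him m hm) ih hki).trans_lt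
        (ENNReal.mul_lt_top (by simp) (ENNReal.mul_lt_top ih hkt))
  have hW : ∀ m ≥ 1, wienerNorm (fun x => k x ^ m) < ⊤ := fun m hm =>
    (hD _ (him m hm)).trans_lt (ENNReal.mul_lt_top (by simp) (hfin m hm))
  -- the exponent of interpolation
  set a : ℝ := (Module.finrank ℝ V / 2 / t + 1) / 2 with ha
  have hr1 : (Module.finrank ℝ V / 2 / t : ℝ) < 1 := (div_lt_one ht0).2 ht
  have hr0 : (0 : ℝ) ≤ Module.finrank ℝ V / 2 / t := div_nonneg hn ht0.le
  have ha0 : 0 < a := by rw [ha]; linarith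
  have ha1 : a < 1 := by rw [ha]; linarith
  -- The assumption `t > n/2` leaves room for `a` strictly between `n/(2t)` and `1`, so that the
  -- weight of exponent `-a t` is still square integrable.
  have hat : (Module.finrank ℝ V : ℝ) / 2 < a * t := by
    rw [← div_lt_iff₀ ht0, ha]
    linarith
  lift l2Norm (fun ξ : V => ENNReal.ofReal (japanese (-(a * t)) ξ)) to ℝ≥0
    using (l2Norm_japanese_lt_top hat).ne with B hB
  have hE1 : l2Norm (fun x => ‖k x‖ₑ) < ⊤ := by
    have h1 := hW 1 le_rfl
    simp only [pow_one] at h1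
    rw [← sobNorm_zero hc hki h1]
    exact (sobNorm_mono ht0.le k).trans_lt hkt
  lift l2Norm (fun x => ‖k x‖ₑ) to ℝ≥0 using hE1.ne with E hE
  -- By Plancherel this is an `L²` bound: all factors of `k^m` but one are estimated by `Q`. The
  -- quotient `E / Q` absorbs the missing factor.
  have hEm : ∀ m ≥ 1, sobNorm 0 (fun x => k x ^ m) ≤ ENNReal.ofReal (E / Q * Q ^ m) := by
    intro m hm
    rw [sobNorm_zero (hcm m) (him m hm) (hW m hm)]
    obtain ⟨j, rfl⟩ := Nat.exists_eq_add_of_le' hm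
    calc l2Norm (fun x => ‖k x ^ (j + 1)‖ₑ)
        ≤ l2Norm (fun x => ENNReal.ofReal (Q ^ j) * ‖k x‖ₑ) := by
          refine l2Norm_mono fun x => ?_
          rw [pow_succ, enorm_mul, enorm_pow, ENNReal.ofReal_pow hQ0.le]
          gcongr
          rw [← ofReal_norm]
          exact ENNReal.ofReal_le_ofReal (hQ x)
      _ = ENNReal.ofReal (E / Q * Q ^ (j + 1)) := by
          rw [l2Norm_const_mul hc.measurable.enorm, ← hE, ← ENNReal.ofReal_coe_nnreal,
            ← ENNReal.ofReal_mul (by positivity)]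
          congr 1
          field_simp
          ring
  set S : ℕ → ℝ := fun m => (sobNorm t (fun x => k x ^ m)).toReal with hSdef
  have hSm : ∀ m ≥ 1, sobNorm t (fun x => k x ^ m) = ENNReal.ofReal (S m) := fun m hm =>
    (ENNReal.ofReal_toReal (hfin m hm).ne).symm
  have hS0 : ∀ m, 0 ≤ S m := fun m => ENNReal.toReal_nonneg
  -- One constant has to serve both hypotheses of the growth lemma: `C S(1)` for multiplication by
  -- one more `k`, and `2 B 4^(t/2)` for squaring.
  set C' : ℝ := C * S 1 + 4 ^ (t / 2) * (2 * B) with hC'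
  have hS1 := hS0 1
  suffices h : ∃ K, 0 ≤ K ∧ ∀ m ≥ 1, S m ≤ K * q ^ m by
    obtain ⟨K, hK, hSK⟩ := h
    exact ⟨K, hK, fun m hm => (hSm m hm).trans_le (ENNReal.ofReal_le_ofReal (hSK m hm))⟩
  refine exists_geometric_bound (C := C') (A := E / Q) hS0 (by positivity) (by positivity) ha0 ha1
    hQ0 hQq ?_ ?_
  · intro m hm
    have h1 := hC _ k (hcm m) (him m hm) (hfin m hm) hki
    have h2 : sobNorm t k = ENNReal.ofReal (S 1) := by simpa using hSm 1 le_rfl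
    simp_rw [← pow_succ] at h1
    rw [hSm _ (by omega), hSm m hm, h2, ← ENNReal.ofReal_coe_nnreal, ← ENNReal.ofReal_mul (hS0 m),
      ← ENNReal.ofReal_mul C.coe_nonneg] at h1
    have h3 := (ENNReal.ofReal_le_ofReal_iff
      (mul_nonneg C.coe_nonneg (mul_nonneg (hS0 m) (hS0 1)))).1 h1
    refine h3.trans ?_
    have : 0 ≤ 4 ^ (t / 2) * (2 * (B : ℝ)) * S m := mul_nonneg (by positivity) (hS0 m)
    rw [hC']
    linarith
  · intro m hm l hl
    -- For `k^m · k^m` each term of the product estimate has one factor in the Wiener norm.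
    -- Interpolating that factor brings in the `L²` norm, whose growth rate is `Q`.
    have h1 := sobNorm_mul_le ht0.le (hcm m) (him m hm) (hW m hm) (him m hm)
    have h2 : wienerNorm (fun x => k x ^ m) ≤
        ENNReal.ofReal (B * (l ^ a * (E / Q * Q ^ m) + l ^ (a - 1) * S m)) := by
      refine (wienerNorm_le_interpolate (t := t) ha0.le ha1.le hl (him m hm)).trans ?_
      rw [← hB, hSm m hm, ENNReal.ofReal_mul B.coe_nonneg, ENNReal.ofReal_coe_nnreal,
        ENNReal.ofReal_add (by positivity) (mul_nonneg (by positivity) (hS0 m)),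
        ENNReal.ofReal_mul (by positivity), ENNReal.ofReal_mul (p := l ^ (a - 1)) (by positivity)]
      gcongr
      exact hEm m hm
    simp_rw [← pow_add, ← two_mul] at h1
    have hR : 0 ≤ B * (l ^ a * (E / Q * Q ^ m) + l ^ (a - 1) * S m) :=
      mul_nonneg B.coe_nonneg (add_nonneg (by positivity) (mul_nonneg (by positivity) (hS0 m)))
    have h3 : ENNReal.ofReal (S (2 * m)) ≤ ENNReal.ofReal (4 ^ (t / 2) *
        (S m * (B * (l ^ a * (E / Q * Q ^ m) + l ^ (a - 1) * S m)) +
          (B * (l ^ a * (E / Q * Q ^ m) + l ^ (a - 1) * S m)) * S m)) := by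
      rw [← hSm _ (by omega), ENNReal.ofReal_mul (by positivity),
        ENNReal.ofReal_add (mul_nonneg (hS0 m) hR) (mul_nonneg hR (hS0 m)),
        ENNReal.ofReal_mul (hS0 m), ENNReal.ofReal_mul hR, ← hSm m hm]
      refine h1.trans ?_
      gcongr
    have h4 := (ENNReal.ofReal_le_ofReal_iff (mul_nonneg (by positivity)
      (add_nonneg (mul_nonneg (hS0 m) hR) (mul_nonneg hR (hS0 m))))).1 h3
    have h5 : 0 ≤ C * S 1 * S m * (l ^ a * (E / Q * Q ^ m) + l ^ (a - 1) * S m) :=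
      mul_nonneg (mul_nonneg (mul_nonneg C.coe_nonneg hS1) (hS0 m))
        (add_nonneg (by positivity) (mul_nonneg (by positivity) (hS0 m)))
    refine h4.trans ?_
    rw [hC']
    linarith

/-- Lower semicontinuity of the `H^t` norm. -/
lemma sobNorm_le_of_tendsto {t : ℝ} {k : V → ℂ} {f : ℕ → V → ℂ} (hf : ∀ N, Integrable (f N))
    (h : ∀ ξ, Filter.Tendsto (fun N => 𝓕 (f N) ξ) Filter.atTop (𝓝 (𝓕 k ξ))) {B : ℝ≥0∞}
    (hB : ∀ N, sobNorm t (f N) ≤ B) : sobNorm t k ≤ B := by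
  have h1 : ∀ ξ, (ENNReal.ofReal (japanese t ξ) * ‖𝓕 k ξ‖ₑ) ^ (2 : ℝ) = Filter.liminf
      (fun N => (ENNReal.ofReal (japanese t ξ) * ‖𝓕 (f N) ξ‖ₑ) ^ (2 : ℝ)) Filter.atTop := by
    intro ξ
    refine (Filter.Tendsto.liminf_eq ?_).symm
    refine (ENNReal.continuous_rpow_const.tendsto _).comp ?_
    exact ENNReal.Tendsto.const_mul ((continuous_enorm.tendsto _).comp (h ξ)) (by simp)
  -- Fatou's lemma.
  have h2 : ∫⁻ ξ, (ENNReal.ofReal (japanese t ξ) * ‖𝓕 k ξ‖ₑ) ^ (2 : ℝ) ≤ B ^ (2 : ℝ) := by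
    simp_rw [h1]
    refine (lintegral_liminf_le fun N => ?_).trans ?_
    · exact ((measurable_japanese t).ennreal_ofReal.mul
        (measurable_enorm_fourier (hf N))).pow_const _
    · refine Filter.liminf_le_of_frequently_le' (Filter.Frequently.of_forall fun N => ?_)
      have h3 := ENNReal.rpow_le_rpow (hB N) (zero_le_two (α := ℝ))
      rw [sobNorm, l2Norm, ← ENNReal.rpow_mul] at h3
      simpa using h3
  have h3 := ENNReal.rpow_le_rpow h2 (show (0 : ℝ) ≤ 1 / 2 by norm_num)
  rw [← ENNReal.rpow_mul] at h3
  simpa [sobNorm, l2Norm] using h3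

end EuclideanSobolevAlgebra

/-! ### `H^s(M, ℂ)` as a locally convex topological algebra. -/

section SobolevAlgebra

open MeasureTheory
open scoped ENNReal NNReal

set_option linter.unusedSectionVars false

variable {n : ℕ} {M : Type u} [TopologicalSpace M] [ChartedSpace (EuclideanSpace ℝ (Fin n)) M]
  [CompactSpace M] {s : WithTop ℝ}

namespace Localization

variable (L : Localization n M s)

lemma eLpNorm_weighted (f : M → ℂ) : eLpNorm (L.weighted f) 2 volume = sobNorm L.t (L.loc f) := by
  rw [eLpNorm_eq_lintegral_rpow_enorm_toReal two_ne_zero (by simp), sobNorm, l2Norm]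
  simp only [ENNReal.toReal_ofNat]
  congr 1
  refine lintegral_congr fun ξ => ?_
  rw [weighted, enorm_mul, ← ofReal_norm, Complex.norm_real, Real.norm_of_nonneg (by positivity)]
  rfl

/-- The extension by zero is continuous because the localized function vanishes off a compact subset
of the chart's image. -/
lemma continuous_loc (f : C(M, ℂ)) : Continuous (L.loc f) := by
  rw [continuous_iff_continuousAt]
  intro y
  by_cases hy : y ∈ L.chart.target
  · have h1 : ContinuousOn (fun y => (L.cutoff (L.chart.symm y) : ℂ) * f (L.chart.symm y))
        L.chart.target :=
      (Complex.continuous_ofReal.comp_continuousOn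
        (L.continuous_cutoff.comp_continuousOn L.chart.symm.continuousOn)).mul
        (f.continuous.comp_continuousOn L.chart.symm.continuousOn)
    refine (h1.continuousAt (L.chart.open_target.mem_nhds hy)).congr ?_
    filter_upwards [L.chart.open_target.mem_nhds hy] with z hz
    simp [loc, hz]
  · have hK : y ∉ L.K := fun h => hy (L.K_subset h)
    refine (continuousAt_const (y := (0 : ℂ))).congr ?_
    filter_upwards [L.isCompact_K.isClosed.isOpen_compl.mem_nhds hK] with z hz
    exact (L.loc_eq_zero _ hz).symm

lemma hasCompactSupport_loc (f : M → ℂ) : HasCompactSupport (L.loc f) :=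
  HasCompactSupport.intro L.isCompact_K fun _ hy => L.loc_eq_zero _ hy

lemma memLp_weighted_iff (f : C(M, ℂ)) :
    MemLp (L.weighted f) 2 ↔ sobNorm L.t (L.loc f) < ⊤ := by
  rw [← eLpNorm_weighted]
  refine ⟨fun h => h.2, fun h => ⟨?_, h⟩⟩
  refine (Measurable.mul ?_ (continuous_fourier (L.integrable_loc f)).measurable
    ).aestronglyMeasurable
  exact Complex.measurable_ofReal.comp (measurable_japanese L.t)

end Localization

lemma HsC.sobNorm_lt_top (f : HsC n M s) (L : Localization n M s) :
    sobNorm L.t (L.loc f) < ⊤ := (L.memLp_weighted_iff _).1 (f.2 L)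

/-- The seminorm of `H^s(M, ℂ)` given by a localization. -/
def HsC.localNorm (L : Localization n M s) (f : HsC n M s) : ℝ := ‖f.localLp L‖

lemma HsC.ofReal_localNorm (L : Localization n M s) (f : HsC n M s) :
    ENNReal.ofReal (f.localNorm L) = sobNorm L.t (L.loc f) := by
  rw [HsC.localNorm, ofReal_norm, HsC.localLp, Lp.enorm_toLp]
  exact L.eLpNorm_weighted _

lemma HsC.localNorm_nonneg (L : Localization n M s) (f : HsC n M s) : 0 ≤ f.localNorm L :=
  norm_nonneg _

/-- The map of `H^s(M, ℂ)` into the product of the spaces `L²(ℝⁿ)` that defines its topology. -/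
def HsC.localLpLin : HsC n M s →ₗ[ℂ] ∀ _ : Localization n M s,
    Lp ℂ 2 (volume : Measure (EuclideanSpace ℝ (Fin n))) where
  toFun f := f.localLp
  map_add' f g := by
    ext1 L
    have h := L.weighted_add f.toMap g.toMap
    simp only [Pi.add_apply, HsC.localLp, ← MemLp.toLp_add]
    congr 1
  map_smul' c f := by
    ext1 L
    have h := L.weighted_smul c f.toMap
    simp only [Pi.smul_apply, HsC.localLp, RingHom.id_apply, ← MemLp.toLp_const_smul]
    congr 1

lemma HsC.isInducing_localLpLin : Topology.IsInducing (HsC.localLpLin (n := n) (M := M) (s := s)) :=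
  ⟨rfl⟩

instance : IsTopologicalAddGroup (HsC n M s) :=
  topologicalAddGroup_induced (HsC.localLpLin (n := n) (M := M) (s := s))

instance : ContinuousSMul ℂ (HsC n M s) :=
  continuousSMul_induced (HsC.localLpLin (n := n) (M := M) (s := s))

instance : ContinuousSMul ℝ (HsC n M s) :=
  ⟨((Complex.continuous_ofReal.comp continuous_fst).smul continuous_snd :
    Continuous fun p : ℝ × HsC n M s => (p.1 : ℂ) • p.2)⟩

instance : LocallyConvexSpace ℝ (HsC n M s) :=
  HsC.isInducing_localLpLin.locallyConvexSpace (f := HsC.localLpLin.restrictScalars ℝ)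

lemma HsC.localNorm_add_le (L : Localization n M s) (f g : HsC n M s) :
    (f + g).localNorm L ≤ f.localNorm L + g.localNorm L := by
  have h : (f + g).localLp L = f.localLp L + g.localLp L := congrFun (HsC.localLpLin.map_add f g) L
  rw [HsC.localNorm, h]
  exact norm_add_le _ _

lemma HsC.localNorm_smul (L : Localization n M s) (c : ℂ) (f : HsC n M s) :
    (c • f).localNorm L = ‖c‖ * f.localNorm L := by
  have h : (c • f).localLp L = c • f.localLp L := congrFun (HsC.localLpLin.map_smul c f) L
  rw [HsC.localNorm, h, norm_smul, HsC.localNorm]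

lemma HsC.continuous_localNorm (L : Localization n M s) :
    Continuous fun f : HsC n M s => f.localNorm L :=
  ((continuous_apply L).comp HsC.isInducing_localLpLin.continuous).norm

lemma HsC.tendsto_zero_iff {α : Type*} {l : Filter α} {f : α → HsC n M s} :
    Filter.Tendsto f l (𝓝 0) ↔
      ∀ L : Localization n M s, Filter.Tendsto (fun a => (f a).localNorm L) l (𝓝 0) := by
  rw [HsC.isInducing_localLpLin.tendsto_nhds_iff, map_zero, tendsto_pi_nhds]
  refine forall_congr' fun L => ?_
  exact tendsto_zero_iff_norm_tendsto_zero

/-! ### The exponent and wider cutoffs -/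

variable [hs : Fact ((((n : ℝ) / 2 : ℝ) : WithTop ℝ) < s)]

variable (n s) in
-- The estimates need a finite exponent above `n/2`. For `s = ∞` any such number will do.
lemma exists_exponent : ∃ r : ℝ, (n : ℝ) / 2 < r ∧ (r : WithTop ℝ) ≤ s := by
  have h := hs.out
  induction s using WithTop.recTopCoe with
  | top => exact ⟨n / 2 + 1, by linarith, le_top⟩
  | coe r => exact ⟨r, by exact_mod_cast h, le_rfl⟩

/-- A localization with the same cutoff and a larger exponent, greater than `n/2`. -/
def Localization.raise (L : Localization n M s) : Localization n M s :=
  { L with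
    t := max L.t (exists_exponent n s).choose
    t_le := by
      rcases max_choice L.t (exists_exponent n s).choose with h | h <;> rw [h]
      · exact L.t_le
      · exact (exists_exponent n s).choose_spec.2 }

lemma Localization.lt_raise_t (L : Localization n M s) :
    (Module.finrank ℝ (EuclideanSpace ℝ (Fin n)) : ℝ) / 2 < L.raise.t := by
  rw [finrank_euclideanSpace_fin]
  exact (exists_exponent n s).choose_spec.1.trans_le (le_max_right _ _)

lemma Localization.le_raise_t (L : Localization n M s) : L.t ≤ L.raise.t := le_max_left _ _

variable [T2Space M] [IsManifold (𝓡 n) ∞ M]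

variable (n) in
-- The bump function vanishes near every point outside `O`, so even the closure of its support lies
-- in `O`. It is one on a whole neighbourhood of `K`.
lemma exists_cutoff {K O : Set M} (hK : IsClosed K) (hO : IsOpen O) (hKO : K ⊆ O) :
    ∃ χ : M → ℝ, ContMDiff (𝓡 n) 𝓘(ℝ, ℝ) ∞ χ ∧ tsupport χ ⊆ O ∧ (∀ᶠ x in 𝓝ˢ K, χ x = 1) ∧
      ∀ x, χ x ∈ Set.Icc (0 : ℝ) 1 := by
  obtain ⟨f, h0, h1, hf⟩ := exists_contMDiffMap_zero_one_nhds_of_isClosed (𝓡 n) (n := (⊤ : ℕ∞))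
    hO.isClosed_compl hK (Set.disjoint_compl_left_iff_subset.2 hKO)
  refine ⟨f, f.contMDiff, fun x hx => ?_, h1, hf⟩
  by_contra hxO
  exact notMem_tsupport_iff_eventuallyEq.2 (Filter.eventually_iff_exists_mem.2
    ⟨_, Filter.mem_of_superset ((mem_nhdsSet_iff_forall.1 h0) x hxO) fun y hy => hy,
      fun y hy => hy⟩) hx

/-- A localization in the same chart whose cutoff is one on the support of the given cutoff, with
the exponent raised. -/
def Localization.wide (L : Localization n M s) : Localization n M s :=
  let h := exists_cutoff n (isClosed_tsupport L.cutoff) L.chart.open_source L.support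
  { L.raise with
    cutoff := h.choose
    smooth := h.choose_spec.1
    support := h.choose_spec.2.1 }

/-- Where the cutoff of `L` does not vanish, the wider one equals one. A product can therefore be
localized by localizing each factor, without taking square roots of cutoffs. -/
lemma Localization.loc_mul (L : Localization n M s) (f g : M → ℂ) :
    L.loc (f * g) = fun y => L.loc f y * L.wide.loc g y := by
  ext y
  by_cases hy : y ∈ L.chart.target
  · have hy' : y ∈ L.wide.chart.target := hy
    have hc : L.wide.chart.symm y = L.chart.symm y := rfl
    simp only [loc, hy, hy', Set.indicator_of_mem, Pi.mul_apply, hc]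
    by_cases h : L.cutoff (L.chart.symm y) = 0
    · simp [h]
    · have h1 : L.wide.cutoff (L.chart.symm y) = 1 :=
        (exists_cutoff n (isClosed_tsupport L.cutoff) L.chart.open_source
          L.support).choose_spec.2.2.1.self_of_nhdsSet _ (subset_tsupport _ h)
      rw [h1]
      push_cast
      ring
  · simp [loc, hy]

lemma Localization.norm_wide_loc_le (L : Localization n M s) (f : C(M, ℂ))
    (y : EuclideanSpace ℝ (Fin n)) : ‖L.wide.loc f y‖ ≤ ‖f‖ := by
  by_cases hy : y ∈ L.wide.chart.target
  · simp only [loc, hy, Set.indicator_of_mem, norm_mul, Complex.norm_real]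
    have h : L.wide.cutoff (L.wide.chart.symm y) ∈ Set.Icc (0 : ℝ) 1 :=
      (exists_cutoff n (isClosed_tsupport L.cutoff) L.chart.open_source
        L.support).choose_spec.2.2.2 (L.wide.chart.symm y)
    have h1 : ‖L.wide.cutoff (L.wide.chart.symm y)‖ ≤ 1 := by
      rw [Real.norm_eq_abs, abs_le]
      exact ⟨by linarith [h.1], h.2⟩
    calc _ ≤ 1 * ‖f‖ := by gcongr; exact f.norm_coe_le_norm _
      _ = ‖f‖ := one_mul _
  · simp [loc, hy]

/-- A localization may have any exponent `t ≤ s`, but the product estimate holds above `n/2`. Hence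
the raised exponents on the right. -/
lemma Localization.exists_sobNorm_loc_mul_le (L : Localization n M s) :
    ∃ C : ℝ≥0, ∀ f g : C(M, ℂ), sobNorm L.raise.t (L.loc f) < ⊤ →
      sobNorm L.t (L.loc (f * g : C(M, ℂ))) ≤
        C * (sobNorm L.raise.t (L.loc f) * sobNorm L.raise.t (L.wide.loc g)) := by
  obtain ⟨C, hC⟩ := exists_sobNorm_mul_le L.lt_raise_t
  refine ⟨C, fun f g hf => ?_⟩
  rw [ContinuousMap.coe_mul, L.loc_mul]
  exact (sobNorm_mono L.le_raise_t _).trans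
    (hC _ _ (L.continuous_loc f) (L.integrable_loc f) hf (L.wide.integrable_loc g))

lemma sobolevSubmodule_mul_mem {f g : C(M, ℂ)} (hf : f ∈ sobolevSubmodule n M s)
    (hg : g ∈ sobolevSubmodule n M s) : f * g ∈ sobolevSubmodule n M s := by
  intro L
  obtain ⟨C, hC⟩ := L.exists_sobNorm_loc_mul_le
  have h1 := (L.raise.memLp_weighted_iff f).1 (hf L.raise)
  exact (L.memLp_weighted_iff _).2 ((hC f g h1).trans_lt (ENNReal.mul_lt_top (by simp)
    (ENNReal.mul_lt_top h1 ((L.wide.memLp_weighted_iff g).1 (hg L.wide)))))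

instance : Mul (HsC n M s) := ⟨fun f g => ⟨f.1 * g.1, sobolevSubmodule_mul_mem f.2 g.2⟩⟩

@[simp] lemma HsC.mul_apply (f g : HsC n M s) (x : M) : (f * g) x = f x * g x := rfl

lemma HsC.exists_localNorm_mul_le (L : Localization n M s) :
    ∃ C : ℝ, 0 ≤ C ∧ ∀ f g : HsC n M s,
      (f * g).localNorm L ≤ C * (f.localNorm L.raise * g.localNorm L.wide) := by
  obtain ⟨C, hC⟩ := L.exists_sobNorm_loc_mul_le
  refine ⟨C, C.coe_nonneg, fun f g => ?_⟩
  have h := hC f.1 g.1 (f.sobNorm_lt_top L.raise)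
  have h0 : 0 ≤ (C : ℝ) * (f.localNorm L.raise * g.localNorm L.wide) :=
    mul_nonneg C.coe_nonneg (mul_nonneg (f.localNorm_nonneg _) (g.localNorm_nonneg _))
  rw [← ENNReal.ofReal_le_ofReal_iff h0, ENNReal.ofReal_mul C.coe_nonneg,
    ENNReal.ofReal_mul (f.localNorm_nonneg _), HsC.ofReal_localNorm, HsC.ofReal_localNorm,
    HsC.ofReal_localNorm, ENNReal.ofReal_coe_nnreal]
  exact h

instance : ContinuousMul (HsC n M s) := by
  refine ⟨continuous_iff_continuousAt.2 ?_⟩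
  rintro ⟨f₀, g₀⟩
  rw [ContinuousAt, ← tendsto_sub_nhds_zero_iff, HsC.tendsto_zero_iff]
  intro L
  obtain ⟨C, hC, h⟩ := HsC.exists_localNorm_mul_le (n := n) (M := M) (s := s) L
  have h1 : Continuous fun p : HsC n M s × HsC n M s =>
      C * ((p.1 - f₀).localNorm L.raise * p.2.localNorm L.wide) +
        C * (f₀.localNorm L.raise * (p.2 - g₀).localNorm L.wide) := by
    have h2 := HsC.continuous_localNorm (n := n) (M := M) (s := s) L.raise
    have h3 := HsC.continuous_localNorm (n := n) (M := M) (s := s) L.wide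
    exact (continuous_const.mul ((h2.comp (by fun_prop)).mul (h3.comp (by fun_prop)))).add
      (continuous_const.mul (continuous_const.mul (h3.comp (by fun_prop))))
  have h0 : ∀ L : Localization n M s, (0 : HsC n M s).localNorm L = 0 := fun L => by
    rw [← zero_smul ℂ (0 : HsC n M s), HsC.localNorm_smul]; simp
  refine squeeze_zero (fun p => HsC.localNorm_nonneg _ _) (fun p => ?_)
    ((h1.tendsto (f₀, g₀)).trans_eq (by simp [h0]))
  -- The decomposition splits off the two increments. Each of the resulting products is bounded by
  -- seminorms, one of which tends to zero.
  have h4 : p.1 * p.2 - f₀ * g₀ = (p.1 - f₀) * p.2 + f₀ * (p.2 - g₀) :=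
    HsC.ext fun x => by simp; ring
  rw [h4]
  exact (HsC.localNorm_add_le _ _ _).trans (add_le_add (h _ _) (h _ _))

/-! ### The Sobolev embedding -/

variable (n s) in
-- With a cutoff equal to one near `x`, all values of `f` near `x` are values of its localization. A
-- pointwise bound for localizations thus bounds `f` itself.
lemma exists_localization_near (x : M) : ∃ L : Localization n M s,
    (Module.finrank ℝ (EuclideanSpace ℝ (Fin n)) : ℝ) / 2 < L.t ∧
    ∀ᶠ y in 𝓝 x, ∀ f : M → ℂ, ∃ z, L.loc f z = f y := by
  set e := chartAt (EuclideanSpace ℝ (Fin n)) x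
  have hx : x ∈ e.source := mem_chart_source _ x
  obtain ⟨χ, hχ, hsupp, h1, -⟩ := exists_cutoff n (isClosed_singleton (x := x)) e.open_source
    (Set.singleton_subset_iff.2 hx)
  let L : Localization n M s := ⟨e, IsManifold.chart_mem_maximalAtlas x, χ, hχ, hsupp,
    _, (exists_exponent n s).choose_spec.2⟩
  refine ⟨L, ?_, ?_⟩
  · rw [finrank_euclideanSpace_fin]
    exact (exists_exponent n s).choose_spec.1
  · rw [nhdsSet_singleton] at h1
    filter_upwards [h1, e.open_source.mem_nhds hx] with y hy hye f
    refine ⟨e y, ?_⟩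
    have h2 : e y ∈ L.chart.target := e.map_source hye
    have h3 : L.chart.symm (e y) = y := e.left_inv hye
    rw [Localization.loc, Set.indicator_of_mem h2, h3]
    simp [L, hy]

variable (n M s) in
-- Finitely many localizations see every point by compactness, and each one is bounded pointwise by
-- its Wiener norm, hence by its `H^t` norm with `t > n/2`.
lemma HsC.exists_norm_le : ∃ (I : Finset (Localization n M s)) (D : Localization n M s → ℝ),
    (∀ L, 0 ≤ D L) ∧ ∀ f : HsC n M s, ‖f.toMap‖ ≤ ∑ L ∈ I, D L * f.localNorm L := by
  classical
  choose L hLt hL using exists_localization_near (M := M) n s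
  obtain ⟨T, hT⟩ := CompactSpace.elim_nhds_subcover _ hL
  have hD : ∀ L : Localization n M s, ∃ D : ℝ, 0 ≤ D ∧
      ((Module.finrank ℝ (EuclideanSpace ℝ (Fin n)) : ℝ) / 2 < L.t →
        ∀ (f : HsC n M s) z, ‖L.loc f z‖ ≤ D * f.localNorm L) := by
    intro L
    by_cases h : (Module.finrank ℝ (EuclideanSpace ℝ (Fin n)) : ℝ) / 2 < L.t
    · obtain ⟨D, hD⟩ := exists_wienerNorm_le h
      refine ⟨D, D.coe_nonneg, fun _ f z => ?_⟩
      have h1 := (enorm_le_wienerNorm (L.continuous_loc f.toMap) (L.integrable_loc f.toMap) z).trans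
        (hD _ (L.integrable_loc f.toMap))
      rw [← HsC.ofReal_localNorm, ← ofReal_norm, ← ENNReal.ofReal_coe_nnreal,
        ← ENNReal.ofReal_mul D.coe_nonneg] at h1
      exact (ENNReal.ofReal_le_ofReal_iff (mul_nonneg D.coe_nonneg (f.localNorm_nonneg _))).1 h1
    · exact ⟨0, le_rfl, fun h' => absurd h' h⟩
  choose D hD0 hD using hD
  refine ⟨T.image L, D, hD0, fun f => ?_⟩
  have hpos : ∀ L, 0 ≤ D L * f.localNorm L := fun L => mul_nonneg (hD0 L) (f.localNorm_nonneg L)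
  refine (ContinuousMap.norm_le _ (Finset.sum_nonneg fun L _ => hpos L)).2 fun y => ?_
  have hy : y ∈ ⋃ x ∈ T, {y | ∀ f : M → ℂ, ∃ z, (L x).loc f z = f y} := hT ▸ Set.mem_univ y
  simp only [Set.mem_iUnion] at hy
  obtain ⟨x, hx, hy⟩ := hy
  obtain ⟨z, hz⟩ := hy f
  calc ‖f y‖ = ‖(L x).loc f z‖ := by rw [hz]
    _ ≤ D (L x) * f.localNorm (L x) := hD _ (hLt x) f z
    _ ≤ _ := Finset.single_le_sum (f := fun L => D L * f.localNorm L) (fun L _ => hpos L)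
        (Finset.mem_image_of_mem L hx)

variable (n M s) in
/-- The Sobolev embedding `H^s(M, ℂ) → C(M, ℂ)`. -/
def HsC.toMapL : HsC n M s →L[ℂ] C(M, ℂ) where
  toFun f := f.toMap
  map_add' _ _ := rfl
  map_smul' _ _ := rfl
  cont := by
    refine continuous_of_continuousAt_zero
      (AddMonoidHom.mk' (fun f : HsC n M s => f.toMap) fun _ _ => rfl) ?_
    obtain ⟨I, D, hD, h⟩ := HsC.exists_norm_le n M s
    rw [ContinuousAt, map_zero, tendsto_zero_iff_norm_tendsto_zero]
    refine squeeze_zero (fun _ => norm_nonneg _) h ?_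
    have h0 := HsC.tendsto_zero_iff.1 (Filter.tendsto_id (α := HsC n M s) (x := 𝓝 0))
    simpa using tendsto_finsetSum I fun L _ => (h0 L).const_mul (D L)

lemma HsC.toMapL_apply (f : HsC n M s) : HsC.toMapL n M s f = f.toMap := rfl

instance : T2Space (HsC n M s) :=
  T2Space.of_injective_continuous (f := HsC.toMapL n M s) Subtype.val_injective
    (HsC.toMapL n M s).continuous

end SobolevAlgebra

/-! ### Power series operating on `H^s`. -/

section FunctionalCalculus

open MeasureTheory
open scoped ENNReal NNReal

set_option linter.unusedSectionVars false

variable {n : ℕ} {M : Type u} [TopologicalSpace M] [ChartedSpace (EuclideanSpace ℝ (Fin n)) M]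
  [CompactSpace M] {s : WithTop ℝ}

/-- Dominated convergence: a uniformly convergent sequence is bounded, and the localized constant
function is integrable. -/
lemma Localization.tendsto_fourier_loc (L : Localization n M s) {f : ℕ → C(M, ℂ)} {g : C(M, ℂ)}
    (h : Filter.Tendsto f Filter.atTop (𝓝 g)) (ξ : EuclideanSpace ℝ (Fin n)) :
    Filter.Tendsto (fun N => 𝓕 (L.loc (f N)) ξ) Filter.atTop (𝓝 (𝓕 (L.loc g) ξ)) := by
  have hloc : ∀ (f : M → ℂ) y, L.loc f y = L.loc 1 y * f (L.chart.symm y) := by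
    intro f y
    by_cases hy : y ∈ L.chart.target <;> simp [loc, hy]
  obtain ⟨B, hB⟩ := h.norm.bddAbove_range
  simp only [Real.fourier_eq]
  refine tendsto_integral_of_dominated_convergence (fun y => ‖L.loc (1 : C(M, ℂ)) y‖ * B) ?_
    ((L.integrable_loc 1).norm.mul_const B) ?_ ?_
  · intro N
    refine Continuous.aestronglyMeasurable ?_
    simp only [Circle.smul_def, smul_eq_mul]
    exact (continuous_induced_dom.comp (Real.continuous_fourierChar.comp (by fun_prop))).mul
      (L.continuous_loc _)
  · refine fun N => Filter.Eventually.of_forall fun y => ?_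
    rw [Circle.norm_smul, hloc, norm_mul]
    refine mul_le_mul_of_nonneg_left ?_ (norm_nonneg _)
    exact ((f N).norm_coe_le_norm _).trans (hB ⟨N, rfl⟩)
  · refine Filter.Eventually.of_forall fun y => ?_
    refine Filter.Tendsto.const_smul ?_ _
    simp only [hloc (f _), hloc g]
    exact (((continuous_eval_const (L.chart.symm y)).tendsto g).comp h).const_mul _

lemma HsC.localNorm_sum_le (L : Localization n M s) {ι : Type*} (I : Finset ι)
    (f : ι → HsC n M s) : (∑ i ∈ I, f i).localNorm L ≤ ∑ i ∈ I, (f i).localNorm L := by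
  have h : (∑ i ∈ I, f i).localLp L = ∑ i ∈ I, (f i).localLp L := by
    have := congrFun (map_sum HsC.localLpLin f I) L
    rwa [Finset.sum_apply] at this
  rw [HsC.localNorm, h]
  exact norm_sum_le _ _

/-- The `H^t` norm of the sum of a uniformly convergent series. -/
lemma Localization.sobNorm_loc_le_of_hasSum (L : Localization n M s) {g : ℕ → HsC n M s}
    {f : C(M, ℂ)} (hf : HasSum (fun m => (g m).toMap) f) {b : ℕ → ℝ} (hb0 : ∀ m, 0 ≤ b m)
    (hb : ∀ m, (g m).localNorm L ≤ b m) (hbs : Summable b) :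
    sobNorm L.t (L.loc f) ≤ ENNReal.ofReal (∑' m, b m) := by
  -- No completeness of `H^s` is needed. The partial sums converge uniformly, so their localized
  -- Fourier transforms converge pointwise, and lower semicontinuity carries the bound to the limit.
  refine sobNorm_le_of_tendsto (f := fun N => L.loc (∑ m ∈ Finset.range N, g m : HsC n M s))
    (fun N => L.integrable_loc _) (L.tendsto_fourier_loc ?_) fun N => ?_
  · refine hf.tendsto_sum_nat.congr fun N => ?_
    exact (map_sum (AddMonoidHom.mk' (fun f : HsC n M s => f.toMap) fun _ _ => rfl) g _).symm
  · rw [← HsC.ofReal_localNorm]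
    refine ENNReal.ofReal_le_ofReal ((HsC.localNorm_sum_le L _ g).trans ?_)
    exact (Finset.sum_le_sum fun m _ => hb m).trans (hbs.sum_le_tsum _ fun m _ => hb0 m)

variable [IsManifold (𝓡 n) ∞ M]

instance : One (HsC n M s) := ⟨⟨1, fun L => L.memLp_weighted_one⟩⟩

@[simp] lemma HsC.one_apply (x : M) : (1 : HsC n M s) x = 1 := rfl

variable [T2Space M] [hs : Fact ((((n : ℝ) / 2 : ℝ) : WithTop ℝ) < s)]

instance : Pow (HsC n M s) ℕ := ⟨fun f m => ⟨f.1 ^ m, by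
  induction m with
  | zero => rw [pow_zero]; exact (1 : HsC n M s).2
  | succ m ih => rw [pow_succ]; exact sobolevSubmodule_mul_mem ih f.2⟩⟩

@[simp] lemma HsC.pow_apply (f : HsC n M s) (m : ℕ) (x : M) : (f ^ m) x = f x ^ m := rfl

lemma HsC.toMap_pow (f : HsC n M s) (m : ℕ) : (f ^ m).toMap = f.toMap ^ m := rfl

/-- Only one factor carries the narrow cutoff. The powers are those of one fixed compactly supported
function, whose growth is known. -/
lemma Localization.loc_pow (L : Localization n M s) (f : M → ℂ) (m : ℕ) :
    L.loc (f ^ m) = fun y => L.loc 1 y * L.wide.loc f y ^ m := by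
  ext y
  by_cases hy : y ∈ L.chart.target
  · have hy' : y ∈ L.wide.chart.target := hy
    have hc : L.wide.chart.symm y = L.chart.symm y := rfl
    simp only [loc, hy, hy', Set.indicator_of_mem, Pi.pow_apply, hc, Pi.one_apply, mul_one]
    by_cases h : L.cutoff (L.chart.symm y) = 0
    · simp [h]
    · have h1 : L.wide.cutoff (L.chart.symm y) = 1 :=
        (exists_cutoff n (isClosed_tsupport L.cutoff) L.chart.open_source
          L.support).choose_spec.2.2.1.self_of_nhdsSet _ (subset_tsupport _ h)
      rw [h1]
      push_cast
      ring
  · simp [loc, hy]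

/-- The powers of `f` grow in the `H^s` topology like those of the maximum of `|f|`. -/
lemma HsC.exists_localNorm_pow_le (L : Localization n M s) (f : HsC n M s) {q : ℝ}
    (hq : ‖f.toMap‖ < q) : ∃ K : ℝ, 0 ≤ K ∧ ∀ m, (f ^ m).localNorm L ≤ K * q ^ m := by
  have hq0 : 0 < q := (norm_nonneg _).trans_lt hq
  obtain ⟨C, hC⟩ := exists_sobNorm_mul_le L.lt_raise_t
  -- The midpoint of `‖f‖` and `q` lies strictly below `q`, bounds the localized function, and is
  -- positive even if `f = 0`.
  obtain ⟨K, hK, h⟩ := exists_sobNorm_pow_le L.lt_raise_t (L.wide.continuous_loc f.toMap)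
    (L.wide.hasCompactSupport_loc f.toMap) (f.sobNorm_lt_top L.wide) (Q := (‖f.toMap‖ + q) / 2)
    (q := q) (fun y => (L.norm_wide_loc_le f.toMap y).trans (by linarith))
    (by have := norm_nonneg f.toMap; linarith) (by linarith)
  have h1 := (1 : HsC n M s).localNorm_nonneg L.raise
  have h2 := (1 : HsC n M s).localNorm_nonneg L
  have h0 : (0 : ℝ) ≤ C * ((1 : HsC n M s).localNorm L.raise * K) :=
    mul_nonneg C.coe_nonneg (mul_nonneg h1 hK)
  refine ⟨C * ((1 : HsC n M s).localNorm L.raise * K) + (1 : HsC n M s).localNorm L,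
    add_nonneg h0 h2, fun m => ?_⟩
  -- The zeroth power of the localized function is the constant one on `ℝⁿ`, which has no finite
  -- norm. This case is covered by the local norm of the constant function on `M`.
  rcases Nat.eq_zero_or_pos m with rfl | hm
  · have e : (f ^ 0 : HsC n M s) = 1 := HsC.ext fun x => pow_zero _
    rw [e, pow_zero, mul_one]
    exact le_add_of_nonneg_left h0
  · have hp : 0 ≤ K * q ^ m := mul_nonneg hK (by positivity)
    have h3 : (f ^ m).localNorm L ≤ C * ((1 : HsC n M s).localNorm L.raise * (K * q ^ m)) := by
      rw [← ENNReal.ofReal_le_ofReal_iff (mul_nonneg C.coe_nonneg (mul_nonneg h1 hp)),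
        HsC.ofReal_localNorm, ENNReal.ofReal_mul C.coe_nonneg, ENNReal.ofReal_mul h1,
        ENNReal.ofReal_coe_nnreal, HsC.ofReal_localNorm, HsC.toMap_pow, ContinuousMap.coe_pow,
        L.loc_pow]
      refine (sobNorm_mono L.le_raise_t _).trans ((hC _ _ (L.raise.continuous_loc 1)
        (L.raise.integrable_loc 1) ((1 : HsC n M s).sobNorm_lt_top L.raise) ?_).trans ?_)
      · refine (Continuous.pow (L.wide.continuous_loc f.toMap) m).integrable_of_hasCompactSupport ?_
        exact (L.wide.hasCompactSupport_loc f.toMap).comp_left (g := fun z => z ^ m)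
          (zero_pow (by omega))
      · gcongr
        · exact le_rfl
        · exact h m hm
    refine h3.trans ?_
    have : 0 ≤ (1 : HsC n M s).localNorm L * q ^ m := by positivity
    linarith

/-- A bound on the powers of `f` which is uniform in `f`. -/
lemma HsC.exists_localNorm_pow_le' (L : Localization n M s) :
    ∃ C B : ℝ, 0 ≤ C ∧ 0 ≤ B ∧
      ∀ (f : HsC n M s) (m : ℕ), (f ^ m).localNorm L ≤ C * (B * f.localNorm L.wide) ^ m := by
  obtain ⟨C, hC⟩ := exists_sobNorm_mul_le L.lt_raise_t
  have h1 := (1 : HsC n M s).localNorm_nonneg L.raise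
  have h2 := (1 : HsC n M s).localNorm_nonneg L
  set D : ℝ := C * (1 : HsC n M s).localNorm L.raise with hD
  have hD0 : 0 ≤ D := mul_nonneg C.coe_nonneg h1
  -- With `C + 1` in place of `C`, the first power also satisfies the geometric bound.
  refine ⟨D + (1 : HsC n M s).localNorm L, C + 1, by positivity, by positivity, fun f m => ?_⟩
  rcases Nat.eq_zero_or_pos m with rfl | hm
  · have e : (f ^ 0 : HsC n M s) = 1 := HsC.ext fun x => pow_zero _
    rw [e, pow_zero, mul_one]
    exact le_add_of_nonneg_left hD0
  · have hf0 := f.localNorm_nonneg L.wide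
    have hcw := L.wide.continuous_loc f.toMap
    have hiw : ∀ m ≥ 1, Integrable fun y => L.wide.loc f.toMap y ^ m := fun m hm =>
      (hcw.pow m).integrable_of_hasCompactSupport
        ((L.wide.hasCompactSupport_loc f.toMap).comp_left (g := fun z => z ^ m)
          (zero_pow (by omega)))
    have hw : sobNorm L.raise.t (L.wide.loc f.toMap) = ENNReal.ofReal (f.localNorm L.wide) :=
      (HsC.ofReal_localNorm L.wide f).symm
    have hpow : ∀ m ≥ 1, sobNorm L.raise.t (fun y => L.wide.loc f.toMap y ^ m) ≤
        ENNReal.ofReal (((C + 1) * f.localNorm L.wide) ^ m) := by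
      intro m hm
      induction m, hm using Nat.le_induction with
      | base =>
        simp only [pow_one, hw]
        refine ENNReal.ofReal_le_ofReal ?_
        nlinarith [mul_nonneg C.coe_nonneg hf0]
      | succ m hm ih =>
        simp_rw [pow_succ]
        refine (hC _ _ (hcw.pow m) (hiw m hm) (ih.trans_lt (by simp))
          (L.wide.integrable_loc f.toMap)).trans ?_
        rw [hw, ENNReal.ofReal_mul (by positivity), ENNReal.ofReal_mul (by positivity)]
        calc (C : ℝ≥0∞) * (_ * _) ≤ ENNReal.ofReal (C + 1) *
              (ENNReal.ofReal (((C + 1) * f.localNorm L.wide) ^ m) *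
                ENNReal.ofReal (f.localNorm L.wide)) := by
              refine mul_le_mul' ?_ (mul_le_mul' ih le_rfl)
              rw [← ENNReal.ofReal_coe_nnreal]
              exact ENNReal.ofReal_le_ofReal (by linarith)
          _ = _ := by ring
    have h3 : (f ^ m).localNorm L ≤ C * ((1 : HsC n M s).localNorm L.raise *
        ((C + 1) * f.localNorm L.wide) ^ m) := by
      rw [← ENNReal.ofReal_le_ofReal_iff (mul_nonneg C.coe_nonneg (mul_nonneg h1 (by positivity))),
        HsC.ofReal_localNorm, ENNReal.ofReal_mul C.coe_nonneg, ENNReal.ofReal_mul h1,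
        ENNReal.ofReal_coe_nnreal, HsC.ofReal_localNorm, HsC.toMap_pow, ContinuousMap.coe_pow,
        L.loc_pow]
      refine (sobNorm_mono L.le_raise_t _).trans ((hC _ _ (L.raise.continuous_loc 1)
        (L.raise.integrable_loc 1) ((1 : HsC n M s).sobNorm_lt_top L.raise) (hiw m hm)).trans ?_)
      gcongr
      · exact le_rfl
      · exact hpow m hm
    refine h3.trans ?_
    have h4 : 0 ≤ (1 : HsC n M s).localNorm L * ((C + 1) * f.localNorm L.wide) ^ m := by
      positivity
    rw [hD]
    linarith

/-- `φ` is represented by a power series with bounded coefficients in the unit disc. -/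
structure IsDiscSeries (a : ℕ → ℂ) (φ : ℂ → ℂ) : Prop where
  norm_le : ∃ A : ℝ, ∀ m, ‖a m‖ ≤ A
  hasSum : ∀ z : ℂ, ‖z‖ < 1 → HasSum (fun m => a m * z ^ m) (φ z)

/-- The series converges absolutely in the sup norm, and evaluation at points identifies its sum. -/
lemma HsC.hasSum_of_pointwise {a : ℕ → ℂ} {φ : ℂ → ℂ} {q : ℝ} (ha : Summable fun m => ‖a m‖ * q ^ m)
    {f : HsC n M s} (hf : ‖f.toMap‖ ≤ q)
    (hφ : ∀ x, HasSum (fun m => a m * f x ^ m) (φ (f x))) {g : C(M, ℂ)}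
    (hg : ∀ x, g x = φ (f x)) : HasSum (fun m => (a m • f ^ m : HsC n M s).toMap) g := by
  have hq : 0 ≤ q := (norm_nonneg _).trans hf
  have hsum : Summable fun m => (a m • f ^ m : HsC n M s).toMap := by
    refine Summable.of_norm_bounded ha fun m => ?_
    change ‖a m • f.toMap ^ m‖ ≤ _
    rw [norm_smul]
    gcongr
    refine (ContinuousMap.norm_le _ (by positivity)).2 fun x => ?_
    rw [ContinuousMap.pow_apply, norm_pow]
    gcongr
    exact (f.toMap.norm_coe_le_norm x).trans hf
  convert hsum.hasSum using 1
  ext x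
  rw [hg x]
  refine (hφ x).unique ?_
  exact ((ContinuousMap.evalCLM ℂ x).hasSum hsum.hasSum)

/-- Power series that converge on a neighbourhood of the range of `f` operate on `H^s`. -/
lemma HsC.mem_of_hasSum {a : ℕ → ℂ} {φ : ℂ → ℂ} {q : ℝ} (ha : Summable fun m => ‖a m‖ * q ^ m)
    {f : HsC n M s} (hf : ‖f.toMap‖ < q)
    (hφ : ∀ x, HasSum (fun m => a m * f x ^ m) (φ (f x))) {g : C(M, ℂ)}
    (hg : ∀ x, g x = φ (f x)) : g ∈ sobolevSubmodule n M s := by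
  intro L
  rw [L.memLp_weighted_iff]
  obtain ⟨K, hK, h⟩ := f.exists_localNorm_pow_le L hf
  have hq : 0 < q := (norm_nonneg _).trans_lt hf
  refine (L.sobNorm_loc_le_of_hasSum (HsC.hasSum_of_pointwise ha hf.le hφ hg)
    (b := fun m => K * (‖a m‖ * q ^ m)) (fun m => by positivity) (fun m => ?_)
    (ha.mul_left K)).trans_lt ENNReal.ofReal_lt_top
  rw [HsC.localNorm_smul]
  calc ‖a m‖ * (f ^ m).localNorm L ≤ ‖a m‖ * (K * q ^ m) := by gcongr; exact h m
    _ = _ := by ring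

namespace IsDiscSeries

variable {a : ℕ → ℂ} {φ : ℂ → ℂ}

lemma summable (h : IsDiscSeries a φ) {q : ℝ} (hq : 0 ≤ q) (hq1 : q < 1) :
    Summable fun m => ‖a m‖ * q ^ m := by
  obtain ⟨A, hA⟩ := h.norm_le
  refine Summable.of_nonneg_of_le (fun m => by positivity) (fun m => ?_)
    ((summable_geometric_of_lt_one hq hq1).mul_left A)
  gcongr
  exact hA m

lemma exists_eq (h : IsDiscSeries a φ) {f : HsC n M s} (hf : ‖f.toMap‖ < 1) :
    ∃ g : HsC n M s, ∀ x, g x = φ (f x) := by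
  obtain ⟨q, hq, hq1⟩ := exists_between hf
  have hq0 : 0 ≤ q := (norm_nonneg _).trans hq.le
  have hx : ∀ x, HasSum (fun m => a m * f x ^ m) (φ (f x)) := fun x =>
    h.hasSum _ ((f.toMap.norm_coe_le_norm x).trans_lt hf)
  have hsum : Summable fun m => a m • f.toMap ^ m := by
    refine Summable.of_norm_bounded (h.summable hq0 hq1) fun m => ?_
    rw [norm_smul]
    gcongr
    refine (ContinuousMap.norm_le _ (by positivity)).2 fun x => ?_
    rw [ContinuousMap.pow_apply, norm_pow]
    gcongr
    exact (f.toMap.norm_coe_le_norm x).trans hq.le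
  have hg : ∀ x, (∑' m, a m • f.toMap ^ m) x = φ (f x) := fun x =>
    ((ContinuousMap.evalCLM ℂ x).hasSum hsum.hasSum).unique (hx x)
  exact ⟨⟨_, HsC.mem_of_hasSum (h.summable hq0 hq1) hq hx hg⟩, hg⟩

/-- For `f` small in a local norm, the crude bound on powers makes the series geometric. The
constants depend on the coefficients only through their bound `A`, so they also apply to a shifted
series. -/
lemma exists_localNorm_le (A : ℝ) (L : Localization n M s) :
    ∃ C δ : ℝ, 0 < δ ∧ ∀ (a : ℕ → ℂ) (φ : ℂ → ℂ), IsDiscSeries a φ → (∀ m, ‖a m‖ ≤ A) →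
      ∀ f g : HsC n M s, ‖f.toMap‖ < 1 → f.localNorm L.wide < δ → (∀ x, g x = φ (f x)) →
        g.localNorm L ≤ C := by
  obtain ⟨C, B, hC, hB, h⟩ := HsC.exists_localNorm_pow_le' (n := n) (M := M) (s := s) L
  -- The radius is chosen so that the ratio `B ‖f‖` of the geometric series is at most `1/2`. Adding
  -- one to `B` avoids division by zero.
  refine ⟨∑' m : ℕ, |A| * (C * (1 / 2) ^ m), 1 / (2 * (B + 1)), by positivity, ?_⟩
  intro a φ ha hA f g hf hfL hg
  obtain ⟨q, hq, hq1⟩ := exists_between hf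
  have hq0 : 0 ≤ q := (norm_nonneg _).trans hq.le
  have hx : ∀ x, HasSum (fun m => a m * f x ^ m) (φ (f x)) := fun x =>
    ha.hasSum _ ((f.toMap.norm_coe_le_norm x).trans_lt hf)
  have hf0 := f.localNorm_nonneg L.wide
  have hBf : B * f.localNorm L.wide ≤ 1 / 2 := by
    rw [lt_div_iff₀ (by positivity)] at hfL
    nlinarith
  have h1 := L.sobNorm_loc_le_of_hasSum (HsC.hasSum_of_pointwise (ha.summable hq0 hq1) hq.le hx hg)
    (b := fun m => |A| * (C * (1 / 2) ^ m)) (fun m => by positivity) (fun m => ?_)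
    ((summable_geometric_two.mul_left C).mul_left |A|)
  · rw [← HsC.ofReal_localNorm] at h1
    exact (ENNReal.ofReal_le_ofReal_iff (tsum_nonneg fun m => by positivity)).1 h1
  · rw [HsC.localNorm_smul]
    refine mul_le_mul ((hA m).trans (le_abs_self A)) ((h f m).trans ?_)
      (HsC.localNorm_nonneg _ _) (abs_nonneg _)
    gcongr

/-- First order Taylor expansion at zero of the operator `f ↦ φ ∘ f`. -/
lemma exists_localNorm_sub_le (h : IsDiscSeries a φ) (L : Localization n M s) :
    ∃ C δ : ℝ, 0 ≤ C ∧ 0 < δ ∧ ∃ L₁ L₂ L₃ : Localization n M s, ∀ f g : HsC n M s,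
      ‖f.toMap‖ < 1 → f.localNorm L₃ < δ → (∀ x, g x = φ (f x)) →
      (g - a 0 • 1 - a 1 • f).localNorm L ≤ C * (f.localNorm L₁ * f.localNorm L₂) := by
  obtain ⟨A, hA⟩ := h.norm_le
  obtain ⟨C₁, hC₁, h₁⟩ := HsC.exists_localNorm_mul_le (n := n) (M := M) (s := s) L
  obtain ⟨C₂, hC₂, h₂⟩ := HsC.exists_localNorm_mul_le (n := n) (M := M) (s := s) L.wide
  obtain ⟨C₃, δ, hδ, h₃⟩ := exists_localNorm_le (n := n) (M := M) (s := s) A L.wide.wide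
  refine ⟨C₁ * (C₂ * |C₃|), δ, by positivity, hδ, L.raise, L.wide.raise, L.wide.wide.wide, ?_⟩
  intro f g hf hfδ hg
  -- The Taylor remainder is `f² G`, where `G` is `f` inserted into the series shifted by two. That
  -- series is again of the same kind, so `G` is locally bounded and the remainder is quadratic.
  have ha2 : IsDiscSeries (fun m => a (m + 2)) (fun z => ∑' m, a (m + 2) * z ^ m) := by
    refine ⟨⟨A, fun m => hA _⟩, fun z hz => Summable.hasSum ?_⟩
    refine Summable.of_norm_bounded ((summable_geometric_of_lt_one (norm_nonneg z) hz).mul_left A)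
      fun m => ?_
    rw [norm_mul, norm_pow]
    gcongr
    exact hA _
  obtain ⟨G, hG⟩ := ha2.exists_eq hf
  have hfac : g - a 0 • 1 - a 1 • f = f * (f * G) := by
    refine HsC.ext fun x => ?_
    have hx := (f.toMap.norm_coe_le_norm x).trans_lt hf
    have e1 := (hasSum_nat_add_iff' 2).2 (h.hasSum _ hx)
    have e0 : (fun m => a (m + 2) * f x ^ (m + 2)) = fun m => f x ^ 2 * (a (m + 2) * f x ^ m) :=
      funext fun m => by ring
    rw [e0] at e1
    have e2 := ((ha2.hasSum _ hx).mul_left (f x ^ 2)).unique e1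
    simp only [HsC.sub_apply, HsC.smul_apply, HsC.one_apply, HsC.mul_apply, hg, hG]
    rw [← mul_assoc, ← sq, e2]
    simp [Finset.sum_range_succ]
    ring
  rw [hfac]
  have n1 := f.localNorm_nonneg L.raise
  have n2 := f.localNorm_nonneg L.wide.raise
  calc (f * (f * G)).localNorm L ≤ C₁ * (f.localNorm L.raise * (f * G).localNorm L.wide) := h₁ _ _
    _ ≤ C₁ * (f.localNorm L.raise * (C₂ * (f.localNorm L.wide.raise * |C₃|))) := by
        gcongr
        refine (h₂ _ _).trans ?_
        gcongr
        exact (h₃ _ _ ha2 (fun m => hA _) f G hf hfδ hG).trans (le_abs_self _)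
    _ = _ := by ring

lemma eventually_small {α : Type*} {l : Filter α} {f : α → HsC n M s}
    (hf : Filter.Tendsto f l (𝓝 0)) : ∀ᶠ i in l, ‖(f i).toMap‖ < 1 := by
  have h1 := (((HsC.toMapL n M s).continuous.tendsto 0).comp hf).norm
  rw [map_zero, norm_zero] at h1
  exact h1.eventually (gt_mem_nhds one_pos)

/-- Continuity is needed only at zero, since the functional equations of `exp` and `log` carry it to
other points. -/
lemma tendsto (h : IsDiscSeries a φ) {α : Type*} {l : Filter α} {f g : α → HsC n M s}
    (hf : Filter.Tendsto f l (𝓝 0)) (hg : ∀ᶠ i in l, ∀ x, g i x = φ (f i x)) :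
    Filter.Tendsto g l (𝓝 (a 0 • 1)) := by
  have h1 : Filter.Tendsto (fun i => g i - a 0 • 1 - a 1 • f i) l (𝓝 0) := by
    rw [HsC.tendsto_zero_iff]
    intro L
    obtain ⟨C, δ, hC, hδ, L₁, L₂, L₃, hb⟩ := h.exists_localNorm_sub_le L
    have hfL := HsC.tendsto_zero_iff.1 hf
    refine squeeze_zero' (Filter.Eventually.of_forall fun i => HsC.localNorm_nonneg _ _)
      (g := fun i => C * ((f i).localNorm L₁ * (f i).localNorm L₂)) ?_ ?_
    · filter_upwards [hg, eventually_small hf, (hfL L₃).eventually (gt_mem_nhds hδ)]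
        with i hi1 hi2 hi3
      exact hb _ _ hi2 hi3 hi1
    · simpa using ((hfL L₁).mul (hfL L₂)).const_mul C
  have h2 := (h1.add (hf.const_smul (a 1))).add_const (a 0 • (1 : HsC n M s))
  simpa using h2

/-- The remainder is quadratic in `t v`, so after division by `t` it is still of order `|t|` in
every seminorm. -/
lemma tendsto_slope (h : IsDiscSeries a φ) (v : HsC n M s) {g : ℝ → HsC n M s}
    (hg : ∀ᶠ t in 𝓝[≠] (0 : ℝ), ∀ x, g t x = φ (t * v x)) :
    Filter.Tendsto (fun t : ℝ => t⁻¹ • (g t - a 0 • 1)) (𝓝[≠] 0) (𝓝 (a 1 • v)) := by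
  have ht0 : Filter.Tendsto (fun t : ℝ => t) (𝓝[≠] 0) (𝓝 0) := nhdsWithin_le_nhds
  have hf : Filter.Tendsto (fun t : ℝ => (t : ℂ) • v) (𝓝[≠] 0) (𝓝 0) := by
    have := ((Complex.continuous_ofReal.tendsto 0).comp ht0).smul_const v
    simpa using this
  rw [← tendsto_sub_nhds_zero_iff, HsC.tendsto_zero_iff]
  intro L
  obtain ⟨C, δ, hC, hδ, L₁, L₂, L₃, hb⟩ := h.exists_localNorm_sub_le L
  have hfL := HsC.tendsto_zero_iff.1 hf
  refine squeeze_zero' (Filter.Eventually.of_forall fun i => HsC.localNorm_nonneg _ _)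
    (g := fun t => |t| * (C * (v.localNorm L₁ * v.localNorm L₂))) ?_ ?_
  · filter_upwards [hg, eventually_small hf, (hfL L₃).eventually (gt_mem_nhds hδ),
      self_mem_nhdsWithin] with t h1 h2 h3 ht
    replace ht : t ≠ 0 := ht
    have e : t⁻¹ • (g t - a 0 • 1) - a 1 • v =
        ((t : ℂ)⁻¹) • (g t - a 0 • 1 - a 1 • ((t : ℂ) • v)) := by
      have hc : (t : ℂ) ≠ 0 := by exact_mod_cast ht
      rw [smul_sub _ _ (a 1 • _), smul_comm (a 1), inv_smul_smul₀ hc]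
      congr 1
      rw [← Complex.ofReal_inv]
      exact (Complex.coe_smul _ _).symm
    have h4 := hb _ _ h2 h3 h1
    rw [HsC.localNorm_smul, HsC.localNorm_smul] at h4
    rw [e, HsC.localNorm_smul]
    have hn : ‖(t : ℂ)‖ = |t| := by simp
    rw [norm_inv, hn]
    rw [hn] at h4
    have htp : 0 < |t| := abs_pos.2 ht
    rw [inv_mul_le_iff₀ htp]
    refine h4.trans_eq (by ring)
  · have := (ht0.abs).mul_const (C * (v.localNorm L₁ * v.localNorm L₂))
    simpa using this

end IsDiscSeries

end FunctionalCalculus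

/-! ### The exponential and the logarithm as smooth maps of `H^s(M, ℂ)`. -/

section ExpLog

open MeasureTheory
open scoped ENNReal NNReal

set_option linter.unusedSectionVars false

lemma isDiscSeries_exp : IsDiscSeries (fun m => (m.factorial : ℂ)⁻¹) Complex.exp := by
  refine ⟨⟨1, fun m => ?_⟩, fun z _ => ?_⟩
  · rw [norm_inv, Complex.norm_natCast]
    exact inv_le_one_of_one_le₀ (by exact_mod_cast Nat.one_le_iff_ne_zero.2 m.factorial_ne_zero)
  · rw [Complex.exp_eq_exp_ℂ]
    simpa only [smul_eq_mul] using NormedSpace.exp_series_hasSum_exp' (𝕂 := ℂ) z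

lemma isDiscSeries_log :
    IsDiscSeries (fun m => (-1) ^ (m + 1) / (m : ℂ)) (fun z => Complex.log (1 + z)) := by
  refine ⟨⟨1, fun m => ?_⟩, fun z hz => ?_⟩
  -- At `m = 0` division by zero gives the coefficient `0`, which is the constant term of `log (1 +
  -- z)`.
  · rcases Nat.eq_zero_or_pos m with rfl | hm
    · simp
    · rw [norm_div, norm_pow, norm_neg, norm_one, one_pow, Complex.norm_natCast]
      exact (div_le_one (by positivity)).2 (by exact_mod_cast hm)
  · convert Complex.hasSum_taylorSeries_log hz using 2
    ring

variable {n : ℕ} {M : Type u} [TopologicalSpace M] [ChartedSpace (EuclideanSpace ℝ (Fin n)) M]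
  [CompactSpace M] {s : WithTop ℝ} [IsManifold (𝓡 n) ∞ M] [T2Space M]
  [hs : Fact ((((n : ℝ) / 2 : ℝ) : WithTop ℝ) < s)]

namespace HsC

@[simp] lemma neg_apply (f : HsC n M s) (x : M) : (-f) x = -f x := rfl

lemma real_smul_eq (t : ℝ) (f : HsC n M s) : t • f = (t : ℂ) • f := rfl

@[simp] lemma real_smul_apply (t : ℝ) (f : HsC n M s) (x : M) : (t • f) x = t * f x := rfl

/-- The real bilinear multiplication map. -/
def mulLinReal : HsC n M s →ₗ[ℝ] HsC n M s →ₗ[ℝ] HsC n M s :=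
  LinearMap.mk₂ ℝ (fun f g => f * g)
    (fun _ _ _ => HsC.ext fun _ => add_mul _ _ _)
    (fun _ _ _ => HsC.ext fun _ => mul_assoc _ _ _)
    (fun _ _ _ => HsC.ext fun _ => mul_add _ _ _)
    (fun _ _ _ => HsC.ext fun _ => mul_left_comm _ _ _)

lemma continuous_mulLinReal :
    Continuous fun p : HsC n M s × HsC n M s => mulLinReal p.1 p.2 := continuous_mul

/-- The exponential of a function of class `H^s`. -/
def exp (f : HsC n M s) : HsC n M s :=
  ⟨⟨fun x => Complex.exp (f x), by fun_prop⟩, by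
    refine HsC.mem_of_hasSum (a := fun m => (m.factorial : ℂ)⁻¹) (φ := Complex.exp) (q := ‖f.toMap‖ + 1)
      ?_ (lt_add_one _) (fun x => ?_) fun x => rfl
    · refine (Real.summable_pow_div_factorial (‖f.toMap‖ + 1)).congr fun m => ?_
      rw [norm_inv, Complex.norm_natCast, div_eq_inv_mul]
    · rw [Complex.exp_eq_exp_ℂ]
      simpa only [smul_eq_mul] using NormedSpace.exp_series_hasSum_exp' (𝕂 := ℂ) (f x)⟩

@[simp] lemma exp_apply (f : HsC n M s) (x : M) : exp f x = Complex.exp (f x) := rfl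

/-- The equation `exp f = exp f₀ · exp (f - f₀)` and the continuity of the product reduce the claim
to continuity at zero. -/
lemma continuous_exp : Continuous (exp : HsC n M s → HsC n M s) := by
  refine continuous_iff_continuousAt.2 fun f₀ => ?_
  have h1 : Filter.Tendsto (fun f => f - f₀) (𝓝 f₀) (𝓝 0) := by
    simpa using (continuous_sub_right f₀).tendsto f₀
  have h2 := isDiscSeries_exp.tendsto h1 (g := fun f => exp (f - f₀))
    (Filter.Eventually.of_forall fun f x => rfl)
  refine ((h2.const_mul (exp f₀)).congr fun f => HsC.ext fun x => ?_).trans_eq ?_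
  · simp [← Complex.exp_add]
  · congr 1
    exact HsC.ext fun x => by simp

lemma curveDeriv_exp_line (f v : HsC n M s) :
    CurveDeriv (fun t : ℝ => exp (f + t • v)) (exp f * v) := by
  have h := isDiscSeries_exp.tendsto_slope v (g := fun t => exp (t • v))
    (Filter.Eventually.of_forall fun t x => rfl)
  have h2 := h.const_mul (exp f)
  simp only [Nat.factorial_one, Nat.cast_one, inv_one, one_smul, Nat.factorial_zero] at h2
  refine h2.congr fun t => HsC.ext fun x => ?_
  simp [Complex.exp_add]
  ring

lemma _root_.Madelung.BastianiC.hsC_mul {E : Type*} [AddCommGroup E] [Module ℝ E]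
    [TopologicalSpace E] {U : Set E} {k : ℕ} {f g : E → HsC n M s} (hf : BastianiC k U f)
    (hg : BastianiC k U g) : BastianiC k U (fun x => f x * g x) :=
  BastianiC.comp (V := Set.univ) isOpen_univ
    (BastianiC.bilin mulLinReal continuous_mulLinReal) (hf.prodMk hg) (Set.mapsTo_univ _ _)

lemma _root_.Madelung.SmoothOn.hsC_mul {E : Type*} [AddCommGroup E] [Module ℝ E]
    [TopologicalSpace E] {U : Set E} {f g : E → HsC n M s} (hf : SmoothOn U f)
    (hg : SmoothOn U g) : SmoothOn U (fun x => f x * g x) := fun k => (hf k).hsC_mul (hg k)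

/-- The derivative `exp f · v` is a product of `exp` with a linear map, so it has the regularity
already known for `exp`. -/
lemma smoothOn_exp : SmoothOn Set.univ (exp : HsC n M s → HsC n M s) := by
  intro k
  induction k with
  | zero => exact continuous_exp.continuousOn
  | succ k ih =>
    refine ⟨continuous_exp.continuousOn, fun p => exp p.1 * p.2, fun f _ v => ?_, ?_⟩
    · simpa [CurveDeriv] using curveDeriv_exp_line f v
    · exact ((ih.comp_clm (ContinuousLinearMap.fst ℝ (HsC n M s) (HsC n M s))).mono fun _ _ => Set.mem_univ _).hsC_mul
        (BastianiC.clm (ContinuousLinearMap.snd ℝ (HsC n M s) (HsC n M s)))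

variable (n M s) in
/-- The functions with values in the right half-plane. -/
def rightHalfPlane : Set (HsC n M s) := {f | ∀ x, 0 < (f x).re}

/-- The condition is open for the compact-open topology since `M` is compact, and it is pulled back
along the Sobolev embedding. -/
lemma isOpen_rightHalfPlane : IsOpen (rightHalfPlane n M s) := by
  have h : IsOpen {f : C(M, ℂ) | Set.MapsTo f Set.univ {z : ℂ | 0 < z.re}} :=
    ContinuousMap.isOpen_setOfPred_mapsTo isCompact_univ (isOpen_lt continuous_const Complex.continuous_re)
  convert h.preimage (HsC.toMapL n M s).continuous using 1
  ext f
  simp [rightHalfPlane, Set.MapsTo, HsC.toMapL_apply]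

/-- The range of `f` is compact in the right half-plane, hence contained in a disc `|z - c| < c`.
After division by `c` the logarithm series around one converges. Only the sup norm of `f / c - 1` is
small here, so this uses the sharp bound on powers. -/
lemma exists_log {f : HsC n M s} (hf : f ∈ rightHalfPlane n M s) :
    ∃ g : HsC n M s, ∀ x, g x = Complex.log (f x) := by
  have hre : Continuous fun x => (f x).re := Complex.continuous_re.comp f.toMap.continuous
  have hb : Continuous fun x => ‖f x‖ ^ 2 / (f x).re :=
    (f.toMap.continuous.norm.pow 2).div hre fun x => (hf x).ne'
  obtain ⟨B, hB⟩ := (isCompact_range hb).bddAbove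
  -- The inequality `|z - c| < c` means `|z|² < 2 c Re z`, and `B` bounds `|f|² / Re f`.
  set c : ℝ := |B| + 1 with hc
  have hc0 : 0 < c := by positivity
  have hlt : ∀ x, ‖((c⁻¹ : ℝ) • f - 1) x‖ < 1 := by
    intro x
    have h1 : ‖f x‖ ^ 2 < 2 * c * (f x).re := by
      have h2 := hB ⟨x, rfl⟩
      simp only at h2
      rw [div_le_iff₀ (hf x)] at h2
      have := hf x
      have := le_abs_self B
      have := abs_nonneg B
      nlinarith
    have h2 : ‖f x - c‖ ^ 2 < c ^ 2 := by
      rw [← Complex.normSq_eq_norm_sq, Complex.normSq_apply] at h1 ⊢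
      simp only [Complex.sub_re, Complex.ofReal_re, Complex.sub_im, Complex.ofReal_im, sub_zero]
      nlinarith
    have h3 : ‖f x - c‖ < c := lt_of_pow_lt_pow_left₀ 2 hc0.le h2
    have h4 : ((c⁻¹ : ℝ) • f - 1) x = (c : ℂ)⁻¹ * (f x - c) := by
      have : (c : ℂ) ≠ 0 := by exact_mod_cast hc0.ne'
      simp
      field_simp
    rw [h4, norm_mul, norm_inv, Complex.norm_real, Real.norm_of_nonneg hc0.le,
      inv_mul_lt_iff₀ hc0, mul_one]
    exact h3
  have hlt' : ‖((c⁻¹ : ℝ) • f - 1 : HsC n M s).toMap‖ < 1 :=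
    (ContinuousMap.norm_lt_iff _ one_pos).2 hlt
  obtain ⟨g, hg⟩ := isDiscSeries_log.exists_eq hlt'
  refine ⟨g + ((Real.log c : ℝ) : ℂ) • 1, fun x => ?_⟩
  have hfx : f x ≠ 0 := fun h => by have := hf x; simp [h] at this
  simp only [HsC.add_apply, hg, HsC.smul_apply, HsC.one_apply, mul_one]
  have e : 1 + ((c⁻¹ : ℝ) • f - 1) x = (c⁻¹ : ℝ) * f x := by simp
  rw [e, Complex.log_ofReal_mul (by positivity) hfx, Real.log_inv]
  push_cast
  ring

open Classical in
/-- The logarithm of a function of class `H^s` with values in the right half-plane. -/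
def log (f : HsC n M s) : HsC n M s :=
  if h : f ∈ rightHalfPlane n M s then (exists_log h).choose else 0

lemma log_apply {f : HsC n M s} (hf : f ∈ rightHalfPlane n M s) (x : M) :
    log f x = Complex.log (f x) := by
  rw [log, dif_pos hf]
  exact (exists_log hf).choose_spec x

/-- Here `exp (-log f)` is the reciprocal of `f`, so `g = f (1 + z)` with both factors in the right
half-plane. Their arguments lie in `(-π/2, π/2)`, so the principal logarithm is additive. This
reduces the study of `log` near `f` to the series at one. -/
lemma log_add_apply {f g : HsC n M s} (hf : f ∈ rightHalfPlane n M s)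
    (hg : g ∈ rightHalfPlane n M s) (h : ‖(exp (-log f) * (g - f)).toMap‖ < 1) (x : M) :
    (log g - log f) x = Complex.log (1 + (exp (-log f) * (g - f)) x) := by
  have hfx : f x ≠ 0 := fun h => by have := hf x; simp [h] at this
  have hgx : g x ≠ 0 := fun h => by have := hg x; simp [h] at this
  have e : (exp (-log f) * (g - f)) x = (f x)⁻¹ * (g x - f x) := by
    simp [log_apply hf, Complex.exp_neg, Complex.exp_log hfx]
  have hx : ‖(exp (-log f) * (g - f)) x‖ < 1 := (ContinuousMap.norm_coe_le_norm _ x).trans_lt h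
  set z := (exp (-log f) * (g - f)) x with hz
  have hgf : g x = f x * (1 + z) := by rw [e]; field_simp; ring
  have hz1 : 0 < (1 + z).re := by
    have := (Complex.abs_re_le_norm z).trans_lt hx
    rw [abs_lt] at this
    simp only [Complex.add_re, Complex.one_re]
    linarith [this.1]
  have h1z : 1 + z ≠ 0 := fun h => by rw [h] at hz1; simp at hz1
  rw [HsC.sub_apply, log_apply hf, log_apply hg, hgf, Complex.log_mul_eq_add_log_iff hfx h1z |>.2]
  · ring
  · have a1 := Complex.abs_arg_lt_pi_div_two_iff.2 (Or.inl (hf x))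
    have a2 := Complex.abs_arg_lt_pi_div_two_iff.2 (Or.inl hz1)
    rw [abs_lt] at a1 a2
    exact ⟨by linarith [a1.1, a2.1], by linarith [a1.2, a2.2]⟩

lemma continuousOn_log : ContinuousOn log (rightHalfPlane n M s) := by
  intro f₀ hf₀
  refine ContinuousAt.continuousWithinAt ?_
  have h1 : Filter.Tendsto (fun f => exp (-log f₀) * (f - f₀)) (𝓝 f₀) (𝓝 0) := by
    have h : Continuous fun f => exp (-log f₀) * (f - f₀) := by fun_prop
    refine (h.tendsto f₀).trans_eq ?_
    congr 1
    exact HsC.ext fun x => by simp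
  have h2 := isDiscSeries_log.tendsto h1 (g := fun f => log f - log f₀) (by
    filter_upwards [isOpen_rightHalfPlane.mem_nhds hf₀, IsDiscSeries.eventually_small h1]
      with f hf hsmall x
    exact log_add_apply hf₀ hf hsmall x)
  simp only [zero_add, pow_one, Nat.cast_zero, div_zero, zero_smul] at h2
  exact tendsto_sub_nhds_zero_iff.1 h2

lemma curveDeriv_log_line {f : HsC n M s} (hf : f ∈ rightHalfPlane n M s) (v : HsC n M s) :
    CurveDeriv (fun t : ℝ => log (f + t • v)) (exp (-log f) * v) := by
  have h1 : Filter.Tendsto (fun t : ℝ => exp (-log f) * (f + t • v - f)) (𝓝 0) (𝓝 0) := by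
    have h : Continuous fun t : ℝ => exp (-log f) * (f + t • v - f) := by fun_prop
    refine (h.tendsto 0).trans_eq ?_
    congr 1
    exact HsC.ext fun x => by simp
  have h := isDiscSeries_log.tendsto_slope (exp (-log f) * v)
    (g := fun t => log (f + t • v) - log f) (by
      filter_upwards [eventually_line_mem isOpen_rightHalfPlane hf v,
        (IsDiscSeries.eventually_small h1).filter_mono nhdsWithin_le_nhds] with t ht hsmall x
      rw [log_add_apply hf ht hsmall x]
      simp
      ring_nf)
  simp only [zero_add, pow_one, Nat.cast_zero, div_zero, zero_smul, sub_zero] at h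
  simpa [CurveDeriv] using h

/-- The derivative `exp (-log f) · v` involves only `exp`, products and `log` itself, so regularity
improves by induction. -/
lemma smoothOn_log : SmoothOn (rightHalfPlane n M s) log := by
  intro k
  induction k with
  | zero => exact continuousOn_log
  | succ k ih =>
    refine ⟨continuousOn_log, fun p => exp (-log p.1) * p.2, fun f hf v => ?_, ?_⟩
    · simpa [CurveDeriv] using curveDeriv_log_line hf v
    · refine BastianiC.hsC_mul ?_ (BastianiC.clm (ContinuousLinearMap.snd ℝ (HsC n M s) (HsC n M s)))
      refine BastianiC.comp (V := Set.univ) isOpen_univ (smoothOn_exp k) ?_ (Set.mapsTo_univ _ _)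
      refine BastianiC.comp (V := Set.univ) isOpen_univ
        (BastianiC.clm (-ContinuousLinearMap.id ℝ (HsC n M s))) ?_ (Set.mapsTo_univ _ _)
      exact (ih.comp_clm (ContinuousLinearMap.fst ℝ (HsC n M s) (HsC n M s))).mono fun p hp => hp.1

end HsC

end ExpLog

/-! ### Conjugation, real and imaginary parts, and real-valued functions. -/

section RealSobolev

open MeasureTheory
open scoped ENNReal NNReal

set_option linter.unusedSectionVars false

lemma fourier_conj {V : Type*} [NormedAddCommGroup V] [InnerProductSpace ℝ V]
    [FiniteDimensional ℝ V] [MeasurableSpace V] [BorelSpace V] (k : V → ℂ) (ξ : V) :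
    𝓕 (fun x => conj (k x)) ξ = conj (𝓕 k (-ξ)) := by
  rw [Real.fourier_eq, Real.fourier_eq, ← integral_conj]
  refine integral_congr_ae (Filter.Eventually.of_forall fun x => ?_)
  simp [Circle.smul_def]

/-- Conjugation reflects the Fourier transform up to conjugation, and the weight is even. -/
lemma sobNorm_conj {V : Type*} [NormedAddCommGroup V] [InnerProductSpace ℝ V]
    [FiniteDimensional ℝ V] [MeasurableSpace V] [BorelSpace V] (t : ℝ) (k : V → ℂ) :
    sobNorm t (fun x => conj (k x)) = sobNorm t k := by
  rw [sobNorm, sobNorm, l2Norm, l2Norm]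
  congr 1
  rw [← lintegral_neg_eq_self]
  refine lintegral_congr fun ξ => ?_
  simp only [fourier_conj, neg_neg, japanese, norm_neg, ← ofReal_norm, RCLike.norm_conj]

variable {n : ℕ} {M : Type u} [TopologicalSpace M] [ChartedSpace (EuclideanSpace ℝ (Fin n)) M]
  [CompactSpace M] {s : WithTop ℝ}

lemma Localization.loc_conj (L : Localization n M s) (f : M → ℂ) :
    L.loc (fun x => conj (f x)) = fun y => conj (L.loc f y) := by
  ext y
  by_cases hy : y ∈ L.chart.target <;> simp [loc, hy]

lemma Localization.sobNorm_loc_conj (L : Localization n M s) (f : M → ℂ) :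
    sobNorm L.t (L.loc fun x => conj (f x)) = sobNorm L.t (L.loc f) := by
  rw [L.loc_conj, sobNorm_conj]

/-- Complex conjugation on `H^s(M, ℂ)`, as a function. -/
def HsC.conjFun (f : HsC n M s) : HsC n M s :=
  ⟨⟨fun x => conj (f x), Complex.continuous_conj.comp f.toMap.continuous⟩, fun L => (L.memLp_weighted_iff _).2
    ((L.sobNorm_loc_conj f).trans_lt (f.sobNorm_lt_top L))⟩

lemma HsC.localNorm_conjFun (L : Localization n M s) (f : HsC n M s) :
    f.conjFun.localNorm L = f.localNorm L := by
  have h := L.sobNorm_loc_conj f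
  have h1 := HsC.ofReal_localNorm L f
  have h2 : ENNReal.ofReal (f.conjFun.localNorm L) = sobNorm L.t (L.loc fun x => conj (f x)) :=
    HsC.ofReal_localNorm L f.conjFun
  rw [h, ← h1] at h2
  exact (ENNReal.ofReal_eq_ofReal_iff (HsC.localNorm_nonneg _ _) (HsC.localNorm_nonneg _ _)).1 h2

section Manifold

/-- Complex conjugation on `H^s(M, ℂ)`. -/
def HsC.conjL : HsC n M s →L[ℝ] HsC n M s where
  toFun := HsC.conjFun
  map_add' f g := HsC.ext fun x => map_add (starRingEnd ℂ) (f x) (g x)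
  map_smul' c f := HsC.ext fun x => by
    change conj ((c : ℂ) * f x) = (c : ℂ) * conj (f x)
    simp
  cont := by
    refine continuous_of_continuousAt_zero
      (AddMonoidHom.mk' (HsC.conjFun (n := n) (M := M) (s := s)) fun f g =>
        HsC.ext fun x => map_add (starRingEnd ℂ) (f x) (g x)) ?_
    rw [ContinuousAt, map_zero, HsC.tendsto_zero_iff]
    intro L
    refine (HsC.tendsto_zero_iff.1 (Filter.tendsto_id (α := HsC n M s) (x := 𝓝 0)) L).congr
      fun f => (HsC.localNorm_conjFun L f).symm

@[simp] lemma HsC.conjL_apply (f : HsC n M s) (x : M) : HsC.conjL f x = conj (f x) := rfl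

/-- The inclusion `H^s(M) → H^s(M, ℂ)` as a real linear map. -/
def HsR.toHsCLin : HsR n M s →ₗ[ℝ] HsC n M s where
  toFun f := f.toHsC
  map_add' _ _ := HsC.ext fun _ => Complex.ofReal_add _ _
  map_smul' _ _ := HsC.ext fun _ => Complex.ofReal_mul _ _

lemma HsR.isInducing_toHsCLin : Topology.IsInducing (HsR.toHsCLin (n := n) (M := M) (s := s)) :=
  ⟨rfl⟩

instance : IsTopologicalAddGroup (HsR n M s) :=
  topologicalAddGroup_induced (HsR.toHsCLin (n := n) (M := M) (s := s))

instance : ContinuousSMul ℝ (HsR n M s) :=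
  continuousSMul_induced (HsR.toHsCLin (n := n) (M := M) (s := s))

instance : LocallyConvexSpace ℝ (HsR n M s) :=
  HsR.isInducing_toHsCLin.locallyConvexSpace

/-- The continuous inclusion `H^s(M) → H^s(M, ℂ)`. -/
def HsR.toHsCL : HsR n M s →L[ℝ] HsC n M s :=
  ⟨HsR.toHsCLin, HsR.isInducing_toHsCLin.continuous⟩

@[simp] lemma HsR.toHsCL_apply (f : HsR n M s) (x : M) : HsR.toHsCL f x = (f x : ℂ) := rfl

/-- The real part. -/
def HsC.reL : HsC n M s →L[ℝ] HsR n M s where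
  toFun f := ⟨⟨fun x => (f x).re, Complex.continuous_re.comp f.toMap.continuous⟩, by
    have h : ofRealLin M ⟨fun x => (f x).re, Complex.continuous_re.comp f.toMap.continuous⟩ =
        ((1 / 2 : ℂ) • (f + HsC.conjL f) : HsC n M s).toMap := by
      ext x
      change (((f x).re : ℝ) : ℂ) = (1 / 2 : ℂ) * (f x + conj (f x))
      rw [Complex.add_conj]
      push_cast
      ring
    change ofRealLin M _ ∈ sobolevSubmodule n M s
    rw [h]
    exact ((1 / 2 : ℂ) • (f + HsC.conjL f) : HsC n M s).2⟩
  map_add' _ _ := HsR.ext fun _ => Complex.add_re _ _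
  map_smul' c f := HsR.ext fun x => by
    change ((c : ℂ) * f x).re = c * (f x).re
    simp
  cont := by
    refine HsR.isInducing_toHsCLin.continuous_iff.2 ?_
    have h : Continuous fun f : HsC n M s => (1 / 2 : ℂ) • (f + HsC.conjL f) := by fun_prop
    refine h.congr fun f => HsC.ext fun x => ?_
    change (1 / 2 : ℂ) * (f x + conj (f x)) = (((f x).re : ℝ) : ℂ)
    rw [Complex.add_conj]
    push_cast
    ring

@[simp] lemma HsC.reL_apply (f : HsC n M s) (x : M) : HsC.reL f x = (f x).re := rfl

/-- Multiplication by a complex constant. -/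
def HsC.smulL (c : ℂ) : HsC n M s →L[ℝ] HsC n M s where
  toFun f := c • f
  map_add' _ _ := smul_add _ _ _
  map_smul' t f := HsC.ext fun x => by
    change c * ((t : ℂ) * f x) = (t : ℂ) * (c * f x)
    ring
  cont := continuous_const_smul c

@[simp] lemma HsC.smulL_apply (c : ℂ) (f : HsC n M s) : HsC.smulL c f = c • f := rfl

/-- The imaginary part. -/
def HsC.imL : HsC n M s →L[ℝ] HsR n M s := HsC.reL.comp (HsC.smulL (-Complex.I))

@[simp] lemma HsC.imL_apply (f : HsC n M s) (x : M) : HsC.imL f x = (f x).im := by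
  change (-Complex.I * f x).re = _
  simp

variable [IsManifold (𝓡 n) ∞ M] [T2Space M]
  [hs : Fact ((((n : ℝ) / 2 : ℝ) : WithTop ℝ) < s)]

namespace HsR

instance : T2Space (HsR n M s) :=
  T2Space.of_injective_continuous (f := HsR.toHsCL (n := n) (M := M) (s := s))
    (fun f g h => HsR.ext fun x => Complex.ofReal_injective (by
      rw [← HsR.toHsCL_apply, h, HsR.toHsCL_apply])) HsR.toHsCL.continuous

/-- The product is formed in `H^s(M, ℂ)` and brought back by the continuous real part, so that its
continuity and regularity are inherited. -/
instance : Mul (HsR n M s) := ⟨fun f g => HsC.reL (f.toHsCL * g.toHsCL)⟩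

lemma mul_def (f g : HsR n M s) : f * g = HsC.reL (f.toHsCL * g.toHsCL) := rfl

@[simp] lemma mul_apply (f g : HsR n M s) (x : M) : (f * g) x = f x * g x := by
  simp [mul_def]

@[simp] lemma neg_apply (f : HsR n M s) (x : M) : (-f) x = -f x := rfl

instance : ContinuousMul (HsR n M s) :=
  ⟨by
    have h : Continuous fun p : HsR n M s × HsR n M s =>
        HsC.reL (p.1.toHsCL * p.2.toHsCL) := by fun_prop
    exact h⟩

/-- The bilinear multiplication map. -/
def mulLin : HsR n M s →ₗ[ℝ] HsR n M s →ₗ[ℝ] HsR n M s :=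
  LinearMap.mk₂ ℝ (fun f g => f * g)
    (fun _ _ _ => HsR.ext fun _ => by simp [add_mul])
    (fun _ _ _ => HsR.ext fun _ => by simp [mul_assoc])
    (fun _ _ _ => HsR.ext fun _ => by simp [mul_add])
    (fun _ _ _ => HsR.ext fun _ => by simp [mul_left_comm])

lemma _root_.Madelung.SmoothOn.hsR_mul {E : Type*} [AddCommGroup E] [Module ℝ E]
    [TopologicalSpace E] {U : Set E} {f g : E → HsR n M s} (hf : SmoothOn U f)
    (hg : SmoothOn U g) : SmoothOn U (fun x => f x * g x) :=
  SmoothOn.bilin mulLin continuous_mul hf hg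

variable (n M s) in
/-- The positive functions. -/
def positive : Set (HsR n M s) := {f | ∀ x, 0 < f x}

lemma toHsCL_mem_rightHalfPlane {f : HsR n M s} (hf : f ∈ positive n M s) :
    f.toHsCL ∈ HsC.rightHalfPlane n M s := fun x => by simpa using hf x

lemma isOpen_positive : IsOpen (positive n M s) := by
  convert HsC.isOpen_rightHalfPlane.preimage (HsR.toHsCL (n := n) (M := M) (s := s)).continuous
    using 1
  ext f
  simp [positive, HsC.rightHalfPlane]

/-- The logarithm of a positive function, as a complex valued function. -/
def logC (f : HsR n M s) : HsC n M s := HsC.log f.toHsCL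

lemma logC_apply {f : HsR n M s} (hf : f ∈ positive n M s) (x : M) :
    logC f x = (Real.log (f x) : ℂ) := by
  rw [logC, HsC.log_apply (toHsCL_mem_rightHalfPlane hf), toHsCL_apply,
    Complex.ofReal_log (hf x).le]

lemma smoothOn_logC : SmoothOn (positive n M s) logC :=
  SmoothOn.comp (f := toHsCL) HsC.isOpen_rightHalfPlane HsC.smoothOn_log (SmoothOn.clm HsR.toHsCL)
    fun _ hf => toHsCL_mem_rightHalfPlane hf

/-- The reciprocal of a positive function. -/
def inv (f : HsR n M s) : HsR n M s := HsC.reL (HsC.exp (-logC f))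

lemma inv_apply {f : HsR n M s} (hf : f ∈ positive n M s) (x : M) : inv f x = (f x)⁻¹ := by
  rw [inv, HsC.reL_apply, HsC.exp_apply, HsC.neg_apply, logC_apply hf, ← Complex.ofReal_neg,
    Complex.exp_ofReal_re, Real.exp_neg, Real.exp_log (hf x)]

lemma smoothOn_inv : SmoothOn (positive n M s) inv :=
  (SmoothOn.comp (V := Set.univ) isOpen_univ HsC.smoothOn_exp smoothOn_logC.neg
    (Set.mapsTo_univ _ _)).clm_comp HsC.reL

end HsR

namespace CurveDeriv

variable {γ : ℝ → HsC n M s} {d : HsC n M s}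

lemma exp (h : CurveDeriv γ d) : CurveDeriv (fun t => HsC.exp (γ t)) (HsC.exp (γ 0) * d) :=
  h.comp (V := Set.univ) isOpen_univ (g := HsC.exp) (dg := fun p => HsC.exp p.1 * p.2)
    (fun _ _ _ => HsC.curveDeriv_exp_line _ _)
    (((HsC.continuous_exp.comp continuous_fst).mul continuous_snd).continuousOn) (Set.mem_univ _)

lemma log (h : CurveDeriv γ d) (h0 : γ 0 ∈ HsC.rightHalfPlane n M s) :
    CurveDeriv (fun t => HsC.log (γ t)) (HsC.exp (-HsC.log (γ 0)) * d) :=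
  h.comp (V := HsC.rightHalfPlane n M s) HsC.isOpen_rightHalfPlane (g := HsC.log)
    (dg := fun p => HsC.exp (-HsC.log p.1) * p.2) (fun _ hf v => HsC.curveDeriv_log_line hf v)
    (ContinuousOn.mul (HsC.continuous_exp.comp_continuousOn
      ((HsC.continuousOn_log.comp continuousOn_fst fun _ hp => hp.1).neg)) continuousOn_snd) h0

end CurveDeriv

section Integral

variable [MeasurableSpace M] [BorelSpace M] (μ : Measure M) [IsProbabilityMeasure μ]

/-- Integration, as a continuous linear form on `H^s(M, ℂ)`. -/
def HsC.intL : HsC n M s →L[ℂ] ℂ :=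
  (LinearMap.mkContinuous
    { toFun := fun f : C(M, ℂ) => ∫ x, f x ∂μ
      map_add' := fun f g => integral_add (integrable_continuousMap_complex f)
        (integrable_continuousMap_complex g)
      map_smul' := fun c f => integral_const_mul c f } 1
    fun f => by
      rw [one_mul]
      refine (norm_integral_le_of_norm_le_const (C := ‖f‖)
        (Filter.Eventually.of_forall f.norm_coe_le_norm)).trans ?_
      simp).comp (HsC.toMapL n M s)

lemma HsC.intL_apply (f : HsC n M s) : HsC.intL μ f = ∫ x, f x ∂μ := rfl

/-- Integration, as a continuous linear form on `H^s(M)`. -/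
def HsR.intL : HsR n M s →L[ℝ] ℝ :=
  Complex.reCLM.comp (((HsC.intL μ).restrictScalars ℝ).comp HsR.toHsCL)

lemma HsR.intL_apply (f : HsR n M s) : HsR.intL μ f = ∫ x, f x ∂μ := by
  change (∫ x, ((f x : ℝ) : ℂ) ∂μ).re = _
  rw [integral_complex_ofReal, Complex.ofReal_re]

end Integral

end Manifold

end RealSobolev

/-! ### Representatives of classes modulo constants. -/

section Cotangent

open MeasureTheory

set_option linter.unusedSectionVars false

variable {n : ℕ} {M : Type u} [TopologicalSpace M] [ChartedSpace (EuclideanSpace ℝ (Fin n)) M]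
  [CompactSpace M] {s : WithTop ℝ} [IsManifold (𝓡 n) ∞ M] [T2Space M]
  [hs : Fact ((((n : ℝ) / 2 : ℝ) : WithTop ℝ) < s)]
  [MeasurableSpace M] [BorelSpace M] {μ : Measure M} [IsProbabilityMeasure μ]

lemma integralMul_apply (ρ θ : HsR n M s) : integralMul (μ := μ) ρ θ = HsR.intL μ (θ * ρ) := by
  simp [integralMul, HsR.intL_apply]

lemma HsR.intL_const1 : HsR.intL μ (HsR.const1 n M s) = 1 := by
  simp [HsR.intL_apply]

lemma HsZero.intL_eq_zero (σ : HsZero n M s μ) : HsR.intL μ σ.1 = 0 :=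
  (HsR.intL_apply μ σ.1).trans σ.2

lemma HsR.intL_mul_sub_smul (σ f : HsR n M s) (c : ℝ) : HsR.intL μ (σ * (f - c • HsR.const1 n M s)) =
    HsR.intL μ (σ * f) - c * HsR.intL μ σ := by
  have h : σ * (f - c • HsR.const1 n M s) = σ * f - c • σ := HsR.ext fun x => by simp; ring
  rw [h, map_sub, map_smul, smul_eq_mul]

lemma normalized_mk (σ : HsZero n M s μ) (θ : HsR n M s) :
    normalized σ (Submodule.Quotient.mk θ) =
      θ - HsR.intL μ (θ * density σ) • HsR.const1 n M s := by
  rw [← integralMul_apply]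
  rfl

lemma mk_const1_smul (c : ℝ) :
    (Submodule.Quotient.mk (c • HsR.const1 n M s) : HsR n M s ⧸ constants n M s) = 0 :=
  (Submodule.Quotient.mk_eq_zero _).2 (Submodule.smul_mem _ _ (Submodule.mem_span_singleton_self _))

lemma mk_normalized (σ : HsZero n M s μ) (q : HsR n M s ⧸ constants n M s) :
    Submodule.Quotient.mk (normalized σ q) = q := by
  obtain ⟨θ, rfl⟩ := Submodule.Quotient.mk_surjective _ q
  rw [normalized_mk, Submodule.Quotient.mk_sub, mk_const1_smul, sub_zero]

lemma intL_density (σ : HsZero n M s μ) : HsR.intL μ (density σ) = 1 :=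
  (HsR.intL_apply μ _).trans (integral_density σ)

lemma intL_normalized_mul (σ : HsZero n M s μ) (q : HsR n M s ⧸ constants n M s) :
    HsR.intL μ (normalized σ q * density σ) = 0 := by
  obtain ⟨θ, rfl⟩ := Submodule.Quotient.mk_surjective _ q
  have h : ∀ f g : HsR n M s, f * g = g * f := fun f g => HsR.ext fun x => by simp [mul_comm]
  rw [normalized_mk, h, HsR.intL_mul_sub_smul, intL_density, mul_one, h, sub_self]

lemma normalized_mk_of_intL_eq_zero (σ : HsZero n M s μ) {τ : HsR n M s}
    (h : HsR.intL μ (τ * density σ) = 0) : normalized σ (Submodule.Quotient.mk τ) = τ := by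
  rw [normalized_mk, h, zero_smul, sub_zero]

/-- The representative of integral zero, as a continuous linear map. -/
def normalizedL (μ : Measure M) [IsProbabilityMeasure μ] :
    (HsR n M s ⧸ constants n M s) →L[ℝ] HsR n M s where
  toLinearMap := normalized (0 : HsZero n M s μ)
  cont := by
    have h : Continuous fun θ : HsR n M s =>
        θ - HsR.intL μ (θ * density (0 : HsZero n M s μ)) • HsR.const1 n M s :=
      continuous_id.sub (((HsR.intL μ).continuous.comp
        (continuous_id.mul continuous_const)).smul continuous_const)
    refine continuous_coinduced_dom.2 (h.congr fun θ => ?_)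
    exact (normalized_mk _ θ).symm

lemma normalizedL_apply (q : HsR n M s ⧸ constants n M s) :
    normalizedL μ q = normalized (0 : HsZero n M s μ) q := rfl

lemma mk_normalizedL (q : HsR n M s ⧸ constants n M s) :
    Submodule.Quotient.mk (normalizedL μ q) = q := mk_normalized _ q

/-- As `∫ θ (1 + σ) = ∫ θ + ∫ σ θ`, the normalization at `σ` differs from the one at the uniform
density by a constant that is bilinear in `σ` and the class. This makes its smooth dependence on the
base point visible. -/
lemma normalized_eq (σ : HsZero n M s μ) (q : HsR n M s ⧸ constants n M s) :
    normalized σ q =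
      normalizedL μ q - HsR.intL μ (σ.1 * normalizedL μ q) • HsR.const1 n M s := by
  obtain ⟨θ, rfl⟩ := Submodule.Quotient.mk_surjective _ q
  rw [normalizedL_apply, normalized_mk, normalized_mk, HsR.intL_mul_sub_smul, HsZero.intL_eq_zero σ,
    mul_zero, sub_zero]
  have h1 : θ * density σ = θ + σ.1 * θ := HsR.ext fun x => by simp; ring
  have h2 : θ * density (0 : HsZero n M s μ) = θ := HsR.ext fun x => by simp
  rw [h1, h2, map_add, add_smul, sub_sub]

/-- The quotient map as a continuous linear map. -/
def mkL : HsR n M s →L[ℝ] HsR n M s ⧸ constants n M s :=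
  ⟨(constants n M s).mkQ, continuous_quot_mk⟩

lemma mkL_apply (θ : HsR n M s) : mkL θ = (Submodule.Quotient.mk θ) := rfl

/-- A continuous section of the quotient map embeds the quotient into `H^s(M)`, from which it
inherits the Hausdorff property and local convexity. -/
lemma isEmbedding_normalizedL :
    Topology.IsEmbedding (normalizedL (n := n) (M := M) (s := s) μ) :=
  Topology.IsEmbedding.of_leftInverse (f := mkL) (fun q => mk_normalized _ q)
    mkL.continuous (normalizedL μ).continuous

lemma locallyConvexSpace_and_t2Space_quotient (μ : Measure M) [IsProbabilityMeasure μ] : LocallyConvexSpace ℝ (HsR n M s ⧸ constants n M s) ∧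
    T2Space (HsR n M s ⧸ constants n M s) :=
  ⟨isEmbedding_normalizedL.toIsInducing.locallyConvexSpace (f := (normalizedL μ).toLinearMap),
    (isEmbedding_normalizedL (μ := μ)).t2Space⟩

end Cotangent

section QuotientInstances

variable {n : ℕ} {M : Type u} [TopologicalSpace M] [ChartedSpace (EuclideanSpace ℝ (Fin n)) M]
  [CompactSpace M] {s : WithTop ℝ} [IsManifold (𝓡 n) ∞ M] [T2Space M]
  [hs : Fact ((((n : ℝ) / 2 : ℝ) : WithTop ℝ) < s)] [Nonempty M]

instance : LocallyConvexSpace ℝ (HsR n M s ⧸ constants n M s) := by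
  -- The quotient involves no measure. A Dirac measure supplies some continuous section, namely the
  -- representative vanishing at a point.
  let : MeasurableSpace M := borel M
  have : BorelSpace M := ⟨rfl⟩
  exact (locallyConvexSpace_and_t2Space_quotient (MeasureTheory.Measure.dirac (Classical.arbitrary M))).1

instance : T2Space (HsR n M s ⧸ constants n M s) := by
  let : MeasurableSpace M := borel M
  have : BorelSpace M := ⟨rfl⟩
  exact (locallyConvexSpace_and_t2Space_quotient (MeasureTheory.Measure.dirac (Classical.arbitrary M))).2

end QuotientInstances

/-! ### Comparison with Fréchet differentiability, and a criterion for Kähler structures. -/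

section Generic

open Set

/-- The map `(x, v) ↦ Df(x) v` is jointly one order less differentiable than `f`, which feeds the
induction. -/
lemma BastianiC.of_contDiffOn {F : Type*} [NormedAddCommGroup F] [NormedSpace ℝ F] {k : ℕ} :
    ∀ {E : Type u} [NormedAddCommGroup E] [NormedSpace ℝ E] {U : Set E} {f : E → F}, IsOpen U →
      ContDiffOn ℝ k f U → BastianiC k U f := by
  induction k with
  | zero => exact fun _ h => h.continuousOn
  | succ k ih =>
    intro E _ _ U f hU h
    refine ⟨h.continuousOn, fun p => fderiv ℝ f p.1 p.2, fun x hx v => ?_, ?_⟩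
    · have hd : DifferentiableAt ℝ f x :=
        (h.differentiableOn (by simp)).differentiableAt (hU.mem_nhds hx)
      have h2 : HasDerivAt (fun t : ℝ => f (x + t • v)) (fderiv ℝ f x v) 0 := by
        have h3 : HasDerivAt (fun t : ℝ => x + t • v) v 0 := by
          simpa using ((hasDerivAt_id (0 : ℝ)).smul_const v).const_add x
        have h4 : HasFDerivAt f (fderiv ℝ f x) (x + (0 : ℝ) • v) := by
          simpa using hd.hasFDerivAt
        exact h4.comp_hasDerivAt 0 h3
      simpa [hasDerivAt_iff_tendsto_slope_zero] using h2
    · refine ih (hU.prod isOpen_univ) ?_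
      have h1 : ContDiffOn ℝ k (fderiv ℝ f) U := h.fderiv_of_isOpen hU (by simp)
      exact (h1.comp contDiffOn_fst fun p hp => hp.1).clm_apply contDiffOn_snd

lemma SmoothOn.of_contDiffOn {E : Type u} [NormedAddCommGroup E] [NormedSpace ℝ E] {F : Type*}
    [NormedAddCommGroup F] [NormedSpace ℝ F] {U : Set E} {f : E → F} (hU : IsOpen U)
    (h : ContDiffOn ℝ ∞ f U) : SmoothOn U f := fun k =>
  BastianiC.of_contDiffOn hU (h.of_le (by exact_mod_cast le_top))

/-- Real inversion is smooth. -/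
lemma smoothOn_real_inv : SmoothOn {x : ℝ | x ≠ 0} fun x => x⁻¹ :=
  SmoothOn.of_contDiffOn isOpen_ne (contDiffOn_inv ℝ)

/-- Complex inversion is smooth. -/
lemma smoothOn_complex_inv : SmoothOn {x : ℂ | x ≠ 0} fun x => x⁻¹ :=
  SmoothOn.of_contDiffOn isOpen_ne fun _ hx => (contDiffAt_inv ℝ hx).contDiffWithinAt

variable {E : Type u} [AddCommGroup E] [Module ℝ E] [TopologicalSpace E]
  [IsTopologicalAddGroup E] [ContinuousSMul ℝ E] [LocallyConvexSpace ℝ E]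

/-- The properties of the two-form `Ω = g(J·, ·)` that follow from those of `g` and `J`. -/
lemma IsKahlerOn.of_metric {U : Set E} (hU : IsOpen U) {g Ω : E → E → E → ℝ} {J : E → E → E}
    (g_smooth : SmoothOn (U ×ˢ (Set.univ : Set (E × E))) (fun p : E × E × E => g p.1 p.2.1 p.2.2))
    (g_symm : ∀ x ∈ U, ∀ u v, g x u v = g x v u)
    (g_linear : ∀ x ∈ U, ∀ v, IsLinearMap ℝ (fun u => g x u v))
    (g_pos : ∀ x ∈ U, ∀ u, u ≠ 0 → 0 < g x u u)
    (Ω_closed : ∀ x ∈ U, ∀ u v w,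
      deriv (fun t : ℝ => Ω (x + t • u) v w) 0 + deriv (fun t : ℝ => Ω (x + t • v) w u) 0 +
        deriv (fun t : ℝ => Ω (x + t • w) u v) 0 = 0)
    (J_smooth : SmoothOn (U ×ˢ (Set.univ : Set E)) (fun p : E × E => J p.1 p.2))
    (J_linear : ∀ x ∈ U, IsLinearMap ℝ (J x))
    (J_sq : ∀ x ∈ U, ∀ u, J x (J x u) = -u)
    (J_integrable : IsIntegrableOn U J)
    (g_J : ∀ x ∈ U, ∀ u v, g x (J x u) (J x v) = g x u v)
    (Ω_eq : ∀ x ∈ U, ∀ u v, Ω x u v = g x (J x u) v) : IsKahlerOn U g Ω J where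
  g_smooth := g_smooth
  g_symm := g_symm
  g_linear := g_linear
  g_pos := g_pos
  Ω_smooth := by
    have h1 : SmoothOn (U ×ˢ (Set.univ : Set (E × E)))
        (fun p : E × E × E => (p.1, J p.1 p.2.1, p.2.2)) :=
      (SmoothOn.clm (ContinuousLinearMap.fst ℝ E (E × E))).prodMk <| SmoothOn.prodMk
        (J_smooth.comp_clm ((ContinuousLinearMap.fst ℝ E (E × E)).prod
          ((ContinuousLinearMap.fst ℝ E E).comp (ContinuousLinearMap.snd ℝ E (E × E))))
          fun p hp => ⟨hp.1, mem_univ _⟩)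
        (SmoothOn.clm ((ContinuousLinearMap.snd ℝ E E).comp (ContinuousLinearMap.snd ℝ E (E × E))))
    refine (SmoothOn.comp (hU.prod isOpen_univ) g_smooth h1
      fun p hp => ⟨hp.1, mem_univ _⟩).congr (hU.prod isOpen_univ) fun p hp => ?_
    exact Ω_eq p.1 hp.1 _ _
  Ω_antisymm x hx u v := by
    have h : g x (-u) (J x v) = -g x u (J x v) := (g_linear x hx _).map_neg u
    rw [Ω_eq x hx, Ω_eq x hx, ← g_J x hx, J_sq x hx, h, g_symm x hx]
  Ω_linear x hx v := by
    have h : (fun u => Ω x u v) = fun u => g x (J x u) v := funext fun u => Ω_eq x hx u v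
    rw [h]
    exact (((g_linear x hx v).mk' _).comp ((J_linear x hx).mk' _)).isLinear
  Ω_nondegenerate x hx u h := by
    by_contra hu
    have h1 := g_pos x hx u hu
    rw [← g_J x hx, ← Ω_eq x hx, h] at h1
    exact h1.false
  Ω_closed := Ω_closed
  J_smooth := J_smooth
  J_linear := J_linear
  J_sq := J_sq
  J_integrable := J_integrable
  g_J := g_J
  Ω_eq := Ω_eq

end Generic

/-! ### Positivity of the volume on open sets. -/

section OpenPos

open MeasureTheory

variable {n : ℕ} {M : Type u} [TopologicalSpace M] [ChartedSpace (EuclideanSpace ℝ (Fin n)) M]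
  [MeasurableSpace M] [IsManifold (𝓡 n) ∞ M] {μ : Measure M}

/-- In a chart, a nonempty open set has positive Lebesgue measure and the density is positive there.
This is what makes both metrics definite. -/
lemma IsVolume.isOpenPosMeasure (h : IsVolume n μ) : μ.IsOpenPosMeasure := by
  refine ⟨fun U hU ⟨x, hx⟩ h0 => ?_⟩
  obtain ⟨m, hm, hpos, hμ⟩ := h _ (IsManifold.chart_mem_maximalAtlas (I := 𝓡 n) (n := ∞) x)
  set e := chartAt (EuclideanSpace ℝ (Fin n)) x
  have hA : IsOpen (e.target ∩ e.symm ⁻¹' U) := e.isOpen_inter_preimage_symm hU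
  have h1 := hμ _ Set.inter_subset_left hA.measurableSet
  have h2 : μ (e.source ∩ e ⁻¹' (e.target ∩ e.symm ⁻¹' U)) = 0 :=
    measure_mono_null (fun y hy => by simpa [e.left_inv hy.1] using hy.2.2) h0
  rw [h2, eq_comm, setLIntegral_eq_zero_iff' hA.measurableSet] at h1
  · have h3 : volume (e.target ∩ e.symm ⁻¹' U) = 0 := by
      refine measure_mono_null (fun y hy => ?_) h1
      simp only [Set.mem_compl_iff, Set.mem_ofPred_eq]
      intro h
      have := h hy
      rw [ENNReal.ofReal_eq_zero] at this
      exact absurd (hpos y hy.1) (not_lt.2 this)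
    exact (hA.measure_pos volume ⟨e x, e.map_source (mem_chart_source _ x),
      by simpa [e.left_inv (mem_chart_source _ x)] using hx⟩).ne' h3
  · exact (ENNReal.measurable_ofReal.comp_aemeasurable
      ((hm.continuousOn.mono Set.inter_subset_left).aemeasurable hA.measurableSet))

end OpenPos

/-! ### The Kähler identities on the cotangent bundle. -/

section CotangentKahler

open MeasureTheory

set_option linter.unusedSectionVars false

variable {n : ℕ} {M : Type u} [TopologicalSpace M] [ChartedSpace (EuclideanSpace ℝ (Fin n)) M]
  [CompactSpace M] {s : WithTop ℝ} [IsManifold (𝓡 n) ∞ M] [T2Space M]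
  [hs : Fact ((((n : ℝ) / 2 : ℝ) : WithTop ℝ) < s)]
  [MeasurableSpace M] [BorelSpace M] {μ : Measure M} [IsProbabilityMeasure μ]

instance : LocallyConvexSpace ℝ (HsZero n M s μ) :=
  (Topology.IsInducing.subtypeVal).locallyConvexSpace (f := (HsZero n M s μ).subtype)

lemma HsR.intL_eq_zero_iff [μ.IsOpenPosMeasure] {f : HsR n M s} (hf : ∀ x, 0 ≤ f x) :
    HsR.intL μ f = 0 ↔ f = 0 := by
  refine ⟨fun h => ?_, fun h => by rw [h, map_zero]⟩
  by_contra h0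
  obtain ⟨x, hx⟩ : ∃ x, f x ≠ 0 := by
    by_contra! h1
    exact h0 (HsR.ext h1)
  have h1 := Continuous.integral_pos_of_hasCompactSupport_nonneg_nonzero (μ := μ) f.toMap.continuous
    (HasCompactSupport.of_compactSpace _) hf hx
  rw [← HsR.intL_apply, h] at h1
  exact h1.false

lemma HsR.intL_nonneg {f : HsR n M s} (hf : ∀ x, 0 ≤ f x) : 0 ≤ HsR.intL μ f := by
  rw [HsR.intL_apply]
  exact integral_nonneg hf

/-- The projection `f ↦ f - ∫ f` onto the functions of integral zero. -/
def HsZero.proj : HsR n M s →L[ℝ] HsZero n M s μ :=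
  ContinuousLinearMap.codRestrict
    (ContinuousLinearMap.id ℝ _ - (HsR.intL μ).smulRight (HsR.const1 n M s)) _ fun f => by
      change ∫ x, _ ∂μ = 0
      rw [← HsR.intL_apply]
      simp [HsR.intL_const1]

lemma HsZero.proj_coe (f : HsR n M s) :
    (HsZero.proj (μ := μ) f).1 = f - HsR.intL μ f • HsR.const1 n M s := rfl

lemma HsZero.proj_coe_of_intL {f : HsR n M s} (hf : HsR.intL μ f = 0) :
    (HsZero.proj (μ := μ) f).1 = f := by
  rw [HsZero.proj_coe, hf, zero_smul, sub_zero]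

lemma HsZero.proj_density (ρ : HsR n M s) (h : HsR.intL μ ρ = 1) :
    density (HsZero.proj (μ := μ) ρ) = ρ := HsR.ext fun x => by
  simp [HsZero.proj_coe, h]

lemma SmoothOn.density {E : Type w} [AddCommGroup E] [Module ℝ E] [TopologicalSpace E] {U : Set E}
    {f : E → HsZero n M s μ} (hf : SmoothOn U f) : SmoothOn U fun x => density (f x) :=
  (SmoothOn.const _).add (hf.clm_comp (HsZero n M s μ).subtypeL)

variable [Nonempty M]

lemma SmoothOn.normalized {E : Type w} [AddCommGroup E] [Module ℝ E] [TopologicalSpace E]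
    {U : Set E} {f : E → HsZero n M s μ} {q : E → HsR n M s ⧸ constants n M s}
    (hf : SmoothOn U f) (hq : SmoothOn U q) : SmoothOn U fun x => normalized (f x) (q x) := by
  simp only [normalized_eq]
  exact (hq.clm_comp (normalizedL μ)).sub
    ((((hf.clm_comp (HsZero n M s μ).subtypeL).hsR_mul (hq.clm_comp (normalizedL μ))).clm_comp
      (HsR.intL μ)).smul (SmoothOn.const _))

variable (n M s μ) in
/-- The image of the global chart of the cotangent bundle. -/
def cotTarget : Set (CotModel n M s μ) := {e | density e.1 ∈ HsR.positive n M s}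

lemma isOpen_cotTarget : IsOpen (cotTarget n M s μ) := by
  have h : Continuous fun e : CotModel n M s μ => HsR.const1 n M s + e.1.1 := by fun_prop
  exact HsR.isOpen_positive.preimage h

/-- The rotation `J(ρ̇, θ̇) = (θ̇ ρ, -ρ̇ / ρ)`. -/
def rotation (e u : CotModel n M s μ) : CotModel n M s μ :=
  (HsZero.proj (normalized e.1 u.2 * density e.1), mkL (-(u.1.1 * HsR.inv (density e.1))))

/-- The product has integral zero by normalization, so the projection in `rotation` changes nothing.
It is there only to land in the subspace by a continuous linear map. -/
lemma rotation_fst (e u : CotModel n M s μ) :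
    (rotation e u).1.1 = normalized e.1 u.2 * density e.1 :=
  HsZero.proj_coe_of_intL (intL_normalized_mul _ _)

lemma inv_density_mul {e : CotModel n M s μ} (he : e ∈ cotTarget n M s μ) (f : HsR n M s) :
    f * HsR.inv (density e.1) * density e.1 = f := HsR.ext fun x => by
  have h : (density e.1) x ≠ 0 := (he x).ne'
  rw [HsR.mul_apply, HsR.mul_apply, HsR.inv_apply he, mul_assoc, inv_mul_cancel₀ h, mul_one]

/-- The function `-ρ̇/ρ` is already normalized, since its integral against `ρ μ` is `-∫ ρ̇ μ = 0`.
-/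
lemma normalized_rotation {e : CotModel n M s μ} (he : e ∈ cotTarget n M s μ)
    (u : CotModel n M s μ) :
    normalized e.1 (rotation e u).2 = -(u.1.1 * HsR.inv (density e.1)) := by
  refine normalized_mk_of_intL_eq_zero _ ?_
  have h : -(u.1.1 * HsR.inv (density e.1)) * density e.1 = -u.1.1 := by
    refine HsR.ext fun x => ?_
    have h := congrArg (fun f : HsR n M s => f x) (inv_density_mul he u.1.1)
    simp only [HsR.mul_apply, HsR.neg_apply] at h ⊢
    rw [neg_mul, h]
  rw [h, map_neg, HsZero.intL_eq_zero, neg_zero]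

lemma isRotationField_rotation : IsRotationField (rotation (n := n) (M := M) (s := s) (μ := μ)) := by
  intro p r τ hτ
  have hρ : density (cotChart p).1 = p.1.1 := density_densCoord p.1
  have hp : (cotChart p) ∈ cotTarget n M s μ := cotChart.map_source (Set.mem_univ p)
  have hτ1 : HsR.intL μ (τ * density (cotChart p).1) = 0 := by
    rw [hρ, HsR.intL_apply]
    simpa using hτ
  have hinv : ∀ x, HsR.inv (density (cotChart p).1) x = (p.1.1 x)⁻¹ := fun x => by
    rw [HsR.inv_apply hp, hρ]
  refine ⟨_, -(r.1 * HsR.inv (density (cotChart p).1)), rfl, fun x => ?_, fun x => ?_, ?_⟩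
  · have h := rotation_fst (cotChart p) (r, Submodule.Quotient.mk τ)
    have h1 := normalized_mk_of_intL_eq_zero _ hτ1
    have h2 : (rotation (cotChart p) (r, Submodule.Quotient.mk τ)).1.1 = τ * p.1.1 := by
      rw [h, hρ, h1]
    exact (congrArg (fun f : HsR n M s => f x) h2).trans (HsR.mul_apply _ _ _)
  · rw [HsR.neg_apply, HsR.mul_apply, hinv, div_eq_mul_inv]
  · have h0 : ∫ x, r.1 x ∂μ = 0 := r.2
    have h : ∀ x, (-(r.1 * HsR.inv (density (cotChart p).1))) x * p.1.1 x = -r.1 x := fun x => by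
      have hx : p.1.1 x ≠ 0 := (p.1.2.1 x).ne'
      rw [HsR.neg_apply, HsR.mul_apply, hinv]
      field_simp
    simp only [h, integral_neg, h0, neg_zero]

lemma sasakiFisherRao_eq {e : CotModel n M s μ} (he : e ∈ cotTarget n M s μ)
    (u v : CotModel n M s μ) : sasakiFisherRao e u v =
      (1 / 4) * HsR.intL μ (u.1.1 * v.1.1 * HsR.inv (density e.1) +
        normalized e.1 u.2 * normalized e.1 v.2 * density e.1) := by
  rw [sasakiFisherRao, HsR.intL_apply]
  simp only [HsR.add_apply, HsR.mul_apply, HsR.inv_apply he, div_eq_mul_inv]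

/-- The pairing does not depend on the representative, so the one normalized at any chosen density
may be used. In particular, the canonical form can be compared with the metric at that density. -/
lemma pairing_eq (r : HsZero n M s μ) (σ : HsZero n M s μ) (q : HsR n M s ⧸ constants n M s) :
    pairing r q = HsR.intL μ (normalized σ q * r.1) := by
  conv_lhs => rw [← mk_normalized σ q]
  exact integralMul_apply _ _

lemma cotangent_g_symm {e : CotModel n M s μ} (he : e ∈ cotTarget n M s μ)
    (u v : CotModel n M s μ) : sasakiFisherRao e u v = sasakiFisherRao e v u := by
  rw [sasakiFisherRao_eq he, sasakiFisherRao_eq he]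
  congr 2
  refine HsR.ext fun x => ?_
  simp only [HsR.add_apply, HsR.mul_apply]
  ring

lemma cotangent_g_linear {e : CotModel n M s μ} (he : e ∈ cotTarget n M s μ)
    (v : CotModel n M s μ) : IsLinearMap ℝ fun u => sasakiFisherRao e u v := by
  constructor
  · intro u u'
    simp only [sasakiFisherRao_eq he]
    rw [← mul_add, ← map_add]
    congr 2
    refine HsR.ext fun x => ?_
    simp only [Prod.fst_add, Prod.snd_add, map_add, Submodule.coe_add, HsR.add_apply, HsR.mul_apply]
    ring
  · intro c u
    simp only [sasakiFisherRao_eq he]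
    rw [smul_eq_mul, mul_left_comm, ← smul_eq_mul (a := c), ← map_smul]
    congr 2
    refine HsR.ext fun x => ?_
    simp only [Prod.smul_fst, Prod.smul_snd, map_smul, Submodule.coe_smul, HsR.add_apply,
      HsR.mul_apply, HsR.smul_apply]
    ring

/-- The integrand is a sum of two nonnegative continuous terms. If the integral vanishes, so do both
terms, and a class whose normalized representative is zero is itself zero. -/
lemma cotangent_g_pos [μ.IsOpenPosMeasure] {e : CotModel n M s μ} (he : e ∈ cotTarget n M s μ)
    {u : CotModel n M s μ} (hu : u ≠ 0) : 0 < sasakiFisherRao e u u := by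
  have hx : ∀ x, (u.1.1 * u.1.1 * HsR.inv (density e.1) +
      normalized e.1 u.2 * normalized e.1 u.2 * density e.1) x =
      (u.1.1 x) ^ 2 * (density e.1 x)⁻¹ + (normalized e.1 u.2 x) ^ 2 * density e.1 x := fun x => by
    simp only [HsR.add_apply, HsR.mul_apply, HsR.inv_apply he]
    ring
  have h1 : ∀ x, 0 ≤ (u.1.1 x) ^ 2 * (density e.1 x)⁻¹ := fun x =>
    mul_nonneg (sq_nonneg _) (inv_nonneg.2 (he x).le)
  have h2 : ∀ x, 0 ≤ (normalized e.1 u.2 x) ^ 2 * density e.1 x := fun x =>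
    mul_nonneg (sq_nonneg _) (he x).le
  have hn : ∀ x, 0 ≤ (u.1.1 * u.1.1 * HsR.inv (density e.1) +
      normalized e.1 u.2 * normalized e.1 u.2 * density e.1) x := fun x => by
    rw [hx]
    exact add_nonneg (h1 x) (h2 x)
  rw [sasakiFisherRao_eq he]
  refine mul_pos (by norm_num) ((HsR.intL_nonneg hn).lt_of_ne' fun h => hu ?_)
  have h0 := (HsR.intL_eq_zero_iff hn).1 h
  have h3 : ∀ x, (u.1.1 x) ^ 2 * (density e.1 x)⁻¹ + (normalized e.1 u.2 x) ^ 2 * density e.1 x = 0 :=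
    fun x => by rw [← hx, h0, HsR.zero_apply]
  have h4 : u.1 = 0 := Subtype.ext (HsR.ext fun x => by
    have := (add_eq_zero_iff_of_nonneg (h1 x) (h2 x)).1 (h3 x)
    have h6 : density e.1 x ≠ 0 := (he x).ne'
    change u.1.1 x = 0
    simpa only [mul_eq_zero, inv_eq_zero, h6, or_false, pow_eq_zero_iff, ne_eq,
      OfNat.ofNat_ne_zero, not_false_eq_true] using this.1)
  have h5 : normalized e.1 u.2 = 0 := HsR.ext fun x => by
    have := (add_eq_zero_iff_of_nonneg (h1 x) (h2 x)).1 (h3 x)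
    have h6 : density e.1 x ≠ 0 := (he x).ne'
    rw [HsR.zero_apply]
    simpa only [mul_eq_zero, h6, or_false, pow_eq_zero_iff, ne_eq, OfNat.ofNat_ne_zero,
      not_false_eq_true] using this.2
  refine Prod.ext h4 ?_
  rw [← mk_normalized e.1 u.2, h5]
  rfl

lemma cotangent_g_smooth : SmoothOn (cotTarget n M s μ ×ˢ Set.univ)
    fun p : CotModel n M s μ × CotModel n M s μ × CotModel n M s μ =>
      sasakiFisherRao p.1 p.2.1 p.2.2 := by
  let C := CotModel n M s μ
  let L₁ : C × C × C →L[ℝ] C := ContinuousLinearMap.fst ℝ C (C × C)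
  let L₂ : C × C × C →L[ℝ] C :=
    (ContinuousLinearMap.fst ℝ C C).comp (ContinuousLinearMap.snd ℝ C (C × C))
  let L₃ : C × C × C →L[ℝ] C :=
    (ContinuousLinearMap.snd ℝ C C).comp (ContinuousLinearMap.snd ℝ C (C × C))
  let F := ContinuousLinearMap.fst ℝ (HsZero n M s μ) (HsR n M s ⧸ constants n M s)
  let S := ContinuousLinearMap.snd ℝ (HsZero n M s μ) (HsR n M s ⧸ constants n M s)
  let V : Set (C × C × C) := cotTarget n M s μ ×ˢ Set.univ
  have hV : IsOpen V := isOpen_cotTarget.prod isOpen_univ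
  have hρ : SmoothOn V fun p => density p.1.1 := SmoothOn.density (SmoothOn.clm (F.comp L₁))
  have hi : SmoothOn V fun p => HsR.inv (density p.1.1) :=
    SmoothOn.comp HsR.isOpen_positive HsR.smoothOn_inv hρ fun p hp => hp.1
  have h1 : ∀ L : C × C × C →L[ℝ] C, SmoothOn V fun p => (L p).1.1 := fun L =>
    SmoothOn.clm ((HsZero n M s μ).subtypeL.comp (F.comp L))
  have h2 : ∀ L : C × C × C →L[ℝ] C, SmoothOn V fun p => normalized p.1.1 (L p).2 := fun L =>
    SmoothOn.normalized (SmoothOn.clm (F.comp L₁)) (SmoothOn.clm (S.comp L))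
  have h := (((((h1 L₂).hsR_mul (h1 L₃)).hsR_mul hi).add
    (((h2 L₂).hsR_mul (h2 L₃)).hsR_mul hρ)).clm_comp (HsR.intL μ)).clm_comp
      ((1 / 4 : ℝ) • ContinuousLinearMap.id ℝ ℝ)
  refine h.congr hV fun p hp => ?_
  exact sasakiFisherRao_eq hp.1 _ _

lemma rotation_smooth : SmoothOn (cotTarget n M s μ ×ˢ Set.univ)
    fun p : CotModel n M s μ × CotModel n M s μ => rotation p.1 p.2 := by
  let C := CotModel n M s μ
  let F := ContinuousLinearMap.fst ℝ (HsZero n M s μ) (HsR n M s ⧸ constants n M s)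
  let S := ContinuousLinearMap.snd ℝ (HsZero n M s μ) (HsR n M s ⧸ constants n M s)
  let V : Set (C × C) := cotTarget n M s μ ×ˢ Set.univ
  have h1 : SmoothOn V fun p => p.1.1 := SmoothOn.clm (F.comp (ContinuousLinearMap.fst ℝ C C))
  have h2 : SmoothOn V fun p => p.2.2 := SmoothOn.clm (S.comp (ContinuousLinearMap.snd ℝ C C))
  have h3 : SmoothOn V fun p => p.2.1.1 := SmoothOn.clm
    ((HsZero n M s μ).subtypeL.comp (F.comp (ContinuousLinearMap.snd ℝ C C)))
  have hi : SmoothOn V fun p => HsR.inv (density p.1.1) :=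
    SmoothOn.comp HsR.isOpen_positive HsR.smoothOn_inv h1.density fun p hp => hp.1
  exact (((h1.normalized h2).hsR_mul h1.density).clm_comp HsZero.proj).prodMk
    ((h3.hsR_mul hi).neg.clm_comp mkL)

lemma rotation_linear (e : CotModel n M s μ) : IsLinearMap ℝ (rotation e) := by
  constructor
  · intro u v
    refine Prod.ext ?_ ?_
    · change HsZero.proj _ = HsZero.proj _ + HsZero.proj _
      rw [← map_add]
      congr 1
      refine HsR.ext fun x => ?_
      simp only [Prod.snd_add, map_add, HsR.add_apply, HsR.mul_apply]
      ring
    · change mkL _ = mkL _ + mkL _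
      rw [← map_add]
      congr 1
      refine HsR.ext fun x => ?_
      simp only [Prod.fst_add, Submodule.coe_add, HsR.add_apply, HsR.mul_apply, HsR.neg_apply]
      ring
  · intro c u
    refine Prod.ext ?_ ?_
    · change HsZero.proj _ = c • HsZero.proj _
      rw [← map_smul]
      congr 1
      refine HsR.ext fun x => ?_
      simp only [Prod.smul_snd, map_smul, HsR.smul_apply, HsR.mul_apply]
      ring
    · change mkL _ = c • mkL _
      rw [← map_smul]
      congr 1
      refine HsR.ext fun x => ?_
      simp only [Prod.smul_fst, Submodule.coe_smul, HsR.smul_apply, HsR.mul_apply, HsR.neg_apply]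
      ring

lemma rotation_sq {e : CotModel n M s μ} (he : e ∈ cotTarget n M s μ) (u : CotModel n M s μ) :
    rotation e (rotation e u) = -u := by
  refine Prod.ext (Subtype.ext ?_) ?_
  · rw [rotation_fst, normalized_rotation he]
    refine HsR.ext fun x => ?_
    have h := congrArg (fun f : HsR n M s => f x) (inv_density_mul he u.1.1)
    simp only [HsR.mul_apply, HsR.neg_apply, neg_mul] at h ⊢
    rw [h]
    rfl
  · change mkL _ = -u.2
    rw [rotation_fst]
    have h : -(normalized e.1 u.2 * density e.1 * HsR.inv (density e.1)) = -normalized e.1 u.2 :=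
      HsR.ext fun x => by
        have hx : (density e.1) x ≠ 0 := (he x).ne'
        simp only [HsR.mul_apply, HsR.neg_apply, HsR.inv_apply he, mul_assoc, mul_inv_cancel₀ hx,
          mul_one]
    rw [h, map_neg]
    exact congrArg _ (mk_normalized e.1 u.2)

lemma sasakiFisherRao_rotation {e : CotModel n M s μ} (he : e ∈ cotTarget n M s μ)
    (u v : CotModel n M s μ) :
    sasakiFisherRao e (rotation e u) (rotation e v) = sasakiFisherRao e u v := by
  rw [sasakiFisherRao_eq he, sasakiFisherRao_eq he]
  congr 2
  simp only [rotation_fst, normalized_rotation he]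
  refine HsR.ext fun x => ?_
  have hx : (density e.1) x ≠ 0 := (he x).ne'
  simp only [HsR.add_apply, HsR.mul_apply, HsR.neg_apply, HsR.inv_apply he]
  field_simp
  ring

lemma canonicalForm_eq {e : CotModel n M s μ} (he : e ∈ cotTarget n M s μ)
    (u v : CotModel n M s μ) :
    (1 / 4) * canonicalForm u v = sasakiFisherRao e (rotation e u) v := by
  rw [sasakiFisherRao_eq he, canonicalForm, pairing_eq _ e.1, pairing_eq _ e.1, ← map_sub]
  congr 2
  simp only [rotation_fst, normalized_rotation he]
  refine HsR.ext fun x => ?_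
  have hx : (density e.1) x ≠ 0 := (he x).ne'
  simp only [HsR.add_apply, HsR.sub_apply, HsR.mul_apply, HsR.neg_apply, HsR.inv_apply he]
  field_simp
  ring

end CotangentKahler

/-! ### The holomorphic coordinate and integrability. -/

section LogChart

open MeasureTheory

set_option linter.unusedSectionVars false

variable {n : ℕ} {M : Type u} [TopologicalSpace M] [ChartedSpace (EuclideanSpace ℝ (Fin n)) M]
  [CompactSpace M] {s : WithTop ℝ} [IsManifold (𝓡 n) ∞ M] [T2Space M]
  [hs : Fact ((((n : ℝ) / 2 : ℝ) : WithTop ℝ) < s)]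
  [MeasurableSpace M] [BorelSpace M] {μ : Measure M} [IsProbabilityMeasure μ]

instance (p : Submodule ℂ (HsC n M s)) : LocallyConvexSpace ℝ p :=
  (Topology.IsInducing.subtypeVal).locallyConvexSpace (f := p.subtype.restrictScalars ℝ)

instance (p : Submodule ℂ (HsC n M s)) : ContinuousSMul ℝ p :=
  continuousSMul_induced (p.subtype.restrictScalars ℝ)

lemma HsC.intL_one : HsC.intL μ (1 : HsC n M s) = 1 := by
  simp [HsC.intL_apply]

lemma HsC.intL_toHsCL (f : HsR n M s) : HsC.intL μ f.toHsCL = (HsR.intL μ f : ℂ) := by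
  simp only [HsC.intL_apply, HsR.intL_apply, HsR.toHsCL_apply]
  exact integral_complex_ofReal

variable (n M s μ) in
/-- The complex valued functions with integral zero. -/
def HsCZero : Submodule ℂ (HsC n M s) := LinearMap.ker (HsC.intL μ).toLinearMap

/-- The projection `f ↦ f - ∫ f` onto the complex valued functions with integral zero. -/
def HsCZero.proj : HsC n M s →L[ℂ] HsCZero n M s μ :=
  ContinuousLinearMap.codRestrict
    (ContinuousLinearMap.id ℂ _ - (HsC.intL μ).smulRight (1 : HsC n M s)) _ fun f => by
      simp [HsCZero, HsC.intL_one]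

lemma HsCZero.proj_coe (f : HsC n M s) :
    (HsCZero.proj (μ := μ) f).1 = f - HsC.intL μ f • (1 : HsC n M s) := rfl

/-- Functions of integral zero stand for functions modulo complex constants. Every ambiguity met
below, in the normalization of the phase, the scale of `ρ` or the choice of a logarithm, is such a
constant. -/
lemma HsCZero.proj_add_smul_one (f : HsC n M s) (c : ℂ) :
    HsCZero.proj (μ := μ) (f + c • (1 : HsC n M s)) = HsCZero.proj f := by
  refine Subtype.ext ?_
  rw [HsCZero.proj_coe, HsCZero.proj_coe, map_add, map_smul, HsC.intL_one, smul_eq_mul, mul_one,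
    add_smul, add_sub_add_right_eq_sub]

lemma HsCZero.proj_self (g : HsCZero n M s μ) : HsCZero.proj g.1 = g := by
  have h : HsC.intL μ g.1 = 0 := g.2
  refine Subtype.ext ?_
  rw [HsCZero.proj_coe, h, zero_smul, sub_zero]

/-- The projection as a real linear map. -/
def HsCZero.projR : HsC n M s →L[ℝ] HsCZero n M s μ := (HsCZero.proj (μ := μ)).restrictScalars ℝ

lemma normalizedL_mk (θ : HsR n M s) : normalizedL μ (Submodule.Quotient.mk θ) =
    θ - HsR.intL μ θ • HsR.const1 n M s := by
  rw [normalizedL_apply, normalized_mk]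
  congr 3
  exact HsR.ext fun x => by simp

/-- The holomorphic coordinate `(ρ, [θ]) ↦ (log ρ - i θ) / 2`, up to constants. -/
def logCoord (e : CotModel n M s μ) : HsCZero n M s μ :=
  HsCZero.projR (HsC.smulL (1 / 2)
    (HsR.logC (density e.1) - HsC.smulL Complex.I (normalizedL μ e.2).toHsCL))

/-- The unnormalized density `e^(2 Re g)`. -/
def expDensity (g : HsCZero n M s μ) : HsR n M s :=
  HsC.reL (HsC.exp (((2 : ℝ) • HsC.reL g.1 : HsR n M s).toHsCL))

/-- The inverse of the holomorphic coordinate. -/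
def logCoordInv (g : HsCZero n M s μ) : CotModel n M s μ :=
  (HsZero.proj ((HsR.intL μ (expDensity g))⁻¹ • expDensity g), mkL ((-2 : ℝ) • HsC.imL g.1))

lemma expDensity_apply (g : HsCZero n M s μ) (x : M) :
    expDensity g x = Real.exp (2 * (g.1 x).re) := by
  rw [expDensity, HsC.reL_apply, HsC.exp_apply, HsR.toHsCL_apply, Complex.exp_ofReal_re]
  simp

lemma expDensity_pos (g : HsCZero n M s μ) (x : M) : 0 < expDensity g x := by
  rw [expDensity_apply]
  exact Real.exp_pos _

lemma HsR.intL_pos {f : HsR n M s} (hf : f ∈ HsR.positive n M s) : 0 < HsR.intL μ f := by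
  rw [HsR.intL_apply]
  refine (integral_pos_iff_support_of_nonneg (fun x => (hf x).le)
    (integrable_continuousMap f.toMap)).2 ?_
  have h : Function.support (fun x => f x) = Set.univ :=
    Set.eq_univ_of_forall fun x => (hf x).ne'
  rw [h]
  simp

lemma intL_expDensity_pos (g : HsCZero n M s μ) : 0 < HsR.intL μ (expDensity g) :=
  HsR.intL_pos (expDensity_pos g)

lemma density_logCoordInv (g : HsCZero n M s μ) :
    density (logCoordInv g).1 = (HsR.intL μ (expDensity g))⁻¹ • expDensity g := by
  refine HsZero.proj_density _ ?_
  rw [map_smul, smul_eq_mul, inv_mul_cancel₀ (intL_expDensity_pos g).ne']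

lemma logCoordInv_mem (g : HsCZero n M s μ) : logCoordInv g ∈ cotTarget n M s μ := by
  intro x
  rw [density_logCoordInv]
  exact mul_pos (inv_pos.2 (intL_expDensity_pos g)) (expDensity_pos g x)

variable [Nonempty M]

lemma logCoord_smooth : SmoothOn (cotTarget n M s μ) logCoord := by
  let F := ContinuousLinearMap.fst ℝ (HsZero n M s μ) (HsR n M s ⧸ constants n M s)
  let S := ContinuousLinearMap.snd ℝ (HsZero n M s μ) (HsR n M s ⧸ constants n M s)
  have h1 : SmoothOn (cotTarget n M s μ) fun e => HsR.logC (density e.1) :=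
    SmoothOn.comp HsR.isOpen_positive HsR.smoothOn_logC (SmoothOn.clm F).density fun _ he => he
  have h2 : SmoothOn (cotTarget n M s μ) fun e =>
      HsC.smulL Complex.I (normalizedL μ e.2).toHsCL :=
    SmoothOn.clm ((HsC.smulL Complex.I).comp (HsR.toHsCL.comp ((normalizedL μ).comp S)))
  exact ((h1.sub h2).clm_comp (HsC.smulL (1 / 2))).clm_comp HsCZero.projR

lemma logCoordInv_smooth : SmoothOn Set.univ (logCoordInv (n := n) (M := M) (s := s) (μ := μ)) := by
  let I : HsCZero n M s μ →L[ℝ] HsC n M s := (HsCZero n M s μ).subtypeL.restrictScalars ℝ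
  have hE : SmoothOn Set.univ (expDensity (n := n) (M := M) (s := s) (μ := μ)) :=
    (SmoothOn.comp isOpen_univ HsC.smoothOn_exp
      (SmoothOn.clm (HsR.toHsCL.comp ((2 : ℝ) • (HsC.reL.comp I)))) (Set.mapsTo_univ _ _)).clm_comp
      HsC.reL
  have h1 : SmoothOn Set.univ fun g : HsCZero n M s μ => (HsR.intL μ (expDensity g))⁻¹ :=
    SmoothOn.comp isOpen_ne smoothOn_real_inv (hE.clm_comp (HsR.intL μ))
      fun g _ => (intL_expDensity_pos g).ne'
  exact ((h1.smul hE).clm_comp HsZero.proj).prodMk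
    (SmoothOn.clm (mkL.comp ((-2 : ℝ) • (HsC.imL.comp I))))

/-- The projection subtracts a constant `c`. Its real part rescales the density and is undone by
normalizing the integral; its imaginary part shifts the phase by a constant and disappears in the
quotient. -/
lemma logCoordInv_logCoord {e : CotModel n M s μ} (he : e ∈ cotTarget n M s μ) :
    logCoordInv (logCoord e) = e := by
  set θ := normalizedL μ e.2 with hθ
  have h0 : ∃ c : ℂ, ∀ x, (logCoord e).1 x =
      (1 / 2) * ((Real.log (density e.1 x) : ℂ) - Complex.I * (θ x : ℂ)) - c :=
    ⟨HsC.intL μ (HsC.smulL (1 / 2)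
        (HsR.logC (density e.1) - HsC.smulL Complex.I (normalizedL μ e.2).toHsCL)), fun x => by
      change (1 / 2) * (HsR.logC (density e.1) x - Complex.I * (θ x : ℂ)) -
        _ * (1 : HsC n M s) x = _
      rw [HsR.logC_apply he, HsC.one_apply, mul_one]
      rfl⟩
  obtain ⟨c, hc⟩ := h0
  have hE : expDensity (logCoord e) = Real.exp (-2 * c.re) • density e.1 := HsR.ext fun x => by
    rw [expDensity_apply, hc, HsR.smul_apply]
    have : 2 * ((1 / 2) * ((Real.log (density e.1 x) : ℂ) - Complex.I * (θ x : ℂ)) - c).re =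
        -2 * c.re + Real.log (density e.1 x) := by
      simp
      ring
    rw [this, Real.exp_add, Real.exp_log (he x)]
  refine Prod.ext ?_ ?_
  · have h1 : density (logCoordInv (logCoord e)).1 = density e.1 := by
      rw [density_logCoordInv, hE, map_smul, intL_density, smul_smul]
      simp [Real.exp_ne_zero]
    exact Subtype.ext (add_left_cancel h1)
  · change mkL _ = _
    have h2 : (-2 : ℝ) • HsC.imL (logCoord e).1 = θ + (2 * c.im) • HsR.const1 n M s :=
      HsR.ext fun x => by
        rw [HsR.smul_apply, HsC.imL_apply, hc]
        simp
        ring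
    rw [h2, map_add, mkL_apply, mkL_apply, mk_const1_smul, add_zero]
    exact mk_normalizedL e.2

lemma logCoord_logCoordInv (g : HsCZero n M s μ) : logCoord (logCoordInv g) = g := by
  have h : ∃ c : ℂ, HsC.smulL (1 / 2) (HsR.logC (density (logCoordInv g).1) -
      HsC.smulL Complex.I (normalizedL μ (logCoordInv g).2).toHsCL) = g.1 + c • (1 : HsC n M s) := by
    refine ⟨(1 / 2) * ((-Real.log (HsR.intL μ (expDensity g)) : ℝ) +
      Complex.I * (HsR.intL μ ((-2 : ℝ) • HsC.imL g.1) : ℂ)), HsC.ext fun x => ?_⟩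
    have h1 : HsR.logC (density (logCoordInv g).1) x =
        ((-Real.log (HsR.intL μ (expDensity g)) + 2 * (g.1 x).re : ℝ) : ℂ) := by
      rw [HsR.logC_apply (logCoordInv_mem g), density_logCoordInv, HsR.smul_apply,
        Real.log_mul (inv_ne_zero (intL_expDensity_pos g).ne') (expDensity_pos g x).ne',
        Real.log_inv, expDensity_apply, Real.log_exp]
    have h2 : normalizedL μ (logCoordInv g).2 x =
        -2 * (g.1 x).im - HsR.intL μ ((-2 : ℝ) • HsC.imL g.1) := by
      change normalizedL μ (Submodule.Quotient.mk _) x = _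
      rw [normalizedL_mk]
      simp only [HsR.sub_apply, HsR.smul_apply, HsC.imL_apply, HsR.const1_apply, mul_one]
    change (1 / 2) * (HsR.logC (density (logCoordInv g).1) x - Complex.I * ((normalizedL μ
      (logCoordInv g).2 x : ℝ) : ℂ)) = g.1 x + _ * (1 : HsC n M s) x
    rw [h1, h2, HsC.one_apply]
    conv_rhs => rw [← Complex.re_add_im (g.1 x)]
    push_cast
    ring
  obtain ⟨c, hc⟩ := h
  rw [logCoord, hc]
  exact (HsCZero.proj_add_smul_one g.1 c).trans (HsCZero.proj_self g)

/-- The holomorphic coordinate as a homeomorphism. -/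
def logChart : OpenPartialHomeomorph (CotModel n M s μ) (HsCZero n M s μ) where
  toFun := logCoord
  invFun := logCoordInv
  source := cotTarget n M s μ
  target := Set.univ
  map_source' _ _ := Set.mem_univ _
  map_target' g _ := logCoordInv_mem g
  left_inv' _ he := logCoordInv_logCoord he
  right_inv' g _ := logCoord_logCoordInv g
  open_source := isOpen_cotTarget
  open_target := isOpen_univ
  continuousOn_toFun := logCoord_smooth.continuousOn
  continuousOn_invFun := logCoordInv_smooth.continuousOn

lemma curveDeriv_logC_density {e : CotModel n M s μ} (he : e ∈ cotTarget n M s μ)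
    (u : CotModel n M s μ) : CurveDeriv (fun t : ℝ => HsR.logC (density (e + t • u).1))
      (u.1.1 * HsR.inv (density e.1)).toHsCL := by
  have h1 : CurveDeriv (fun t : ℝ => (density (e + t • u).1).toHsCL) u.1.1.toHsCL := by
    refine (CurveDeriv.line (density e.1).toHsCL u.1.1.toHsCL).congr
      (Filter.Eventually.of_forall fun t => HsC.ext fun x => ?_)
    have h : density (e + t • u).1 x = density e.1 x + t * u.1.1 x := by
      simp [add_assoc]
    change ((density (e + t • u).1 x : ℝ) : ℂ) = (density e.1 x : ℂ) + (t : ℂ) * (u.1.1 x : ℂ)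
    rw [h]
    push_cast
    rfl
  have h0 : (density (e + (0 : ℝ) • u).1) = density e.1 := by rw [zero_smul, add_zero]
  have h2 := h1.log (by rw [h0]; exact HsR.toHsCL_mem_rightHalfPlane he)
  rw [h0] at h2
  suffices h3 : (u.1.1 * HsR.inv (density e.1)).toHsCL =
      HsC.exp (-HsR.logC (density e.1)) * u.1.1.toHsCL by
    rw [h3]
    exact h2
  refine HsC.ext fun x => ?_
  rw [HsC.mul_apply, HsC.exp_apply, HsC.neg_apply]
  rw [HsR.logC_apply he, HsR.toHsCL_apply, HsR.toHsCL_apply, HsR.mul_apply, HsR.inv_apply he,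
    ← Complex.ofReal_neg, ← Complex.ofReal_exp, Real.exp_neg, Real.exp_log (he x)]
  push_cast
  ring

lemma curveDeriv_normalizedL (e u : CotModel n M s μ) :
    CurveDeriv (fun t : ℝ => (normalizedL μ (e + t • u).2).toHsCL) (normalizedL μ u.2).toHsCL := by
  refine (CurveDeriv.line (normalizedL μ e.2).toHsCL (normalizedL μ u.2).toHsCL).congr
      (Filter.Eventually.of_forall fun t => ?_)
  simp only [Prod.snd_add, Prod.smul_snd, map_add, map_smul]

/-- The derivative is `(ρ̇/ρ - iθ̇)/2` modulo constants. Differentiation produces the representative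
of `θ̇` normalized at the uniform density, and passing to the one normalized at `e` changes it by a
constant. -/
lemma hasDirDeriv_logCoord {e : CotModel n M s μ} (he : e ∈ cotTarget n M s μ)
    (u : CotModel n M s μ) : HasDirDeriv logCoord e u (HsCZero.projR (HsC.smulL (1 / 2)
      ((u.1.1 * HsR.inv (density e.1)).toHsCL -
        HsC.smulL Complex.I (normalized e.1 u.2).toHsCL))) := by
  have h := (((curveDeriv_logC_density he u).add
    ((curveDeriv_normalizedL e u).clm (-HsC.smulL Complex.I))).clm (HsC.smulL (1 / 2))).clm
      (HsCZero.projR (n := n) (M := M) (s := s) (μ := μ))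
  rw [hasDirDeriv_iff_curveDeriv]
  convert h using 1
  · funext t
    rw [logCoord, sub_eq_add_neg]
    rfl
  · have h1 : HsC.smulL (1 / 2) ((u.1.1 * HsR.inv (density e.1)).toHsCL -
        HsC.smulL Complex.I (normalized e.1 u.2).toHsCL) =
        HsC.smulL (1 / 2) ((u.1.1 * HsR.inv (density e.1)).toHsCL +
          (-HsC.smulL Complex.I) (normalizedL μ u.2).toHsCL) +
          (1 / 2 * (Complex.I * (HsR.intL μ (e.1.1 * normalizedL μ u.2) : ℂ))) •
            (1 : HsC n M s) := by
      rw [normalized_eq]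
      refine HsC.ext fun x => ?_
      simp only [HsC.smulL_apply, HsC.smul_apply, HsC.sub_apply, HsC.add_apply, HsR.toHsCL_apply,
        neg_apply, HsC.neg_apply, HsC.one_apply, HsR.sub_apply, HsR.smul_apply,
        HsR.const1_apply]
      push_cast
      ring
    rw [h1]
    exact HsCZero.proj_add_smul_one _ _

/-- Under `J` the vector `ρ̇/ρ - iθ̇` becomes `θ̇ + iρ̇/ρ = i (ρ̇/ρ - iθ̇)`. The sign of `θ` in the
coordinate is chosen for this: on the wave function, which has the conjugate logarithm, `J` acts as
`-i`. -/
lemma isIntegrableOn_rotation :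
    IsIntegrableOn (cotTarget n M s μ) (rotation (n := n) (M := M) (s := s) (μ := μ)) := by
  intro e he
  refine ⟨HsCZero n M s μ, inferInstance, inferInstance, inferInstance, inferInstance,
    inferInstance, inferInstance, inferInstance, logChart, he, subset_rfl, logCoord_smooth,
    logCoordInv_smooth, fun e he u w h => ?_⟩
  have h1 : w = _ := CurveDeriv.unique (hasDirDeriv_iff_curveDeriv.1 h)
    (hasDirDeriv_iff_curveDeriv.1 (hasDirDeriv_logCoord he u))
  have h2 := hasDirDeriv_logCoord he (rotation e u)
  have h3 : HsCZero.projR (HsC.smulL (1 / 2)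
      (((rotation e u).1.1 * HsR.inv (density e.1)).toHsCL -
        HsC.smulL Complex.I (normalized e.1 (rotation e u).2).toHsCL)) = Complex.I • w := by
    rw [h1]
    change HsCZero.proj _ = Complex.I • HsCZero.proj _
    rw [← map_smul]
    congr 1
    refine HsC.ext fun x => ?_
    rw [rotation_fst, normalized_rotation he]
    have hx : (density e.1) x ≠ 0 := (he x).ne'
    simp only [HsC.smulL_apply, HsC.smul_apply, HsC.sub_apply, HsR.toHsCL_apply, HsR.mul_apply,
      HsR.neg_apply, HsR.inv_apply he, mul_assoc, mul_inv_cancel₀ hx, mul_one]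
    push_cast
    linear_combination (1 / 2) * (normalized e.1 u.2 x : ℂ) * Complex.I_mul_I
  rw [← h3]
  exact h2

end LogChart

/-! ### The cotangent bundle as a Kähler manifold. -/

section CotangentAtlas

open MeasureTheory

set_option linter.unusedSectionVars false

lemma isModelSpace (E : Type u) [AddCommGroup E] [Module ℝ E] [TopologicalSpace E]
    [IsTopologicalAddGroup E] [ContinuousSMul ℝ E] [LocallyConvexSpace ℝ E] [T2Space E] :
    IsModelSpace E := ⟨inferInstance, inferInstance, inferInstance, inferInstance⟩

variable {n : ℕ} {M : Type u} [TopologicalSpace M] [ChartedSpace (EuclideanSpace ℝ (Fin n)) M]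
  [CompactSpace M] {s : WithTop ℝ} [IsManifold (𝓡 n) ∞ M] [T2Space M]
  [hs : Fact ((((n : ℝ) / 2 : ℝ) : WithTop ℝ) < s)]
  [MeasurableSpace M] [BorelSpace M] {μ : Measure M} [IsProbabilityMeasure μ]

lemma continuous_cotChart : Continuous (cotChart (n := n) (M := M) (s := s) (μ := μ)) := by
  have h1 : Continuous fun p : CotDens n M s μ => p.1.1 - HsR.const1 n M s := by fun_prop
  exact (h1.subtype_mk fun p => (densCoord p.1).2).prodMk continuous_snd

lemma continuousOn_cotChart_symm :
    ContinuousOn (cotChart (n := n) (M := M) (s := s) (μ := μ)).symm (cotTarget n M s μ) := by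
  rw [continuousOn_iff_continuous_domRestrict]
  have h1 : Continuous fun e : cotTarget n M s μ => HsR.const1 n M s + e.1.1.1 := by fun_prop
  have h2 := (h1.subtype_mk (p := fun ρ : HsR n M s => (∀ x, 0 < ρ x) ∧ ∫ x, ρ x ∂μ = 1)
    fun e => ⟨e.2, integral_density e.1.1⟩).prodMk
    (continuous_snd.comp continuous_subtype_val)
  refine h2.congr fun e => ?_
  refine Prod.ext ?_ rfl
  exact (densOfCoord_of_pos e.2).symm

variable [Nonempty M]

lemma isKahlerOn_cotTarget [μ.IsOpenPosMeasure] : IsKahlerOn (cotTarget n M s μ)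
    sasakiFisherRao (fun _ u v => (1 / 4) * canonicalForm u v) rotation :=
  IsKahlerOn.of_metric isOpen_cotTarget cotangent_g_smooth (fun _ he => cotangent_g_symm he)
    (fun _ he => cotangent_g_linear he) (fun _ he _ hu => cotangent_g_pos he hu)
    -- In the global chart the canonical form has constant coefficients, so every derivative
    -- vanishes.
    (fun _ _ u v w => by simp) rotation_smooth (fun e _ => rotation_linear e)
    (fun _ he => rotation_sq he) isIntegrableOn_rotation
    (fun _ he => sasakiFisherRao_rotation he) (fun _ he => canonicalForm_eq he)

lemma isKahler_cotDensAtlas [μ.IsOpenPosMeasure] :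
    (cotDensAtlas (n := n) (M := M) (s := s) (μ := μ) rotation).IsKahler where
  t2 := inferInstance
  modelSpace _ := isModelSpace (CotModel n M s μ)
  cover _ := ⟨PUnit.unit, Set.mem_univ _⟩
  isOpen_source _ := isOpen_univ
  isOpen_target _ := isOpen_cotTarget
  continuousOn_chart _ := continuous_cotChart.continuousOn
  continuousOn_symm _ := continuousOn_cotChart_symm
  smooth_transition i j := by
    have h : {x | x ∈ (cotChart (n := n) (M := M) (s := s) (μ := μ)).target ∧
        id (cotChart.symm x) ∈ (cotChart (n := n) (M := M) (s := s) (μ := μ)).source} =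
        cotTarget n M s μ := Set.ext fun e => ⟨fun he => he.1, fun he => ⟨he, Set.mem_univ _⟩⟩
    change SmoothOn {x | x ∈ (cotChart (n := n) (M := M) (s := s) (μ := μ)).target ∧
        id (cotChart.symm x) ∈ (cotChart (n := n) (M := M) (s := s) (μ := μ)).source} _
    rw [h]
    exact (SmoothOn.clm (ContinuousLinearMap.id ℝ (CotModel n M s μ))).congr isOpen_cotTarget
      fun e he => cotChart.right_inv he
  compatible := by
    rintro i j (e : CotModel n M s μ) (he : e ∈ cotTarget n M s μ) -
    have h0 : cotChart (cotChart.symm e) = e := cotChart.right_inv he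
    -- The only transition map is the identity on the open target, and limits are unique. So the
    -- derivative relation is an equality of vectors.
    have key : ∀ u u' : CotModel n M s μ,
        HasDirDeriv (fun y => cotChart (cotChart.symm y)) e u u' ↔ u' = u := by
      intro u u'
      have h1 : HasDirDeriv (fun y : CotModel n M s μ => cotChart (cotChart.symm y)) e u u :=
        HasDirDeriv.congr (f := id) isOpen_cotTarget (fun y hy => cotChart.right_inv hy) he
          (hasDirDeriv_iff_curveDeriv.2 (CurveDeriv.line e u))
      exact ⟨fun h => tendsto_nhds_unique h h1, fun h => h ▸ h1⟩
    refine ⟨fun u v u' v' hu hv => ?_, fun u u' hu => ?_⟩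
    · obtain rfl := (key _ _).1 hu
      obtain rfl := (key _ _).1 hv
      change sasakiFisherRao (cotChart (cotChart.symm e)) _ _ = _ ∧ _
      rw [h0]
      exact ⟨rfl, rfl⟩
    · obtain rfl := (key _ _).1 hu
      refine (key _ _).2 ?_
      change rotation (cotChart (cotChart.symm e)) _ = _
      rw [h0]
      rfl
  kahlerOn _ := isKahlerOn_cotTarget

end CotangentAtlas

/-! ### The Fubini-Study form. -/

section FubiniStudy

open MeasureTheory

set_option linter.unusedSectionVars false

lemma SmoothOn.complex_mul {E : Type u} [AddCommGroup E] [Module ℝ E] [TopologicalSpace E]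
    {U : Set E} {f g : E → ℂ} (hf : SmoothOn U f) (hg : SmoothOn U g) :
    SmoothOn U fun x => f x * g x :=
  SmoothOn.bilin (LinearMap.mul ℝ ℂ) continuous_mul hf hg

variable {n : ℕ} {M : Type u} [TopologicalSpace M] [ChartedSpace (EuclideanSpace ℝ (Fin n)) M]
  [CompactSpace M] {s : WithTop ℝ} [IsManifold (𝓡 n) ∞ M] [T2Space M]
  [hs : Fact ((((n : ℝ) / 2 : ℝ) : WithTop ℝ) < s)]
  [MeasurableSpace M] [BorelSpace M] {μ : Measure M} [IsProbabilityMeasure μ]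

lemma ip_eq (ψ φ : HsC n M s) : ip μ ψ φ = HsC.intL μ (φ * HsC.conjL ψ) := by
  rw [HsC.intL_apply]
  simp only [HsC.mul_apply, HsC.conjL_apply]
  rfl

lemma conj_ip (ψ φ : HsC n M s) : conj (ip μ ψ φ) = ip μ φ ψ := by
  change conj (∫ x, φ x * conj (ψ x) ∂μ) = ∫ x, ψ x * conj (φ x) ∂μ
  rw [← integral_conj]
  refine integral_congr_ae (Filter.Eventually.of_forall fun x => ?_)
  simp [mul_comm]

lemma ip_add_left (ψ ψ' φ : HsC n M s) : ip μ (ψ + ψ') φ = ip μ ψ φ + ip μ ψ' φ := by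
  rw [← conj_ip, map_add, map_add, conj_ip, conj_ip]

lemma ip_smul_left (c : ℂ) (ψ φ : HsC n M s) : ip μ (c • ψ) φ = conj c * ip μ ψ φ := by
  rw [← conj_ip, map_smul, smul_eq_mul, map_mul, conj_ip]

lemma ip_conjL (ψ φ : HsC n M s) : ip μ (HsC.conjL ψ) (HsC.conjL φ) = conj (ip μ ψ φ) := by
  change ∫ x, conj (φ x) * conj (conj (ψ x)) ∂μ = conj (∫ x, φ x * conj (ψ x) ∂μ)
  rw [← integral_conj]
  simp

variable (n M s μ) in
/-- The inner product as a real bilinear map. -/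
def ipBilin : HsC n M s →ₗ[ℝ] HsC n M s →ₗ[ℝ] ℂ :=
  LinearMap.mk₂ ℝ (fun φ ψ => ip μ ψ φ) (fun _ _ _ => map_add _ _ _)
    (fun c f g => by
      rw [HsC.real_smul_eq, map_smul]
      simp)
    (fun _ _ _ => ip_add_left _ _ _)
    (fun c f g => by
      rw [HsC.real_smul_eq, ip_smul_left]
      simp)

lemma continuous_ipBilin :
    Continuous fun p : HsC n M s × HsC n M s => ipBilin n M s μ p.1 p.2 := by
  have h : Continuous fun p : HsC n M s × HsC n M s => HsC.intL μ (p.1 * HsC.conjL p.2) := by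
    fun_prop
  exact h.congr fun p => (ip_eq p.2 p.1).symm

lemma SmoothOn.ip {E : Type w} [AddCommGroup E] [Module ℝ E] [TopologicalSpace E] {U : Set E}
    {f g : E → HsC n M s} (hf : SmoothOn U f) (hg : SmoothOn U g) :
    SmoothOn U fun x => ip μ (f x) (g x) :=
  SmoothOn.bilin (ipBilin n M s μ) continuous_ipBilin hg hf

/-- The linear form `⟨·, ψ⟩` is continuous. -/
def ipL (μ : Measure M) [IsProbabilityMeasure μ] (ψ : HsC n M s) : HsC n M s →L[ℂ] ℂ where
  toLinearMap := ip μ ψ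
  cont := continuous_ipBilin.comp (continuous_id.prodMk continuous_const)

/-- The `L²` norm squared. -/
def normSqL2 (μ : Measure M) (ψ : HsC n M s) : ℝ := ∫ x, ‖ψ x‖ ^ 2 ∂μ

lemma ip_self (ψ : HsC n M s) : ip μ ψ ψ = normSqL2 μ ψ := by
  rw [normSqL2, ← integral_complex_ofReal]
  refine integral_congr_ae (Filter.Eventually.of_forall fun x => ?_)
  simp [Complex.mul_conj, Complex.normSq_eq_norm_sq]

lemma normSqL2_pos [μ.IsOpenPosMeasure] {ψ : HsC n M s} (h : ψ ≠ 0) : 0 < normSqL2 μ ψ := by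
  obtain ⟨x, hx⟩ : ∃ x, ψ x ≠ 0 := by
    by_contra! h1
    exact h (HsC.ext h1)
  exact Continuous.integral_pos_of_hasCompactSupport_nonneg_nonzero
    (ψ.toMap.continuous.norm.pow 2) (HasCompactSupport.of_compactSpace _)
    (fun _ => sq_nonneg _) (x := x) (by simpa using hx)

lemma ip_self_ne_zero [μ.IsOpenPosMeasure] {ψ : HsC n M s} (h : ψ ≠ 0) : ip μ ψ ψ ≠ 0 := by
  rw [ip_self]
  exact_mod_cast (normSqL2_pos h).ne'

lemma fubiniStudy_add_left (ψ u u' v : HsC n M s) :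
    fubiniStudy μ ψ (u + u') v = fubiniStudy μ ψ u v + fubiniStudy μ ψ u' v := by
  simp only [fubiniStudy, map_add]
  ring

lemma fubiniStudy_smul_left (c : ℂ) (ψ u v : HsC n M s) :
    fubiniStudy μ ψ (c • u) v = c * fubiniStudy μ ψ u v := by
  simp only [fubiniStudy, map_smul, smul_eq_mul]
  ring

lemma conj_fubiniStudy (ψ u v : HsC n M s) :
    conj (fubiniStudy μ ψ u v) = fubiniStudy μ ψ v u := by
  simp only [fubiniStudy, map_sub, map_div₀, map_mul, map_pow, conj_ip]
  ring

lemma fubiniStudy_smul_right (c : ℂ) (ψ u v : HsC n M s) :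
    fubiniStudy μ ψ u (c • v) = conj c * fubiniStudy μ ψ u v := by
  rw [← conj_fubiniStudy, fubiniStudy_smul_left, map_mul, conj_fubiniStudy]

/-- The Fubini-Study form descends to the projective space. -/
lemma fubiniStudy_invariant [μ.IsOpenPosMeasure] {ψ : HsC n M s} (hψ : ψ ≠ 0) {l : ℂ} (hl : l ≠ 0)
    (c d : ℂ) (u v : HsC n M s) :
    fubiniStudy μ (l • ψ) (l • u + c • ψ) (l • v + d • ψ) = fubiniStudy μ ψ u v := by
  have hN := ip_self_ne_zero (μ := μ) hψ
  have hl' : conj l ≠ 0 := by simpa using hl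
  simp only [fubiniStudy, map_add, map_smul, ip_add_left, ip_smul_left, smul_eq_mul]
  field_simp
  ring

/-- The value is the squared `L²` norm of the component of `u` orthogonal to `ψ`, relative to that
of `ψ`. It vanishes only for multiples of `ψ`. -/
lemma fubiniStudy_self [μ.IsOpenPosMeasure] {ψ : HsC n M s} (hψ : ψ ≠ 0) (u : HsC n M s) :
    fubiniStudy μ ψ u u = ((normSqL2 μ (u - (ip μ ψ u / ip μ ψ ψ) • ψ) /
      normSqL2 μ ψ : ℝ) : ℂ) := by
  have hN := ip_self_ne_zero (μ := μ) hψ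
  rw [Complex.ofReal_div, ← ip_self, ← ip_self, sub_eq_add_neg, ← neg_smul]
  simp only [fubiniStudy, map_add, map_smul, ip_add_left, ip_smul_left, smul_eq_mul, map_neg,
    map_div₀, conj_ip]
  field_simp
  ring

lemma hasDerivAt_fubiniStudy [μ.IsOpenPosMeasure] {ψ : HsC n M s} (hψ : ψ ≠ 0)
    (u v z : HsC n M s) :
    HasDerivAt (fun t : ℝ => fubiniStudy μ (ψ + t • u) v z)
      (-ip μ z v * (ip μ ψ u + ip μ u ψ) / ip μ ψ ψ ^ 2 -
        (ip μ u v * ip μ z ψ + ip μ ψ v * ip μ z u) /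
          ip μ ψ ψ ^ 2 +
        2 * ip μ ψ v * ip μ z ψ * (ip μ ψ u + ip μ u ψ) /
          ip μ ψ ψ ^ 3) 0 := by
  have hN := ip_self_ne_zero (μ := μ) hψ
  have ht : HasDerivAt (fun t : ℝ => (t : ℂ)) 1 0 := Complex.ofRealCLM.hasDerivAt
  have h1 : HasDerivAt (fun t : ℝ => ip μ (ψ + t • u) v) (ip μ u v) 0 := by
    have h := (ht.mul_const (ip μ u v)).const_add (ip μ ψ v)
    rw [one_mul] at h
    refine h.congr_of_eventuallyEq (Filter.Eventually.of_forall fun t => ?_)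
    simp only [ip_add_left, HsC.real_smul_eq, ip_smul_left, Complex.conj_ofReal]
  have h2 : ∀ z, HasDerivAt (fun t : ℝ => ip μ z (ψ + t • u)) (ip μ z u) 0 := by
    intro z
    have h := (ht.mul_const (ip μ z u)).const_add (ip μ z ψ)
    rw [one_mul] at h
    refine h.congr_of_eventuallyEq (Filter.Eventually.of_forall fun t => ?_)
    simp only [map_add, HsC.real_smul_eq, map_smul, smul_eq_mul]
  have h3 : HasDerivAt (fun t : ℝ => ip μ (ψ + t • u) (ψ + t • u))
      (ip μ ψ u + ip μ u ψ) 0 := by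
    have hb : HasDerivAt (fun t : ℝ => ip μ ψ ψ + (t : ℂ) * (ip μ ψ u +
        ip μ u ψ) + (t : ℂ) * (t : ℂ) * ip μ u u)
        (ip μ ψ u + ip μ u ψ) 0 := by
      have h := ((ht.mul_const (ip μ ψ u + ip μ u ψ)).const_add
        (ip μ ψ ψ)).add ((ht.mul ht).mul_const (ip μ u u))
      exact h.congr_deriv (by simp)
    refine hb.congr_of_eventuallyEq (Filter.Eventually.of_forall fun t => ?_)
    simp only [map_add, HsC.real_smul_eq, map_smul, smul_eq_mul, ip_add_left, ip_smul_left,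
      Complex.conj_ofReal]
    ring
  have h0 : ψ + (0 : ℝ) • u = ψ := by rw [zero_smul, add_zero]
  have h := ((hasDerivAt_const (0 : ℝ) (ip μ z v)).div h3 (by rwa [h0])).sub
    ((h1.mul (h2 z)).div (h3.pow 2) (by rw [Pi.pow_apply, h0]; exact pow_ne_zero 2 hN))
  refine (h.congr_deriv ?_)
  simp only [Pi.mul_apply, Pi.pow_apply, h0]
  field_simp
  ring

/-- The cyclic sum of the derivatives of the full Hermitian form is real: conjugation exchanges the
arguments of every inner product and leaves the sum unchanged. Its imaginary part is therefore zero.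
-/
lemma fubiniStudy_closed [μ.IsOpenPosMeasure] {ψ : HsC n M s} (hψ : ψ ≠ 0) (u v z : HsC n M s) :
    deriv (fun t : ℝ => (fubiniStudy μ (ψ + t • u) v z).im) 0 +
      deriv (fun t : ℝ => (fubiniStudy μ (ψ + t • v) z u).im) 0 +
      deriv (fun t : ℝ => (fubiniStudy μ (ψ + t • z) u v).im) 0 = 0 := by
  have him : ∀ {f : ℝ → ℂ} {d : ℂ}, HasDerivAt f d 0 → deriv (fun t => (f t).im) 0 = d.im :=
    fun h => (Complex.imCLM.hasFDerivAt.comp_hasDerivAt 0 h).deriv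
  rw [him (hasDerivAt_fubiniStudy hψ u v z), him (hasDerivAt_fubiniStudy hψ v z u),
    him (hasDerivAt_fubiniStudy hψ z u v), ← Complex.add_im, ← Complex.add_im,
    ← Complex.conj_eq_iff_im]
  simp only [map_add, map_sub, map_div₀, map_mul, map_neg, map_pow, conj_ip, Complex.conj_ofNat]
  ring

end FubiniStudy

/-! ### The Kähler structure in an affine chart of the projective space. -/

section ProjectiveKahler

open MeasureTheory

set_option linter.unusedSectionVars false

variable {n : ℕ} {M : Type u} [TopologicalSpace M] [ChartedSpace (EuclideanSpace ℝ (Fin n)) M]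
  [CompactSpace M] {s : WithTop ℝ} [IsManifold (𝓡 n) ∞ M] [T2Space M]
  [hs : Fact ((((n : ℝ) / 2 : ℝ) : WithTop ℝ) < s)]
  [MeasurableSpace M] [BorelSpace M] {μ : Measure M} [IsProbabilityMeasure μ]

lemma HsC.real_smul_coe (p : Submodule ℂ (HsC n M s)) (t : ℝ) (f : p) :
    (t • f : p).1 = t • f.1 := rfl

/-- The inclusion of a complex subspace as a real linear map. -/
def inclR (p : Submodule ℂ (HsC n M s)) : p →L[ℝ] HsC n M s := p.subtypeL.restrictScalars ℝ

lemma affine_add_smul (ψ₀ : UnitSphere n M s μ) (w u : perp ψ₀) (t : ℝ) :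
    ψ₀.1 + (w + t • u).1 = (ψ₀.1 + w.1) + t • u.1 := (add_assoc _ _ _).symm

lemma perp_g_smooth [μ.IsOpenPosMeasure] (ψ₀ : UnitSphere n M s μ) :
    SmoothOn (Set.univ ×ˢ Set.univ) fun p : perp ψ₀ × perp ψ₀ × perp ψ₀ =>
      (fubiniStudy μ (ψ₀.1 + p.1.1) p.2.1.1 p.2.2.1).re := by
  let P := perp ψ₀
  let V : Set (P × P × P) := Set.univ ×ˢ Set.univ
  let L₁ : P × P × P →L[ℝ] P := ContinuousLinearMap.fst ℝ P (P × P)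
  let L₂ : P × P × P →L[ℝ] P :=
    (ContinuousLinearMap.fst ℝ P P).comp (ContinuousLinearMap.snd ℝ P (P × P))
  let L₃ : P × P × P →L[ℝ] P :=
    (ContinuousLinearMap.snd ℝ P P).comp (ContinuousLinearMap.snd ℝ P (P × P))
  have hψ : SmoothOn V fun p => ψ₀.1 + p.1.1 :=
    (SmoothOn.const _).add (SmoothOn.clm ((inclR P).comp L₁))
  have hu : SmoothOn V fun p => p.2.1.1 := SmoothOn.clm ((inclR P).comp L₂)
  have hv : SmoothOn V fun p => p.2.2.1 := SmoothOn.clm ((inclR P).comp L₃)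
  have hN : SmoothOn V fun p => (ip μ (ψ₀.1 + p.1.1) (ψ₀.1 + p.1.1))⁻¹ :=
    SmoothOn.comp isOpen_ne smoothOn_complex_inv (SmoothOn.ip (μ := μ) hψ hψ)
      fun p _ => ip_self_ne_zero (affine_ne_zero ψ₀ p.1)
  have h := (((SmoothOn.ip (μ := μ) hv hu).complex_mul hN).sub
    (((SmoothOn.ip (μ := μ) hψ hu).complex_mul (SmoothOn.ip (μ := μ) hv hψ)).complex_mul
      (hN.complex_mul hN))).clm_comp Complex.reCLM
  refine h.congr (isOpen_univ.prod isOpen_univ) fun p _ => ?_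
  simp only [fubiniStudy, div_eq_mul_inv, sq, mul_inv]
  rfl

/-- A null vector is a multiple of `ψ₀ + w`. Pairing with `ψ₀` gives `0` for the vector and `1` for
`ψ₀ + w`, so the multiple is zero. -/
lemma perp_g_pos [μ.IsOpenPosMeasure] (ψ₀ : UnitSphere n M s μ) (w : perp ψ₀) {u : perp ψ₀}
    (hu : u ≠ 0) : 0 < (fubiniStudy μ (ψ₀.1 + w.1) u.1 u.1).re := by
  have hψ := affine_ne_zero ψ₀ w
  rw [fubiniStudy_self hψ, Complex.ofReal_re]
  refine div_pos (normSqL2_pos fun h => hu ?_) (normSqL2_pos hψ)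
  have h1 : ip μ ψ₀.1 u.1 = 0 := u.2
  rw [sub_eq_zero] at h
  rw [h, map_smul, ip_affine, smul_eq_mul, mul_one] at h1
  rw [h1, zero_smul] at h
  exact Subtype.ext h

/-- The conjugate of an element of the unit sphere. -/
def UnitSphere.conj (ψ₀ : UnitSphere n M s μ) : UnitSphere n M s μ :=
  ⟨HsC.conjL ψ₀.1, by rw [ip_conjL, ψ₀.2, map_one]⟩

/-- Conjugation between orthogonal complements. -/
def perpConj (ψ₀ : UnitSphere n M s μ) : perp ψ₀ →L[ℝ] perp (UnitSphere.conj ψ₀) where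
  toFun u := ⟨HsC.conjL u.1, by
    have h : ip μ ψ₀.1 u.1 = 0 := u.2
    change ip μ (HsC.conjL ψ₀.1) (HsC.conjL u.1) = 0
    rw [ip_conjL, h, map_zero]⟩
  map_add' u v := Subtype.ext (map_add HsC.conjL u.1 v.1)
  map_smul' c u := Subtype.ext (map_smul HsC.conjL c u.1)
  cont := by
    have h : Continuous fun u : perp ψ₀ => HsC.conjL u.1 := by fun_prop
    exact h.subtype_mk _

lemma HsC.conjL_conjL (f : HsC n M s) : HsC.conjL (HsC.conjL f) = f := HsC.ext fun x => by simp

/-- Conjugation between orthogonal complements, in the other direction. -/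
def perpConjInv (ψ₀ : UnitSphere n M s μ) : perp (UnitSphere.conj ψ₀) →L[ℝ] perp ψ₀ where
  toFun u := ⟨HsC.conjL u.1, by
    have h : ip μ (HsC.conjL ψ₀.1) u.1 = 0 := u.2
    change ip μ ψ₀.1 (HsC.conjL u.1) = 0
    rw [← HsC.conjL_conjL ψ₀.1, ip_conjL, h, map_zero]⟩
  map_add' u v := Subtype.ext (map_add HsC.conjL u.1 v.1)
  map_smul' c u := Subtype.ext (map_smul HsC.conjL c u.1)
  cont := by
    have h : Continuous fun u : perp (UnitSphere.conj ψ₀) => HsC.conjL u.1 := by fun_prop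
    exact h.subtype_mk _

/-- Conjugation as a chart. -/
def perpConjChart (ψ₀ : UnitSphere n M s μ) :
    OpenPartialHomeomorph (perp ψ₀) (perp (UnitSphere.conj ψ₀)) where
  toFun := perpConj ψ₀
  invFun := perpConjInv ψ₀
  source := Set.univ
  target := Set.univ
  map_source' _ _ := Set.mem_univ _
  map_target' _ _ := Set.mem_univ _
  left_inv' u _ := Subtype.ext (HsC.conjL_conjL u.1)
  right_inv' u _ := Subtype.ext (HsC.conjL_conjL u.1)
  open_source := isOpen_univ
  open_target := isOpen_univ
  continuousOn_toFun := (perpConj ψ₀).continuous.continuousOn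
  continuousOn_invFun := (perpConjInv ψ₀).continuous.continuousOn

lemma hasDirDeriv_clm {E F : Type u} [AddCommGroup E] [Module ℝ E] [TopologicalSpace E]
    [IsTopologicalAddGroup E] [ContinuousSMul ℝ E] [AddCommGroup F] [Module ℝ F]
    [TopologicalSpace F] (L : E →L[ℝ] F) (x v : E) : HasDirDeriv L x v (L v) :=
  hasDirDeriv_iff_curveDeriv.2 ((CurveDeriv.line x v).clm L)

/-- The structure is `-i` in the affine coordinate. Composing with complex conjugation gives a chart
in which it is multiplication by `i`. -/
lemma perp_isIntegrableOn (ψ₀ : UnitSphere n M s μ) :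
    IsIntegrableOn Set.univ fun _ u : perp ψ₀ => -(Complex.I • u) := by
  intro x _
  refine ⟨perp (UnitSphere.conj ψ₀), inferInstance, inferInstance, inferInstance, inferInstance,
    inferInstance, inferInstance, inferInstance, perpConjChart ψ₀, Set.mem_univ _,
    Set.subset_univ _, SmoothOn.clm (perpConj ψ₀), SmoothOn.clm (perpConjInv ψ₀),
    fun y _ v w h => ?_⟩
  have h1 : w = perpConj ψ₀ v := tendsto_nhds_unique h (hasDirDeriv_clm (perpConj ψ₀) y v)
  have h2 : Complex.I • w = perpConj ψ₀ (-(Complex.I • v)) := by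
    rw [h1]
    refine Subtype.ext (HsC.ext fun x => ?_)
    change Complex.I * conj (v.1 x) = conj (-(Complex.I * v.1 x))
    simp
  rw [h2]
  exact hasDirDeriv_clm (perpConj ψ₀) y _

lemma isKahlerOn_perp [μ.IsOpenPosMeasure] (ψ₀ : UnitSphere n M s μ) : IsKahlerOn Set.univ
    (fun w u v : perp ψ₀ => (fubiniStudy μ (ψ₀.1 + w.1) u.1 v.1).re)
    (fun w u v : perp ψ₀ => (fubiniStudy μ (ψ₀.1 + w.1) u.1 v.1).im)
    (fun _ u : perp ψ₀ => -(Complex.I • u)) := by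
  have hI : ∀ u : perp ψ₀, (-(Complex.I • u)).1 = (-Complex.I) • u.1 := fun u =>
    (neg_smul Complex.I u.1).symm
  refine IsKahlerOn.of_metric isOpen_univ (perp_g_smooth ψ₀) (fun w _ u v => ?_)
    (fun w _ v => ⟨fun u u' => ?_, fun c u => ?_⟩) (fun w _ u hu => perp_g_pos ψ₀ w hu)
    (fun w _ u v z => ?_) ?_ (fun w _ => ⟨fun u v => ?_, fun c u => ?_⟩) (fun w _ u => ?_)
    (perp_isIntegrableOn ψ₀) (fun w _ u v => ?_) (fun w _ u v => ?_)
  · rw [← conj_fubiniStudy, Complex.conj_re]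
  · rw [Submodule.coe_add, fubiniStudy_add_left, Complex.add_re]
  · rw [HsC.real_smul_coe, HsC.real_smul_eq, fubiniStudy_smul_left, Complex.re_ofReal_mul,
      smul_eq_mul]
  · simp only [affine_add_smul]
    exact fubiniStudy_closed (affine_ne_zero ψ₀ w) u.1 v.1 z.1
  · exact SmoothOn.clm (((-(Complex.I • ContinuousLinearMap.id ℂ (perp ψ₀))).restrictScalars ℝ).comp
      (ContinuousLinearMap.snd ℝ (perp ψ₀) (perp ψ₀)))
  · rw [smul_add, neg_add]
  · rw [smul_comm, ← smul_neg]
  · rw [smul_neg, neg_neg, smul_smul, Complex.I_mul_I, neg_one_smul]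
  · rw [hI, hI, fubiniStudy_smul_left, fubiniStudy_smul_right, ← mul_assoc]
    simp
  · rw [hI, fubiniStudy_smul_left]
    simp

/-- The orthogonal projection onto the complement of `ψ₀`. -/
def perpProj (ψ₀ : UnitSphere n M s μ) : HsC n M s →L[ℂ] perp ψ₀ :=
  ContinuousLinearMap.codRestrict
    (ContinuousLinearMap.id ℂ _ - (ipL μ ψ₀.1).smulRight ψ₀.1) _ fun f => by
      change ip μ ψ₀.1 (f - ip μ ψ₀.1 f • ψ₀.1) = 0
      rw [map_sub, map_smul, ψ₀.2, smul_eq_mul, mul_one, sub_self]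

lemma perpProj_coe (ψ₀ : UnitSphere n M s μ) (f : HsC n M s) :
    (perpProj ψ₀ f).1 = f - ip μ ψ₀.1 f • ψ₀.1 := rfl

/-- Where the coordinate is defined by its formula, it is a scalar reciprocal times the identity,
followed by a continuous linear map. Smoothness is read off from this form. -/
lemma affineCoord_eq_perpProj (ψ₀ : UnitSphere n M s μ) {f : HsC n M s} (h : ip μ ψ₀.1 f ≠ 0) :
    affineCoord ψ₀ f = perpProj ψ₀ ((ip μ ψ₀.1 f)⁻¹ • f) := by
  refine Subtype.ext ?_
  rw [affineCoord_of_ne ψ₀ h, perpProj_coe, map_smul, smul_eq_mul, inv_mul_cancel₀ h, one_smul]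

lemma affineCoord_smul (ψ₀ : UnitSphere n M s μ) {a : ℂ} (ha : a ≠ 0) (f : HsC n M s) :
    affineCoord ψ₀ (a • f) = affineCoord ψ₀ f := by
  by_cases h : ip μ ψ₀.1 f = 0
  · rw [affineCoord, affineCoord, dif_pos h, dif_pos (by rw [map_smul, h, smul_zero])]
  · rw [affineCoord_eq_perpProj ψ₀ h, affineCoord_eq_perpProj ψ₀
      (by rw [map_smul]; exact mul_ne_zero ha h), map_smul (ip μ ψ₀.1), smul_smul, smul_eq_mul,
      mul_inv, mul_comm a⁻¹, mul_assoc, inv_mul_cancel₀ ha, mul_one]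

lemma projChart_mk (ψ₀ : UnitSphere n M s μ) {f : HsC n M s} (hf : f ≠ 0) :
    projChart ψ₀ (ProjHs.mk f hf) = affineCoord ψ₀ f := by
  obtain ⟨a, ha, h⟩ := ProjHs.rep_mk f hf
  change affineCoord ψ₀ _ = _
  rw [h, affineCoord_smul ψ₀ ha]

lemma mem_projChart_source (ψ₀ : UnitSphere n M s μ) {f : HsC n M s} (hf : f ≠ 0) :
    ProjHs.mk f hf ∈ (projChart ψ₀).source ↔ ip μ ψ₀.1 f ≠ 0 := by
  obtain ⟨a, ha, h⟩ := ProjHs.rep_mk f hf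
  change ip μ ψ₀.1 _ ≠ 0 ↔ _
  rw [h, map_smul, smul_eq_mul, mul_ne_zero_iff]
  exact and_iff_right ha

lemma SmoothOn.complex_smul {E : Type w} [AddCommGroup E] [Module ℝ E] [TopologicalSpace E]
    {U : Set E} {c : E → ℂ} {f : E → HsC n M s} (hc : SmoothOn U c) (hf : SmoothOn U f) :
    SmoothOn U fun x => c x • f x :=
  SmoothOn.bilin (LinearMap.mk₂ ℝ (fun (c : ℂ) (f : HsC n M s) => c • f) (fun _ _ _ => add_smul _ _ _)
    (fun _ _ _ => smul_assoc _ _ _) (fun _ _ _ => smul_add _ _ _) (fun _ _ _ => smul_comm _ _ _))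
    continuous_smul hc hf

lemma isOpen_ip_ne_zero (ψ₀ : UnitSphere n M s μ) : IsOpen {f : HsC n M s | ip μ ψ₀.1 f ≠ 0} :=
  isOpen_ne.preimage (ipL μ ψ₀.1).continuous

lemma smoothOn_affineCoord (ψ₀ : UnitSphere n M s μ) :
    SmoothOn {f : HsC n M s | ip μ ψ₀.1 f ≠ 0} (affineCoord ψ₀) := by
  have h1 : SmoothOn {f : HsC n M s | ip μ ψ₀.1 f ≠ 0} fun f => ip μ ψ₀.1 f :=
    SmoothOn.clm ((ipL μ ψ₀.1).restrictScalars ℝ)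
  have h2 : SmoothOn {f : HsC n M s | ip μ ψ₀.1 f ≠ 0} fun f => (ip μ ψ₀.1 f)⁻¹ :=
    SmoothOn.comp isOpen_ne smoothOn_complex_inv h1 fun f hf => hf
  have h3 := (h2.complex_smul (SmoothOn.clm (ContinuousLinearMap.id ℝ _))).clm_comp
    ((perpProj ψ₀).restrictScalars ℝ)
  exact h3.congr (isOpen_ip_ne_zero ψ₀) fun f hf => affineCoord_eq_perpProj ψ₀ hf

/-- The derivative of `affineCoord ψ₀` at `f` in the direction `d`. -/
def affineDeriv (ψ₀ : UnitSphere n M s μ) (f d : HsC n M s) : perp ψ₀ :=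
  perpProj ψ₀ ((ip μ ψ₀.1 f)⁻¹ • d - ((ip μ ψ₀.1 f)⁻¹ ^ 2 * ip μ ψ₀.1 d) • f)

/-- The quotient rule already gives a vector orthogonal to `ψ₀`, so the projection does nothing. The
second term is a multiple of `f`, which the Fubini-Study form does not see. -/
lemma affineDeriv_coe (ψ₀ : UnitSphere n M s μ) {f : HsC n M s} (h : ip μ ψ₀.1 f ≠ 0)
    (d : HsC n M s) : (affineDeriv ψ₀ f d).1 =
      (ip μ ψ₀.1 f)⁻¹ • d + (-((ip μ ψ₀.1 f)⁻¹ ^ 2 * ip μ ψ₀.1 d)) • f := by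
  have h1 : ip μ ψ₀.1 ((ip μ ψ₀.1 f)⁻¹ • d - ((ip μ ψ₀.1 f)⁻¹ ^ 2 * ip μ ψ₀.1 d) • f) = 0 := by
    rw [map_sub, map_smul, map_smul, smul_eq_mul, smul_eq_mul]
    field_simp
    ring
  rw [affineDeriv, perpProj_coe, h1, zero_smul, sub_zero, neg_smul, sub_eq_add_neg]

lemma affineDeriv_smul (ψ₀ : UnitSphere n M s μ) (f d : HsC n M s) (c : ℂ) :
    affineDeriv ψ₀ f (c • d) = c • affineDeriv ψ₀ f d := by
  rw [affineDeriv, affineDeriv, ← map_smul, map_smul (ip μ ψ₀.1), smul_sub, smul_comm c, smul_smul c,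
    smul_eq_mul, mul_left_comm]

lemma curveDeriv_affineCoord (ψ₀ : UnitSphere n M s μ) {γ : ℝ → HsC n M s} {d : HsC n M s}
    (h : CurveDeriv γ d) (h0 : ip μ ψ₀.1 (γ 0) ≠ 0) :
    CurveDeriv (fun t => affineCoord ψ₀ (γ t)) (affineDeriv ψ₀ (γ 0) d) := by
  have hc : CurveDeriv (fun t => ip μ ψ₀.1 (γ t)) (ip μ ψ₀.1 d) :=
    h.clm ((ipL μ ψ₀.1).restrictScalars ℝ)
  have hne : ∀ᶠ t in 𝓝 0, ip μ ψ₀.1 (γ t) ≠ 0 :=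
    (curveDeriv_iff_hasDerivAt.1 hc).continuousAt.eventually_ne h0
  have hci : CurveDeriv (fun t => (ip μ ψ₀.1 (γ t))⁻¹)
      (-(ip μ ψ₀.1 d) / ip μ ψ₀.1 (γ 0) ^ 2) := by
    rw [curveDeriv_iff_hasDerivAt] at hc ⊢
    exact hc.fun_inv h0
  have h1 := (CurveDeriv.bilin (LinearMap.mk₂ ℝ (fun (c : ℂ) (f : HsC n M s) => c • f)
    (fun _ _ _ => add_smul _ _ _) (fun _ _ _ => smul_assoc _ _ _) (fun _ _ _ => smul_add _ _ _)
    (fun _ _ _ => smul_comm _ _ _)) continuous_smul hci h).clm ((perpProj ψ₀).restrictScalars ℝ)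
  have h2 := h1.congr (hne.mono fun t ht => affineCoord_eq_perpProj ψ₀ ht)
  suffices h3 : affineDeriv ψ₀ (γ 0) d = perpProj ψ₀
      ((-(ip μ ψ₀.1 d) / ip μ ψ₀.1 (γ 0) ^ 2) • γ 0 + (ip μ ψ₀.1 (γ 0))⁻¹ • d) by
    rw [h3]
    exact h2
  rw [affineDeriv, sub_eq_add_neg, ← neg_smul, add_comm]
  congr 3
  field_simp

end ProjectiveKahler

/-! ### The projective space as a Kähler manifold. -/

section ProjectiveAtlas

open MeasureTheory

set_option linter.unusedSectionVars false

variable {n : ℕ} {M : Type u} [TopologicalSpace M] [ChartedSpace (EuclideanSpace ℝ (Fin n)) M]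
  [CompactSpace M] {s : WithTop ℝ} [IsManifold (𝓡 n) ∞ M] [T2Space M]
  [hs : Fact ((((n : ℝ) / 2 : ℝ) : WithTop ℝ) < s)]
  [MeasurableSpace M] [BorelSpace M] {μ : Measure M} [IsProbabilityMeasure μ]

/-- In the chart, `f` is divided by `⟨f, ψ₀⟩` and `d` likewise, up to a multiple of `f`. By
invariance the form may be computed on any lift, which gives compatibility of the charts and later
the comparison with the wave function. -/
lemma fubiniStudy_affineDeriv [μ.IsOpenPosMeasure] (ψ₀ : UnitSphere n M s μ) {f : HsC n M s}
    (h : ip μ ψ₀.1 f ≠ 0) (d e : HsC n M s) :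
    fubiniStudy μ (ψ₀.1 + (affineCoord ψ₀ f).1) (affineDeriv ψ₀ f d).1 (affineDeriv ψ₀ f e).1 =
      fubiniStudy μ f d e := by
  have hf : f ≠ 0 := fun h0 => h (by rw [h0, map_zero])
  rw [affineCoord_of_ne ψ₀ h, add_sub_cancel, affineDeriv_coe ψ₀ h, affineDeriv_coe ψ₀ h,
    fubiniStudy_invariant hf (inv_ne_zero h)]

lemma hasDirDeriv_affineCoord (ψ₀ : UnitSphere n M s μ) {E : Type u} [AddCommGroup E] [Module ℝ E]
    [TopologicalSpace E] {F : E → HsC n M s} {x v : E} {d : HsC n M s} (h : HasDirDeriv F x v d)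
    (h0 : ip μ ψ₀.1 (F x) ≠ 0) :
    HasDirDeriv (fun y => affineCoord ψ₀ (F y)) x v (affineDeriv ψ₀ (F x) d) := by
  rw [hasDirDeriv_iff_curveDeriv] at h ⊢
  have hx : F (x + (0 : ℝ) • v) = F x := by rw [zero_smul, add_zero]
  have h1 := curveDeriv_affineCoord ψ₀ h (by rwa [hx])
  rwa [hx] at h1

lemma hasDirDeriv_affine (ψ₀ : UnitSphere n M s μ) (w u : perp ψ₀) :
    HasDirDeriv (fun y : perp ψ₀ => ψ₀.1 + y.1) w u u.1 := by
  rw [hasDirDeriv_iff_curveDeriv]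
  simp only [affine_add_smul]
  exact CurveDeriv.line _ _

namespace ProjHs

/-- The quotient map onto the projective space. -/
def quot (ψ : {ψ : HsC n M s // ψ ≠ 0}) : ProjHs n M s := mk ψ.1 ψ.2

lemma continuous_quot : Continuous (quot (n := n) (M := M) (s := s)) := continuous_coinduced_rng

lemma mk_eq_mk_iff (ψ φ : HsC n M s) (hψ : ψ ≠ 0) (hφ : φ ≠ 0) :
    mk ψ hψ = mk φ hφ ↔ ∃ a : ℂ, a • φ = ψ :=
  Projectivization.mk_eq_mk_iff' ℂ ψ φ hψ hφ

lemma mk_rep (p : ProjHs n M s) : mk p.rep (Projectivization.rep_nonzero p) = p :=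
  Projectivization.mk_rep p

lemma surjective_quot : Function.Surjective (quot (n := n) (M := M) (s := s)) := fun p =>
  ⟨⟨p.rep, Projectivization.rep_nonzero p⟩, mk_rep p⟩

/-- The saturation of an open set is the union of its preimages under nonzero scalings, which are
continuous. -/
lemma isOpenMap_quot : IsOpenMap (quot (n := n) (M := M) (s := s)) := by
  intro U hU
  rw [isOpen_coinduced]
  have h : (fun ψ : {ψ : HsC n M s // ψ ≠ 0} => mk ψ.1 ψ.2) ⁻¹' (quot '' U) =
      ⋃ a : {a : ℂ // a ≠ 0}, (fun ψ : {ψ : HsC n M s // ψ ≠ 0} =>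
        (⟨a.1 • ψ.1, smul_ne_zero a.2 ψ.2⟩ : {ψ : HsC n M s // ψ ≠ 0})) ⁻¹' U := by
    ext ψ
    simp only [Set.mem_preimage, Set.mem_image, Set.mem_iUnion]
    constructor
    · rintro ⟨φ, hφ, h⟩
      obtain ⟨a, ha⟩ := (mk_eq_mk_iff _ _ φ.2 ψ.2).1 h
      have ha0 : a ≠ 0 := fun h0 => φ.2 (by rw [← ha, h0, zero_smul])
      exact ⟨⟨a, ha0⟩, by convert hφ⟩
    · rintro ⟨a, ha⟩
      exact ⟨_, ha, (mk_eq_mk_iff _ _ _ _).2 ⟨a.1, rfl⟩⟩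
  rw [h]
  refine isOpen_iUnion fun a => hU.preimage ?_
  exact (continuous_subtype_val.const_smul a.1).subtype_mk _

lemma isOpenQuotientMap_quot : IsOpenQuotientMap (quot (n := n) (M := M) (s := s)) :=
  ⟨surjective_quot, continuous_quot, isOpenMap_quot⟩

end ProjHs

lemma isOpen_projChart_source (ψ₀ : UnitSphere n M s μ) : IsOpen (projChart ψ₀).source := by
  rw [isOpen_coinduced]
  have h : (fun ψ : {ψ : HsC n M s // ψ ≠ 0} => ProjHs.mk ψ.1 ψ.2) ⁻¹' (projChart ψ₀).source =
      Subtype.val ⁻¹' {f : HsC n M s | ip μ ψ₀.1 f ≠ 0} :=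
    Set.ext fun ψ => mem_projChart_source ψ₀ ψ.2
  rw [h]
  exact (isOpen_ip_ne_zero ψ₀).preimage continuous_subtype_val

lemma continuousOn_projChart (ψ₀ : UnitSphere n M s μ) :
    ContinuousOn (projChart ψ₀) (projChart ψ₀).source := by
  intro p hp
  obtain ⟨ψ, rfl⟩ := ProjHs.surjective_quot p
  refine ContinuousAt.continuousWithinAt ?_
  refine (ProjHs.isOpenQuotientMap_quot.continuousAt_comp_iff).1 ?_
  have h : (projChart ψ₀ ∘ ProjHs.quot : {ψ : HsC n M s // ψ ≠ 0} → perp ψ₀) =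
      affineCoord ψ₀ ∘ Subtype.val := funext fun φ => projChart_mk ψ₀ φ.2
  rw [h]
  exact (((smoothOn_affineCoord ψ₀).continuousOn).continuousAt ((isOpen_ip_ne_zero ψ₀).mem_nhds
    ((mem_projChart_source ψ₀ ψ.2).1 hp))).comp continuous_subtype_val.continuousAt

lemma continuous_projChart_symm (ψ₀ : UnitSphere n M s μ) : Continuous (projChart ψ₀).symm := by
  have h : Continuous fun w : perp ψ₀ => ψ₀.1 + w.1 := by fun_prop
  exact ProjHs.continuous_quot.comp (h.subtype_mk (affine_ne_zero ψ₀))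

/-- The normalization of a nonzero function. -/
lemma exists_unit [μ.IsOpenPosMeasure] {φ : HsC n M s} (hφ : φ ≠ 0) :
    ∃ ψ₀ : UnitSphere n M s μ, ∃ c : ℂ, c ≠ 0 ∧ ψ₀.1 = c • φ := by
  have hN := normSqL2_pos (μ := μ) hφ
  have hc : (((Real.sqrt (normSqL2 μ φ))⁻¹ : ℝ) : ℂ) ≠ 0 := by
    exact_mod_cast inv_ne_zero (Real.sqrt_ne_zero'.2 hN)
  refine ⟨⟨(((Real.sqrt (normSqL2 μ φ))⁻¹ : ℝ) : ℂ) • φ, ?_⟩, _, hc, rfl⟩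
  rw [ip_smul_left, map_smul, ip_self, Complex.conj_ofReal, smul_eq_mul, ← Complex.ofReal_mul,
    ← Complex.ofReal_mul, ← mul_assoc, ← mul_inv, Real.mul_self_sqrt hN.le,
    inv_mul_cancel₀ hN.ne', Complex.ofReal_one]

/-- A vector orthogonal to neither `ψ` nor `φ` is `ψ` itself, or `ψ + φ` when the two are
orthogonal. A common chart separates two points; with equal points the lemma yields the covering
property. -/
lemma exists_common_chart [μ.IsOpenPosMeasure] (p q : ProjHs n M s) :
    ∃ ψ₀ : UnitSphere n M s μ, p ∈ (projChart ψ₀).source ∧ q ∈ (projChart ψ₀).source := by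
  obtain ⟨⟨ψ, hψ⟩, rfl⟩ := ProjHs.surjective_quot p
  obtain ⟨⟨φ, hφ⟩, rfl⟩ := ProjHs.surjective_quot q
  obtain ⟨χ, h1, h2⟩ : ∃ χ : HsC n M s, ip μ χ ψ ≠ 0 ∧ ip μ χ φ ≠ 0 := by
    by_cases h : ip μ ψ φ = 0
    · have h' : ip μ φ ψ = 0 := by rw [← conj_ip, h, map_zero]
      refine ⟨ψ + φ, ?_, ?_⟩
      · rw [ip_add_left, h', add_zero]
        exact ip_self_ne_zero hψ
      · rw [ip_add_left, h, zero_add]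
        exact ip_self_ne_zero hφ
    · exact ⟨ψ, ip_self_ne_zero hψ, h⟩
  have hχ : χ ≠ 0 := by
    rintro rfl
    rw [← conj_ip, map_zero, map_zero] at h1
    exact h1 rfl
  obtain ⟨ψ₀, c, hc, h⟩ := exists_unit (μ := μ) hχ
  have hc' : conj c ≠ 0 := by simpa using hc
  refine ⟨ψ₀, (mem_projChart_source ψ₀ hψ).2 ?_, (mem_projChart_source ψ₀ hφ).2 ?_⟩
  · rw [h, ip_smul_left]
    exact mul_ne_zero hc' h1
  · rw [h, ip_smul_left]
    exact mul_ne_zero hc' h2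

lemma t2Space_projHs (μ : Measure M) [IsProbabilityMeasure μ] [μ.IsOpenPosMeasure] :
    T2Space (ProjHs n M s) := by
  refine ⟨fun p q hpq => ?_⟩
  obtain ⟨ψ₀, hp, hq⟩ := exists_common_chart (μ := μ) p q
  obtain ⟨U, V, hU, hV, hpU, hqV, hUV⟩ := t2_separation
    fun h => hpq ((projChart ψ₀).injOn hp hq h)
  refine ⟨_, _, (continuousOn_projChart ψ₀).isOpen_inter_preimage (isOpen_projChart_source ψ₀) hU,
    (continuousOn_projChart ψ₀).isOpen_inter_preimage (isOpen_projChart_source ψ₀) hV,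
    ⟨hp, hpU⟩, ⟨hq, hqV⟩, ?_⟩
  exact (hUV.preimage _).mono Set.inter_subset_right Set.inter_subset_right

lemma isKahler_projAtlas [μ.IsOpenPosMeasure] : (projAtlas n M s μ).IsKahler where
  t2 := t2Space_projHs μ
  modelSpace ψ₀ := isModelSpace (perp (show UnitSphere n M s μ from ψ₀))
  cover p := let ⟨ψ₀, h, _⟩ := exists_common_chart (μ := μ) p p; ⟨ψ₀, h⟩
  isOpen_source := isOpen_projChart_source
  isOpen_target _ := isOpen_univ
  continuousOn_chart := continuousOn_projChart
  continuousOn_symm ψ₀ := (continuous_projChart_symm ψ₀).continuousOn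
  smooth_transition := by
    intro (ψ₀ : UnitSphere n M s μ) (ψ₁ : UnitSphere n M s μ)
    have hF : SmoothOn {w : perp ψ₀ | ip μ ψ₁.1 (ψ₀.1 + w.1) ≠ 0} fun w => ψ₀.1 + w.1 :=
      (SmoothOn.const _).add (SmoothOn.clm (inclR (perp ψ₀)))
    have h := SmoothOn.comp (isOpen_ip_ne_zero ψ₁) (smoothOn_affineCoord ψ₁) hF fun w hw => hw
    have hfun : (fun w : perp ψ₀ => projChart ψ₁ (id ((projChart ψ₀).symm w))) =
        fun w => affineCoord ψ₁ (ψ₀.1 + w.1) :=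
      funext fun w => projChart_mk ψ₁ (affine_ne_zero ψ₀ w)
    have hset : {w : perp ψ₀ | w ∈ (projChart ψ₀).target ∧
        id ((projChart ψ₀).symm w) ∈ (projChart ψ₁).source} =
        {w : perp ψ₀ | ip μ ψ₁.1 (ψ₀.1 + w.1) ≠ 0} := Set.ext fun w =>
      (and_iff_right (Set.mem_univ w)).trans (mem_projChart_source ψ₁ (affine_ne_zero ψ₀ w))
    change SmoothOn {w : perp ψ₀ | w ∈ (projChart ψ₀).target ∧
        id ((projChart ψ₀).symm w) ∈ (projChart ψ₁).source}
        fun w : perp ψ₀ => projChart ψ₁ (id ((projChart ψ₀).symm w))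
    rw [hfun, hset]
    exact h
  compatible := by
    intro (ψ₀ : UnitSphere n M s μ) (ψ₁ : UnitSphere n M s μ) (w : perp ψ₀) _ hw
    have hw1 : ip μ ψ₁.1 (ψ₀.1 + w.1) ≠ 0 :=
      (mem_projChart_source ψ₁ (affine_ne_zero ψ₀ w)).1 hw
    have hfun : (fun w : perp ψ₀ => projChart ψ₁ (id ((projChart ψ₀).symm w))) =
        fun w => affineCoord ψ₁ (ψ₀.1 + w.1) :=
      funext fun w => projChart_mk ψ₁ (affine_ne_zero ψ₀ w)
    have h0 : projChart ψ₁ (id ((projChart ψ₀).symm w)) = affineCoord ψ₁ (ψ₀.1 + w.1) :=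
      congrFun hfun w
    have key : ∀ (u : perp ψ₀) (u' : perp ψ₁),
        HasDirDeriv (fun w : perp ψ₀ => projChart ψ₁ (id ((projChart ψ₀).symm w))) w u u' ↔
          u' = affineDeriv ψ₁ (ψ₀.1 + w.1) u.1 := by
      intro u u'
      rw [hfun]
      have h1 := hasDirDeriv_affineCoord ψ₁ (hasDirDeriv_affine ψ₀ w u) hw1
      exact ⟨fun h => tendsto_nhds_unique h h1, fun h => h ▸ h1⟩
    refine ⟨fun (u v : perp ψ₀) (u' v' : perp ψ₁) hu hv => ?_,
      fun (u : perp ψ₀) (u' : perp ψ₁) hu => ?_⟩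
    · obtain rfl := (key _ _).1 hu
      obtain rfl := (key _ _).1 hv
      have h2 := fubiniStudy_affineDeriv ψ₁ hw1 u.1 v.1
      rw [← h0] at h2
      exact ⟨congrArg Complex.re h2, congrArg Complex.im h2⟩
    · obtain rfl := (key _ _).1 hu
      refine (key _ _).2 ?_
      change -(Complex.I • affineDeriv ψ₁ (ψ₀.1 + w.1) u.1) =
        affineDeriv ψ₁ (ψ₀.1 + w.1) (-(Complex.I • u)).1
      have h3 : (-(Complex.I • u)).1 = (-Complex.I) • u.1 := (neg_smul Complex.I u.1).symm
      rw [h3, affineDeriv_smul, neg_smul]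
  kahlerOn ψ₀ := isKahlerOn_perp ψ₀

end ProjectiveAtlas

/-! ### Logarithms of wave functions modulo constants. -/

section LogClass

open MeasureTheory

set_option linter.unusedSectionVars false

variable {n : ℕ} {M : Type u} [TopologicalSpace M] [ChartedSpace (EuclideanSpace ℝ (Fin n)) M]
  [CompactSpace M] {s : WithTop ℝ} [IsManifold (𝓡 n) ∞ M] [T2Space M]
  [hs : Fact ((((n : ℝ) / 2 : ℝ) : WithTop ℝ) < s)]
  [MeasurableSpace M] [BorelSpace M] {μ : Measure M} [IsProbabilityMeasure μ] [ConnectedSpace M]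

/-- On a connected space, a continuous logarithm is unique up to a constant. -/
lemma exists_eq_add_const_of_exp_eq {X : Type*} [TopologicalSpace X] [ConnectedSpace X] {a b : X → ℂ}
    (ha : Continuous a) (hb : Continuous b) {c : ℂ}
    (h : ∀ x, Complex.exp (a x) = c * Complex.exp (b x)) : ∃ k : ℂ, ∀ x, a x = b x + k := by
  obtain ⟨x₀⟩ : Nonempty X := inferInstance
  have h1 : ∀ x, ∃ m : ℤ, a x - b x = (a x₀ - b x₀) + m * (2 * Real.pi * Complex.I) := fun x => by
    rw [← Complex.exp_eq_exp_iff_exists_int, Complex.exp_sub, Complex.exp_sub, h, h,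
      mul_div_cancel_right₀ _ (Complex.exp_ne_zero _), mul_div_cancel_right₀ _ (Complex.exp_ne_zero _)]
  choose m hm using h1
  -- The integer is recovered continuously from the difference of the two logarithms, so it is
  -- constant by connectedness.
  have hd : Continuous fun x => ((m x : ℤ) : ℝ) := by
    have h2 : Continuous fun x => ((a x - b x - (a x₀ - b x₀)) / (2 * Real.pi * Complex.I)).re := by
      fun_prop
    refine h2.congr fun x => ?_
    rw [hm x, add_sub_cancel_left, mul_div_cancel_right₀ _ Complex.two_pi_I_ne_zero,
      Complex.intCast_re]
  have hm' : Continuous m := Int.isClosedEmbedding_coe_real.isEmbedding.continuous_iff.2 hd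
  refine ⟨a x₀ - b x₀ + m x₀ * (2 * Real.pi * Complex.I), fun x => ?_⟩
  rw [← PreconnectedSpace.constant inferInstance hm' (x := x) (y := x₀), ← hm x]
  ring

lemma HsC.exp_add (a b : HsC n M s) : HsC.exp (a + b) = HsC.exp a * HsC.exp b := HsC.ext fun x => by
  simp only [HsC.exp_apply, HsC.add_apply, HsC.mul_apply, Complex.exp_add]

lemma HsC.exp_smul_one (c : ℂ) (a : HsC n M s) :
    HsC.exp (a + c • (1 : HsC n M s)) = Complex.exp c • HsC.exp a := HsC.ext fun x => by
  simp only [HsC.exp_apply, HsC.add_apply, HsC.smul_apply, HsC.one_apply, Complex.exp_add, mul_one,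
    mul_comm]

lemma HsC.exp_ne_zero (a : HsC n M s) : HsC.exp a ≠ 0 := fun h => by
  obtain ⟨x⟩ : Nonempty M := inferInstance
  have := congrArg (fun f : HsC n M s => f x) h
  simp only [HsC.exp_apply, HsC.zero_apply] at this
  exact Complex.exp_ne_zero _ this

lemma HsC.eq_add_of_exp_eq {a b : HsC n M s} {c : ℂ} (h : HsC.exp a = c • HsC.exp b) :
    ∃ k : ℂ, a = b + k • (1 : HsC n M s) := by
  obtain ⟨k, hk⟩ := exists_eq_add_const_of_exp_eq a.toMap.continuous b.toMap.continuous (c := c)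
    fun x => by
      rw [← HsC.exp_apply, h, HsC.smul_apply, HsC.exp_apply]
  refine ⟨k, HsC.ext fun x => ?_⟩
  rw [hk, HsC.add_apply, HsC.smul_apply, HsC.one_apply, mul_one]

lemma HsC.smul_exp_mem_range {c : ℂ} (hc : c ≠ 0) (b : HsC n M s) :
    c • HsC.exp b ∈ Set.range (HsC.exp (n := n) (M := M) (s := s)) :=
  ⟨b + Complex.log c • (1 : HsC n M s), by rw [HsC.exp_smul_one, Complex.exp_log hc]⟩

/-- The functions close to `e^b`. -/
def HsC.nearExp (b : HsC n M s) : Set (HsC n M s) :=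
  {ψ | ψ * HsC.exp (-b) ∈ HsC.rightHalfPlane n M s}

lemma HsC.isOpen_nearExp (b : HsC n M s) : IsOpen (HsC.nearExp b) := by
  have h : Continuous fun ψ : HsC n M s => ψ * HsC.exp (-b) := by fun_prop
  exact HsC.isOpen_rightHalfPlane.preimage h

lemma HsC.exp_mem_nearExp (b : HsC n M s) : HsC.exp b ∈ HsC.nearExp b := fun x => by
  rw [← HsC.exp_add, add_neg_cancel, HsC.exp_apply, HsC.zero_apply, Complex.exp_zero]
  exact one_pos

lemma HsC.exp_add_log {b ψ : HsC n M s} (h : ψ ∈ HsC.nearExp b) :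
    HsC.exp (b + HsC.log (ψ * HsC.exp (-b))) = ψ := HsC.ext fun x => by
  have hx : (ψ * HsC.exp (-b)) x ≠ 0 := fun h0 => by
    have := h x
    rw [h0, Complex.zero_re] at this
    exact this.false
  rw [HsC.exp_apply, HsC.add_apply, Complex.exp_add, HsC.log_apply h, Complex.exp_log hx,
    HsC.mul_apply, HsC.exp_apply, HsC.neg_apply, mul_left_comm, ← Complex.exp_add, add_neg_cancel,
    Complex.exp_zero, mul_one]

/-- A function near `e^b` is `e^b` times a function with values in the right half-plane, which has a
logarithm in `H^s`. -/
lemma HsC.isOpen_range_exp : IsOpen (Set.range (HsC.exp (n := n) (M := M) (s := s))) := by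
  refine isOpen_iff_forall_mem_open.2 ?_
  rintro _ ⟨b, rfl⟩
  exact ⟨HsC.nearExp b, fun ψ hψ => ⟨_, HsC.exp_add_log hψ⟩, HsC.isOpen_nearExp b,
    HsC.exp_mem_nearExp b⟩

/-- The conjugate logarithm of a function with a logarithm, up to constants. -/
def logClass (μ : Measure M) [IsProbabilityMeasure μ] (ψ : HsC n M s) : HsCZero n M s μ :=
  HsCZero.projR (HsC.conjL (Function.invFun HsC.exp ψ))

lemma projR_conjL_add_smul_one (b : HsC n M s) (k : ℂ) :
    HsCZero.projR (μ := μ) (HsC.conjL (b + k • (1 : HsC n M s))) =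
      HsCZero.projR (HsC.conjL b) := by
  have h : HsC.conjL (b + k • (1 : HsC n M s)) = HsC.conjL b + conj k • (1 : HsC n M s) :=
    HsC.ext fun x => by
      simp only [HsC.conjL_apply, HsC.add_apply, HsC.smul_apply, HsC.one_apply, map_add, map_mul,
        map_one]
  rw [h]
  exact HsCZero.proj_add_smul_one _ _

lemma exists_add_of_projR_conjL_eq {a b : HsC n M s}
    (h : HsCZero.projR (μ := μ) (HsC.conjL a) = HsCZero.projR (HsC.conjL b)) :
    ∃ k : ℂ, a = b + k • (1 : HsC n M s) := by
  refine ⟨conj (HsC.intL μ (HsC.conjL a) - HsC.intL μ (HsC.conjL b)), HsC.ext fun x => ?_⟩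
  have h1 := congrArg (fun f : HsCZero n M s μ => conj (f.1 x)) h
  change conj (conj (a x) - _ * (1 : HsC n M s) x) = conj (conj (b x) - _ * (1 : HsC n M s) x) at h1
  simp only [HsC.one_apply, mul_one, map_sub, Complex.conj_conj] at h1
  simp only [HsC.add_apply, HsC.smul_apply, HsC.one_apply, mul_one, map_sub]
  linear_combination h1

/-- The logarithm inside `logClass` is an arbitrary choice, but two choices differ by a constant, as
does a change of the scalar `c`. The projection removes both, so `logClass` depends only on the line
of `ψ`. -/
lemma logClass_smul_exp {c : ℂ} (hc : c ≠ 0) (b : HsC n M s) :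
    logClass μ (c • HsC.exp b) = HsCZero.projR (HsC.conjL b) := by
  obtain ⟨k, hk⟩ := HsC.eq_add_of_exp_eq (Function.invFun_eq (HsC.smul_exp_mem_range hc b))
  rw [logClass, hk, projR_conjL_add_smul_one]

lemma logClass_exp (b : HsC n M s) :
    logClass μ (HsC.exp b) = HsCZero.projR (HsC.conjL b) := by
  simpa using logClass_smul_exp (μ := μ) one_ne_zero b

/-- Near `e^b` there is the smooth branch `b + log (ψ e^(-b))`. The class does not depend on the
branch, so it agrees locally with a smooth map although the global choice of logarithms need not be
continuous. -/
lemma smoothOn_logClass :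
    SmoothOn (Set.range (HsC.exp (n := n) (M := M) (s := s))) (logClass μ) := by
  refine SmoothOn.of_locally ?_
  rintro _ ⟨b, rfl⟩
  refine ⟨HsC.nearExp b, fun ψ hψ => ⟨_, HsC.exp_add_log hψ⟩, HsC.isOpen_nearExp b,
    HsC.exp_mem_nearExp b, ?_⟩
  have h1 : SmoothOn (HsC.nearExp b) fun ψ => ψ * HsC.exp (-b) :=
    (SmoothOn.clm (ContinuousLinearMap.id ℝ _)).hsC_mul (SmoothOn.const _)
  have h2 : SmoothOn (HsC.nearExp b) fun ψ => b + HsC.log (ψ * HsC.exp (-b)) :=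
    (SmoothOn.const _).add
      (SmoothOn.comp HsC.isOpen_rightHalfPlane HsC.smoothOn_log h1 fun _ h => h)
  refine ((h2.clm_comp HsC.conjL).clm_comp HsCZero.projR).congr (HsC.isOpen_nearExp b)
    fun ψ hψ => ?_
  conv_lhs => rw [← HsC.exp_add_log hψ]
  exact logClass_exp _

/-- Half the complex logarithm `(log ρ + i θ) / 2` of the wave function. -/
def logWave (e : CotModel n M s μ) : HsC n M s :=
  HsC.smulL (1 / 2) (HsR.logC (density e.1) + HsC.smulL Complex.I (normalizedL μ e.2).toHsCL)

/-- Links the wave function to the holomorphic coordinate: conjugating `(log ρ + iθ)/2` gives `(log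
ρ - iθ)/2`. -/
lemma projR_conjL_logWave {e : CotModel n M s μ} (he : e ∈ cotTarget n M s μ) :
    HsCZero.projR (HsC.conjL (logWave e)) = logCoord e := by
  rw [logCoord]
  congr 1
  refine HsC.ext fun x => ?_
  change conj ((1 / 2) * (HsR.logC (density e.1) x + Complex.I * ((normalizedL μ e.2 x : ℝ) : ℂ))) =
    (1 / 2) * (HsR.logC (density e.1) x - Complex.I * ((normalizedL μ e.2 x : ℝ) : ℂ))
  rw [HsR.logC_apply he]
  simp only [map_mul, map_add, map_div₀, map_one, Complex.conj_ofReal, Complex.conj_I,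
    Complex.conj_ofNat]
  ring

/-- The wave function `√ρ e^(iθ/2)`, for the representative `θ` of integral zero. -/
def wave (e : CotModel n M s μ) : HsC n M s := HsC.exp (logWave e)

lemma wave_mem_range (e : CotModel n M s μ) : wave e ∈ Set.range (HsC.exp (n := n) (M := M) (s := s)) :=
  ⟨_, rfl⟩

lemma wave_ne_zero (e : CotModel n M s μ) : wave e ≠ 0 := HsC.exp_ne_zero _

lemma logClass_smul_wave {c : ℂ} (hc : c ≠ 0) {e : CotModel n M s μ} (he : e ∈ cotTarget n M s μ) :
    logClass μ (c • wave e) = logCoord e :=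
  (logClass_smul_exp hc _).trans (projR_conjL_logWave he)

/-- Every exponential is a wave function up to a scalar: both have the same class, so their
logarithms differ by a constant. -/
lemma wave_logCoordInv {ψ : HsC n M s} (hψ : ψ ∈ Set.range (HsC.exp (n := n) (M := M) (s := s))) :
    ∃ c : ℂ, c • ψ = wave (logCoordInv (logClass μ ψ)) := by
  obtain ⟨b, rfl⟩ := hψ
  have h := projR_conjL_logWave (logCoordInv_mem (logClass μ (HsC.exp b)))
  rw [logCoord_logCoordInv, logClass_exp] at h
  obtain ⟨k, hk⟩ := exists_add_of_projR_conjL_eq h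
  exact ⟨Complex.exp k, by rw [logClass_exp, wave, hk, HsC.exp_smul_one]⟩

lemma smoothOn_wave : SmoothOn (cotTarget n M s μ) wave := by
  let F := ContinuousLinearMap.fst ℝ (HsZero n M s μ) (HsR n M s ⧸ constants n M s)
  let S := ContinuousLinearMap.snd ℝ (HsZero n M s μ) (HsR n M s ⧸ constants n M s)
  have h1 : SmoothOn (cotTarget n M s μ) fun e => HsR.logC (density e.1) :=
    SmoothOn.comp HsR.isOpen_positive HsR.smoothOn_logC (SmoothOn.clm F).density fun _ he => he
  have h2 : SmoothOn (cotTarget n M s μ) fun e =>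
      HsC.smulL Complex.I (normalizedL μ e.2).toHsCL :=
    SmoothOn.clm ((HsC.smulL Complex.I).comp (HsR.toHsCL.comp ((normalizedL μ).comp S)))
  exact SmoothOn.comp (f := logWave) isOpen_univ HsC.smoothOn_exp ((h1.add h2).clm_comp (HsC.smulL (1 / 2)))
    (Set.mapsTo_univ _ _)

end LogClass

/-! ### The Madelung transform as a Kähler isomorphism onto an open subset. -/

section MadelungTransform

open MeasureTheory

set_option linter.unusedSectionVars false

variable {n : ℕ} {M : Type u} [TopologicalSpace M] [ChartedSpace (EuclideanSpace ℝ (Fin n)) M]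
  [CompactSpace M] {s : WithTop ℝ} [IsManifold (𝓡 n) ∞ M] [T2Space M]
  [hs : Fact ((((n : ℝ) / 2 : ℝ) : WithTop ℝ) < s)]
  [MeasurableSpace M] [BorelSpace M] {μ : Measure M} [IsProbabilityMeasure μ] [ConnectedSpace M]

/-- The Madelung transform `(ρ, [θ]) ↦ [√ρ e^(iθ/2)]`. -/
def madelung (p : CotDens n M s μ) : ProjHs n M s :=
  ProjHs.mk (wave (cotChart p)) (wave_ne_zero _)

lemma cotChart_mem (p : CotDens n M s μ) : cotChart p ∈ cotTarget n M s μ :=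
  cotChart.map_source (Set.mem_univ p)

lemma isMadelungTransform_madelung :
    IsMadelungTransform (madelung (n := n) (M := M) (s := s) (μ := μ)) := by
  intro ρ θ
  have hρ : ρ.1 ∈ HsR.positive n M s := ρ.2.1
  refine ⟨HsC.exp (HsC.smulL (1 / 2) (HsR.logC ρ.1 + HsC.smulL Complex.I θ.toHsCL)),
    HsC.exp_ne_zero _, fun x => ?_, ?_⟩
  · rw [HsC.exp_apply]
    change Complex.exp ((1 / 2) * (HsR.logC ρ.1 x + Complex.I * (θ x : ℂ))) = _
    rw [HsR.logC_apply hρ, mul_add, Complex.exp_add]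
    congr 1
    · rw [Real.sqrt_eq_rpow, Real.rpow_def_of_pos (hρ x), mul_comm (Real.log _)]
      push_cast
      rfl
    · congr 1
      ring
  · refine (ProjHs.mk_eq_mk_iff _ _ _ _).2 ?_
    -- The given `θ` and its representative of integral zero differ by `∫ θ μ`, which changes the
    -- wave function by a constant phase.
    refine ⟨Complex.exp (-(1 / 2 * (Complex.I * (HsR.intL μ θ : ℂ)))), ?_⟩
    rw [← HsC.exp_smul_one, wave, logWave]
    congr 1
    change _ = HsC.smulL (1 / 2) (HsR.logC (density (densCoord ρ)) + HsC.smulL Complex.I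
      (normalizedL μ (Submodule.Quotient.mk θ)).toHsCL)
    rw [density_densCoord, normalizedL_mk]
    refine HsC.ext fun x => ?_
    simp only [HsC.smulL_apply, HsC.smul_apply, HsC.add_apply, HsC.one_apply, HsR.toHsCL_apply,
      HsR.sub_apply, HsR.smul_apply, HsR.const1_apply, Complex.ofReal_sub, mul_one]
    ring

lemma continuous_wave_cotChart : Continuous fun p : CotDens n M s μ => wave (cotChart p) :=
  smoothOn_wave.continuousOn.comp_continuous continuous_cotChart cotChart_mem

lemma continuous_madelung : Continuous (madelung (n := n) (M := M) (s := s) (μ := μ)) :=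
  ProjHs.continuous_quot.comp (continuous_wave_cotChart.subtype_mk fun _ => wave_ne_zero _)

lemma injective_madelung : Function.Injective (madelung (n := n) (M := M) (s := s) (μ := μ)) := by
  intro p q h
  obtain ⟨a, ha⟩ := (ProjHs.mk_eq_mk_iff _ _ _ _).1 h
  have ha0 : a ≠ 0 := fun h0 => wave_ne_zero (cotChart p) (by rw [← ha, h0, zero_smul])
  have h1 := logClass_smul_wave ha0 (cotChart_mem q)
  have h2 := logClass_smul_wave one_ne_zero (cotChart_mem p)
  rw [one_smul, ← ha, h1] at h2
  have h3 := congrArg logCoordInv h2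
  rw [logCoordInv_logCoord (cotChart_mem q), logCoordInv_logCoord (cotChart_mem p)] at h3
  exact (cotChart.injOn (Set.mem_univ _) (Set.mem_univ _) h3).symm

/-- The projection to projective space is open and factors near `ψ₀` as `madelung ∘ T` with `T`
continuous. Hence `madelung` maps neighbourhoods of `p` to neighbourhoods of its image. -/
lemma isOpenMap_madelung : IsOpenMap (madelung (n := n) (M := M) (s := s) (μ := μ)) := by
  refine IsOpenMap.of_nhds_le fun p => ?_
  let T : {ψ : HsC n M s // ψ ≠ 0} → CotDens n M s μ := fun ψ =>
    cotChart.symm (logCoordInv (logClass μ ψ.1))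
  let ψ₀ : {ψ : HsC n M s // ψ ≠ 0} := ⟨wave (cotChart p), wave_ne_zero _⟩
  have hT0 : T ψ₀ = p := by
    have h := logClass_smul_wave one_ne_zero (cotChart_mem p)
    rw [one_smul] at h
    change cotChart.symm (logCoordInv (logClass μ (wave (cotChart p)))) = p
    rw [h, logCoordInv_logCoord (cotChart_mem p)]
    exact cotChart.left_inv (Set.mem_univ p)
  have hT : Filter.Tendsto T (𝓝 ψ₀) (𝓝 p) := by
    have h1 : ContinuousAt (fun ψ : {ψ : HsC n M s // ψ ≠ 0} => logClass μ ψ.1) ψ₀ :=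
      ContinuousAt.comp (g := logClass μ) (f := Subtype.val)
        (smoothOn_logClass.continuousOn.continuousAt
          (HsC.isOpen_range_exp.mem_nhds (wave_mem_range (cotChart p))))
        continuous_subtype_val.continuousAt
    have h2 : Continuous (logCoordInv (n := n) (M := M) (s := s) (μ := μ)) :=
      continuousOn_univ.1 logCoordInv_smooth.continuousOn
    have h3 := (continuousOn_cotChart_symm.continuousAt
      (isOpen_cotTarget.mem_nhds (logCoordInv_mem (logClass μ ψ₀.1)))).tendsto.comp
      (h2.continuousAt.tendsto.comp h1.tendsto)
    rw [← hT0]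
    exact h3
  have hev : ∀ᶠ ψ in 𝓝 ψ₀, ProjHs.quot ψ = madelung (T ψ) := by
    filter_upwards [continuous_subtype_val.continuousAt.eventually
      (HsC.isOpen_range_exp.mem_nhds (wave_mem_range (cotChart p)))] with ψ hψ
    obtain ⟨c, hc⟩ := wave_logCoordInv (μ := μ) hψ
    have h : cotChart (T ψ) = logCoordInv (logClass μ ψ.1) :=
      cotChart.right_inv (logCoordInv_mem _)
    refine ((ProjHs.mk_eq_mk_iff _ _ _ _).2 ⟨c, ?_⟩).symm
    rw [h]
    exact hc
  have hmap : 𝓝 (madelung p) = Filter.map ProjHs.quot (𝓝 ψ₀) :=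
    (ProjHs.isOpenMap_quot.map_nhds_eq (ProjHs.continuous_quot.continuousAt (x := ψ₀))).symm
  rw [hmap, Filter.map_congr hev]
  change Filter.map (madelung ∘ T) _ ≤ _
  rw [← Filter.map_map]
  exact Filter.map_mono hT

lemma isOpenEmbedding_madelung :
    Topology.IsOpenEmbedding (madelung (n := n) (M := M) (s := s) (μ := μ)) :=
  .of_continuous_injective_isOpenMap continuous_madelung injective_madelung isOpenMap_madelung

lemma projChart_madelung (ψ₁ : UnitSphere n M s μ) (p : CotDens n M s μ) :
    projChart ψ₁ (madelung p) = affineCoord ψ₁ (wave (cotChart p)) :=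
  projChart_mk ψ₁ (wave_ne_zero _)

lemma madelung_mem_source (ψ₁ : UnitSphere n M s μ) (p : CotDens n M s μ) :
    madelung p ∈ (projChart ψ₁).source ↔ ip μ ψ₁.1 (wave (cotChart p)) ≠ 0 :=
  mem_projChart_source ψ₁ (wave_ne_zero _)

lemma cotChart_cotChart_symm {e : CotModel n M s μ} (he : e ∈ cotTarget n M s μ) :
    cotChart (cotChart.symm e) = e := cotChart.right_inv he

lemma isOpen_wave_domain (ψ₁ : UnitSphere n M s μ) :
    IsOpen {e : CotModel n M s μ | e ∈ cotTarget n M s μ ∧ ip μ ψ₁.1 (wave e) ≠ 0} :=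
  smoothOn_wave.continuousOn.isOpen_inter_preimage isOpen_cotTarget (isOpen_ip_ne_zero ψ₁)

lemma isSmoothMap_madelung : KahlerAtlas.IsSmoothMap
    (cotDensAtlas (n := n) (M := M) (s := s) (μ := μ) rotation) (projAtlas n M s μ) madelung := by
  intro i (ψ₁ : UnitSphere n M s μ)
  have hset : {e : CotModel n M s μ | e ∈ cotTarget n M s μ ∧
      madelung (cotChart.symm e) ∈ (projChart ψ₁).source} =
      {e : CotModel n M s μ | e ∈ cotTarget n M s μ ∧ ip μ ψ₁.1 (wave e) ≠ 0} :=
    Set.ext fun e => and_congr_right fun he => by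
      rw [madelung_mem_source, cotChart_cotChart_symm he]
  change SmoothOn {e : CotModel n M s μ | e ∈ cotTarget n M s μ ∧
      madelung (cotChart.symm e) ∈ (projChart ψ₁).source}
      fun e : CotModel n M s μ => projChart ψ₁ (madelung (cotChart.symm e))
  rw [hset]
  refine (SmoothOn.comp (f := wave) (isOpen_ip_ne_zero ψ₁) (smoothOn_affineCoord ψ₁)
    (smoothOn_wave.mono fun _ he => he.1) fun _ he => he.2).congr (isOpen_wave_domain ψ₁)
    fun e he => ?_
  rw [projChart_madelung, cotChart_cotChart_symm he.1]

/-- The affine coordinate of a line gives the representative `ψ₁ + w`, a multiple of the wave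
function. As `logClass` ignores the multiple, the inverse is `logCoordInv ∘ logClass` on that
representative. -/
lemma madelung_smooth_inverse (ψ₁ : UnitSphere n M s μ) : ∃ h : perp ψ₁ → CotModel n M s μ,
    SmoothOn (projChart ψ₁ '' {q | q ∈ (projChart ψ₁).source ∧
      q ∈ madelung (n := n) (M := M) (s := s) (μ := μ) '' Set.univ}) h ∧
    ∀ p : CotDens n M s μ, madelung p ∈ (projChart ψ₁).source →
      h (projChart ψ₁ (madelung p)) = cotChart p := by
  have hval : ∀ p : CotDens n M s μ, madelung p ∈ (projChart ψ₁).source →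
      ψ₁.1 + (projChart ψ₁ (madelung p)).1 =
        (ip μ ψ₁.1 (wave (cotChart p)))⁻¹ • wave (cotChart p) := fun p hp => by
    rw [projChart_madelung, affineCoord_of_ne ψ₁ ((madelung_mem_source ψ₁ p).1 hp),
      add_sub_cancel]
  refine ⟨fun w => logCoordInv (logClass μ (ψ₁.1 + w.1)), ?_, fun p hp => ?_⟩
  · have h1 : SmoothOn {w : perp ψ₁ | ψ₁.1 + w.1 ∈ Set.range (HsC.exp (n := n) (M := M) (s := s))}
        fun w => ψ₁.1 + w.1 := (SmoothOn.const _).add (SmoothOn.clm (inclR (perp ψ₁)))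
    refine (SmoothOn.comp isOpen_univ logCoordInv_smooth
      (SmoothOn.comp HsC.isOpen_range_exp (smoothOn_logClass (μ := μ)) h1 fun w hw => hw)
      (Set.mapsTo_univ _ _)).mono ?_
    rintro _ ⟨_, ⟨hq, p, -, rfl⟩, rfl⟩
    change ψ₁.1 + (projChart ψ₁ (madelung p)).1 ∈ Set.range HsC.exp
    rw [hval p hq]
    exact HsC.smul_exp_mem_range (inv_ne_zero ((madelung_mem_source ψ₁ p).1 hq)) _
  · dsimp only
    rw [hval p hp, logClass_smul_wave (inv_ne_zero ((madelung_mem_source ψ₁ p).1 hp))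
      (cotChart_mem p), logCoordInv_logCoord (cotChart_mem p)]

/-- The derivative of the wave function, up to its multiples. -/
def waveFactor (e u : CotModel n M s μ) : HsC n M s :=
  HsC.smulL (1 / 2) ((u.1.1 * HsR.inv (density e.1)).toHsCL +
    HsC.smulL Complex.I (normalized e.1 u.2).toHsCL)

/-- The term `c • wave e` comes from normalizing `θ̇` at `e` instead of at the uniform density. It
is tangent to the fibre and drops out in projective space. -/
lemma hasDirDeriv_wave {e : CotModel n M s μ} (he : e ∈ cotTarget n M s μ) (u : CotModel n M s μ) :
    ∃ c : ℂ, HasDirDeriv wave e u (wave e * waveFactor e u + c • wave e) := by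
  have h := (((curveDeriv_logC_density he u).add
    ((curveDeriv_normalizedL e u).clm (HsC.smulL Complex.I))).clm (HsC.smulL (1 / 2))).exp
  have h0 : e + (0 : ℝ) • u = e := by rw [zero_smul, add_zero]
  refine ⟨1 / 2 * (Complex.I * (HsR.intL μ (e.1.1 * normalizedL μ u.2) : ℂ)), ?_⟩
  rw [hasDirDeriv_iff_curveDeriv]
  suffices h1 : wave e * waveFactor e u +
      (1 / 2 * (Complex.I * (HsR.intL μ (e.1.1 * normalizedL μ u.2) : ℂ))) • wave e =
      wave e * HsC.smulL (1 / 2) ((u.1.1 * HsR.inv (density e.1)).toHsCL +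
        HsC.smulL Complex.I (normalizedL μ u.2).toHsCL) by
    rw [h1]
    rw [h0] at h
    exact h
  refine HsC.ext fun x => ?_
  rw [waveFactor, normalized_eq]
  simp only [HsC.smulL_apply, HsC.smul_apply, HsC.add_apply, HsC.mul_apply, HsR.toHsCL_apply,
    HsR.sub_apply, HsR.smul_apply, HsR.const1_apply, Complex.ofReal_sub, mul_one]
  ring

lemma affineDeriv_add_smul_self (ψ₀ : UnitSphere n M s μ) {f : HsC n M s} (h : ip μ ψ₀.1 f ≠ 0)
    (d : HsC n M s) (c : ℂ) : affineDeriv ψ₀ f (d + c • f) = affineDeriv ψ₀ f d := by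
  refine Subtype.ext ?_
  rw [affineDeriv_coe ψ₀ h, affineDeriv_coe ψ₀ h, smul_add, map_add, map_smul, smul_smul, add_assoc,
    ← add_smul, smul_eq_mul]
  congr 2
  field_simp
  ring

lemma norm_wave_sq {e : CotModel n M s μ} (he : e ∈ cotTarget n M s μ) (x : M) :
    wave e x * conj (wave e x) = (density e.1 x : ℂ) := by
  rw [wave, HsC.exp_apply, ← Complex.exp_conj, ← Complex.exp_add, Complex.add_conj]
  have h : (logWave e x).re = 1 / 2 * Real.log (density e.1 x) := by
    change ((1 / 2) * (HsR.logC (density e.1) x + Complex.I * ((normalizedL μ e.2 x : ℝ) : ℂ))).re = _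
    rw [HsR.logC_apply he]
    simp
  rw [h, ← Complex.ofReal_exp]
  congr 1
  rw [← mul_assoc, mul_one_div_cancel two_ne_zero, one_mul, Real.exp_log (he x)]

lemma ip_wave {e : CotModel n M s μ} (he : e ∈ cotTarget n M s μ) (α β : HsC n M s) :
    ip μ (wave e * β) (wave e * α) = HsC.intL μ ((density e.1).toHsCL * (α * HsC.conjL β)) := by
  rw [ip_eq]
  congr 1
  refine HsC.ext fun x => ?_
  simp only [HsC.mul_apply, HsC.conjL_apply, map_mul, HsR.toHsCL_apply]
  rw [← norm_wave_sq he]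
  ring

/-- The wave function has unit norm, and `wave e * waveFactor e u` is orthogonal to it because `∫ ρ̇
μ = 0` and `∫ θ̇ ρ μ = 0`. What remains is `¼ ∫ ρ (ρ̇₁/ρ + iθ̇₁)(ρ̇₂/ρ - iθ̇₂) μ`, whose real and
imaginary parts are the two forms. -/
lemma fubiniStudy_wave {e : CotModel n M s μ} (he : e ∈ cotTarget n M s μ)
    (u v : CotModel n M s μ) :
    fubiniStudy μ (wave e) (wave e * waveFactor e u) (wave e * waveFactor e v) =
      (sasakiFisherRao e u v : ℂ) + Complex.I * ((1 / 4 * canonicalForm u v : ℝ) : ℂ) := by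
  have hone : wave e = wave e * 1 := HsC.ext fun x => by simp
  have hN : ip μ (wave e) (wave e) = 1 := by
    rw [hone, ip_wave he]
    have h : (density e.1).toHsCL * (1 * HsC.conjL 1) = (density e.1).toHsCL :=
      HsC.ext fun x => by simp
    rw [h, HsC.intL_toHsCL, intL_density, Complex.ofReal_one]
  have hx : ∀ x, (density e.1 x : ℂ) ≠ 0 := fun x => by exact_mod_cast (he x).ne'
  have hz : ip μ (wave e) (wave e * waveFactor e u) = 0 := by
    have h : (density e.1).toHsCL * (waveFactor e u * HsC.conjL 1) = (1 / 2 : ℂ) •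
        (u.1.1.toHsCL + Complex.I • (normalized e.1 u.2 * density e.1).toHsCL) := by
      refine HsC.ext fun x => ?_
      simp only [waveFactor, HsC.smulL_apply, HsC.smul_apply, HsC.add_apply, HsC.mul_apply,
        HsR.toHsCL_apply, HsR.mul_apply, HsC.conjL_apply, HsC.one_apply, map_one, mul_one,
        HsR.inv_apply he, Complex.ofReal_mul, Complex.ofReal_inv]
      have hρ := hx x
      field_simp
    have hip := ip_wave (μ := μ) he (waveFactor e u) 1
    rw [← hone] at hip
    rw [hip, h, map_smul, map_add, map_smul, HsC.intL_toHsCL, HsC.intL_toHsCL,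
      HsZero.intL_eq_zero, intL_normalized_mul]
    simp
  rw [fubiniStudy, hN, hz, zero_mul, zero_div, sub_zero, div_one, ip_wave he, canonicalForm_eq he,
    sasakiFisherRao_eq he, sasakiFisherRao_eq he, rotation_fst, normalized_rotation he]
  have h : (density e.1).toHsCL * (waveFactor e u * HsC.conjL (waveFactor e v)) = (1 / 4 : ℂ) •
      ((u.1.1 * v.1.1 * HsR.inv (density e.1) +
        normalized e.1 u.2 * normalized e.1 v.2 * density e.1).toHsCL + Complex.I •
      (normalized e.1 u.2 * density e.1 * v.1.1 * HsR.inv (density e.1) +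
        -(u.1.1 * HsR.inv (density e.1)) * normalized e.1 v.2 * density e.1).toHsCL) := by
    refine HsC.ext fun x => ?_
    simp only [waveFactor, HsC.smulL_apply, HsC.smul_apply, HsC.add_apply, HsC.mul_apply,
      HsR.toHsCL_apply, HsR.mul_apply, HsR.neg_apply, HsC.conjL_apply,
      HsR.inv_apply he, Complex.ofReal_mul, Complex.ofReal_inv, Complex.ofReal_neg, map_mul, map_add, map_inv₀, map_div₀, map_one, Complex.conj_ofNat,
      Complex.conj_ofReal, Complex.conj_I]
    have hρ := hx x
    field_simp
    linear_combination (-4 * (density e.1 x : ℂ) ^ 2 * (normalized e.1 u.2 x : ℂ) *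
      (normalized e.1 v.2 x : ℂ)) * Complex.I_mul_I
  rw [h, map_smul, map_add, map_smul, HsC.intL_toHsCL, HsC.intL_toHsCL]
  push_cast
  simp only [smul_eq_mul]
  ring

/-- Since `θ̇ - iρ̇/ρ = -i (ρ̇/ρ + iθ̇)`, the rotation acts on the wave function as `-i`. -/
lemma waveFactor_rotation {e : CotModel n M s μ} (he : e ∈ cotTarget n M s μ)
    (u : CotModel n M s μ) : waveFactor e (rotation e u) = (-Complex.I) • waveFactor e u := by
  rw [waveFactor, rotation_fst, normalized_rotation he]
  refine HsC.ext fun x => ?_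
  have hx : (density e.1 x : ℂ) ≠ 0 := by exact_mod_cast (he x).ne'
  simp only [waveFactor, HsC.smulL_apply, HsC.smul_apply, HsC.add_apply, HsR.toHsCL_apply,
    HsR.mul_apply, HsR.neg_apply, HsR.inv_apply he, Complex.ofReal_mul, Complex.ofReal_inv,
    Complex.ofReal_neg]
  field_simp
  linear_combination ((density e.1 x : ℂ) * (normalized e.1 u.2 x : ℂ)) * Complex.I_mul_I

lemma preservesKahler_madelung [μ.IsOpenPosMeasure] : KahlerAtlas.PreservesKahler
    (cotDensAtlas (n := n) (M := M) (s := s) (μ := μ) rotation) (projAtlas n M s μ) madelung := by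
  intro i (ψ₁ : UnitSphere n M s μ) (e : CotModel n M s μ) (he : e ∈ cotTarget n M s μ) hs1
  have h1 : ip μ ψ₁.1 (wave e) ≠ 0 := by
    have h := (madelung_mem_source ψ₁ (cotChart.symm e)).1 hs1
    rwa [cotChart_cotChart_symm he] at h
  have hfun : ∀ e ∈ cotTarget n M s μ,
      projChart ψ₁ (madelung (cotChart.symm e)) = affineCoord ψ₁ (wave e) := fun e he => by
    rw [projChart_madelung, cotChart_cotChart_symm he]
  -- The derivative of the transform in the charts is the affine derivative of the lift, with the
  -- part along the wave function discarded. Uniqueness of limits turns the derivative relation into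
  -- a formula.
  have key : ∀ (u : CotModel n M s μ) (u' : perp ψ₁),
      HasDirDeriv (fun y : CotModel n M s μ => projChart ψ₁ (madelung (cotChart.symm y))) e u u' ↔
        u' = affineDeriv ψ₁ (wave e) (wave e * waveFactor e u) := by
    intro u u'
    obtain ⟨c, hc⟩ := hasDirDeriv_wave he u
    have h2 := HasDirDeriv.congr isOpen_cotTarget hfun he (hasDirDeriv_affineCoord ψ₁ hc h1)
    rw [affineDeriv_add_smul_self ψ₁ h1] at h2
    exact ⟨fun h => tendsto_nhds_unique h h2, fun h => h ▸ h2⟩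
  refine ⟨fun (u v : CotModel n M s μ) (u' v' : perp ψ₁) hu hv => ?_,
    fun (u : CotModel n M s μ) (u' : perp ψ₁) hu => ?_⟩
  · obtain rfl := (key _ _).1 hu
    obtain rfl := (key _ _).1 hv
    have h2 := fubiniStudy_affineDeriv ψ₁ h1 (wave e * waveFactor e u) (wave e * waveFactor e v)
    rw [← hfun e he, fubiniStudy_wave he] at h2
    have h3 := congrArg Complex.re h2
    have h4 := congrArg Complex.im h2
    constructor
    · refine h3.trans ?_
      simp only [Complex.add_re, Complex.ofReal_re, Complex.mul_re, Complex.I_re, Complex.I_im,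
        Complex.ofReal_im, zero_mul, mul_zero, sub_zero, add_zero]
      rfl
    · refine h4.trans ?_
      simp only [Complex.add_im, Complex.ofReal_re, Complex.mul_im, Complex.I_re, Complex.I_im,
        Complex.ofReal_im, zero_mul, one_mul, zero_add]
      rfl
  · obtain rfl := (key _ _).1 hu
    refine (key _ _).2 ?_
    change -(Complex.I • affineDeriv ψ₁ (wave e) (wave e * waveFactor e u)) =
      affineDeriv ψ₁ (wave e) (wave e * waveFactor e (rotation e u))
    have h2 : wave e * (-Complex.I) • waveFactor e u = (-Complex.I) • (wave e * waveFactor e u) :=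
      HsC.ext fun x => by
        simp only [HsC.mul_apply, HsC.smul_apply]
        ring
    rw [waveFactor_rotation he, h2, affineDeriv_smul, neg_smul]

lemma isKahlerOpenEmbedding_madelung [μ.IsOpenPosMeasure] :
    KahlerAtlas.IsKahlerOpenEmbedding
      (cotDensAtlas (n := n) (M := M) (s := s) (μ := μ) rotation) (projAtlas n M s μ) madelung where
  isOpenEmbedding := isOpenEmbedding_madelung
  smooth := isSmoothMap_madelung
  smooth_inverse _ ψ₁ :=
    let ⟨h, h1, h2⟩ := madelung_smooth_inverse (show UnitSphere n M s μ from ψ₁)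
    ⟨h, h1, fun p _ hp => h2 p hp⟩
  preserves := preservesKahler_madelung

end MadelungTransform

end Madelung

end

theorem mainTheorem3 {n : ℕ} {M : Type*} [TopologicalSpace M] [T2Space M] [CompactSpace M]
    [ConnectedSpace M] [ChartedSpace (EuclideanSpace ℝ (Fin n)) M] [IsManifold (𝓡 n) ∞ M]
    [MeasurableSpace M] [BorelSpace M]
    (μ : MeasureTheory.Measure M) [MeasureTheory.IsProbabilityMeasure μ]
    (hμ : Madelung.IsVolume n μ)
    (s : WithTop ℝ) (hs : (((n : ℝ) / 2 : ℝ) : WithTop ℝ) < s) :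
    ∃ (J : Madelung.CotModel n M s μ → Madelung.CotModel n M s μ → Madelung.CotModel n M s μ)
      (Φ : Madelung.CotDens n M s μ → Madelung.ProjHs n M s),
      Madelung.IsRotationField J ∧
      Madelung.IsMadelungTransform Φ ∧
      (Madelung.cotDensAtlas J).IsKahler ∧
      (Madelung.projAtlas n M s μ).IsKahler ∧
      (Madelung.cotDensAtlas J).IsKahlerOpenEmbedding (Madelung.projAtlas n M s μ) Φ := by
  -- The algebra structure on `H^s` is found by instance search, so the condition `n/2 < s` is
  -- supplied as a `Fact`.
  have : Fact ((((n : ℝ) / 2 : ℝ) : WithTop ℝ) < s) := ⟨hs⟩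
  have : μ.IsOpenPosMeasure := hμ.isOpenPosMeasure
  exact ⟨Madelung.rotation, Madelung.madelung, Madelung.isRotationField_rotation,
    Madelung.isMadelungTransform_madelung, Madelung.isKahler_cotDensAtlas,
    Madelung.isKahler_projAtlas, Madelung.isKahlerOpenEmbedding_madelung⟩
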